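/- Let $W$ be one of the complex cubic Jordan algebras attached to the complex simple Lie groups $G$ not of type $A_\ell$, $C_\ell$, with its cubic form $\mathfrak{C}\in S^3W^*$, that is (up to linear isomorphism): $W=\mathbb{C}$ with $\mathfrak{C}(t^3)=t^3/3$ ($G_2$); the spin factor $W=\mathbb{C}^m\oplus\mathbb{C}$, $m\ge 1$, with $\mathfrak{C}(t^3)=\langle v,v\rangle\lambda$ for $t=(v,\lambda)$, where $\langle\cdot,\cdot\rangle$ is a non-degenerate symmetric bilinear form (types $B$, $D$); or the $3\times3$ hermitian matrices $W=\mathcal{J}_3(\mathbb{A})$ with $\mathfrak{C}(t^3)=\det t$, where $\mathbb{A}$ is the trivial algebra $0$ or the complexification of $\mathbb{R},\mathbb{C},\mathbb{H},\mathbb{O}$ ($D_4,F_4,E_6,E_7,E_8$). Let $\{\mathsf{w}_a\}_{a=1}^{n-1}$ be any basis of $W$, $n=1+\dim W$, write $t=t^a\mathsf{w}_a$, $\mathfrak{C}_{abe}=\mathfrak{C}(\mathsf{w}_a,\mathsf{w}_b,\mathsf{w}_e)$, $\mathfrak{C}_a(t^2)=\mathfrak{C}_{abe}t^bt^e$, and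 fix $1\le c\le n-1$. On $J^1(\mathbb{C}^n,\mathbb{C})$ with coordinates $(x^i,u,u_i)$, $0\le i\le n-1$, and contact distribution $\mathcal{C}=\ker(du-u_i\,dx^i)$, put $$\mathbf{X}_0=\partial_{x^0}+u_0\partial_u+x^c\partial_{u_0},\quad \mathbf{X}_a=\partial_{x^a}+u_a\partial_u,\quad \mathbf{U}^0=\partial_{u_0},\quad \mathbf{U}^a=\partial_{u_a},$$ and consider the $G$-contact structure given by the field $\mathcal{V}\subset\mathbb{P}(\mathcal{C})$ of sub-adjoint varieties that is (the closure of) the projectivization of the vector fields $$\mathbf{V}(\lambda,t)=\lambda^3\mathbf{X}_0-\lambda^2t^a\mathbf{X}_a-\tfrac12\mathfrak{C}(t^3)\mathbf{U}^0-\tfrac32\lambda\,\mathfrak{C}_a(t^2)\mathbf{U}^a,\qquad \lambda\in\mathbb{C},\ t\in W.$$ An (infinitesimal) symmetry on an open set $U$ is a holomorphic contact vector field $\mathbf{S}$ on $U$ such that $[\mathbf{S},\mathbf{V}(\lambda,t)]$ takes values in the affine tangent space $\widehat{T}_{[\mathbf{V}(\lambda,t)]}\mathcal{V}$ for all $\lambda$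 and $t$. The contact vector field with generating function $f$ is $\mathbf{S}_f=-f_{u_i}\partial_{x^i}+(f-u_if_{u_i})\partial_u+(f_{x^i}+u_if_u)\partial_{u_i}$. Then on every connected open set $U$ the symmetries are exactly the restrictions of the fields $\mathbf{S}_f$ with $f$ in the complex linear span of the following functions (equivalently, the generating functions of symmetries on $U$ are exactly the restrictions to $U$ of the elements of this span): $$1,\quad x^i,\quad u_i-\delta_i{}^c\frac{(x^0)^2}{2},\quad 7u-2x^0u_0-3x^au_a,\quad x^0u_a+\frac32\mathfrak{C}_a(X^2)-\frac16\delta_a{}^c(x^0)^3,$$ $$7A^a{}_bx^bu_a-k\,(3x^0u_0+x^au_a),\quad\text{where } A^a{}_{(b}\mathfrak{C}_{de)a}=0 \text{ and } A^c{}_b=k\,\delta^c{}_b \text{ for all } b.$$ Here $X=x^a\mathsf{w}_a$, $0\le i\le n-1$, $1\le a,b,d,e\le n-1$, $k\in\mathbb{C}$, $A=(A^a{}_b)$ is a complex matrix, repeated indices $i$ and $a,b$ are summed over these ranges (there is no sum over the fixed index $c$), and parentheses around indices denote symmetrization. -/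

import Mathlib

/-! ## Complex composition algebras and cubic Jordan algebras -/

/-- A product, a conjugation and a scalar-part functional on a complex vector space. -/
class ConjAlgebra (A : Type) where
  mul : A → A → A
  conj : A → A
  re : A → ℂ

/-- The complexification of `ℝ`: the field `ℂ`, with trivial (complex linear) conjugation. -/
instance conjAlgebraComplex : ConjAlgebra ℂ where
  mul a b := a * b
  conj a := a
  re a := a

/-- The trivial algebra. -/
instance conjAlgebraTrivial : ConjAlgebra PUnit.{1} where
  mul _ _ := PUnit.unit
  conj _ := PUnit.unit
  re _ := 0

/-- The Cayley--Dickson double of `A`. -/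
def CayleyDickson (A : Type) : Type := A × A

instance cayleyDicksonAddCommGroup (A : Type) [AddCommGroup A] :
    AddCommGroup (CayleyDickson A) :=
  inferInstanceAs (AddCommGroup (A × A))

instance cayleyDicksonModule (A : Type) [AddCommGroup A] [Module ℂ A] :
    Module ℂ (CayleyDickson A) :=
  inferInstanceAs (Module ℂ (A × A))

/-- `(a, b) (c, e) = (a c - ē b, e a + b c̄)`, with conjugate `(ā, -b)` of `(a, b)`. -/
instance conjAlgebraCayleyDickson (A : Type) [AddCommGroup A] [ConjAlgebra A] :
    ConjAlgebra (CayleyDickson A) where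
  mul p q :=
    (ConjAlgebra.mul p.1 q.1 - ConjAlgebra.mul (ConjAlgebra.conj q.2) p.2,
      ConjAlgebra.mul q.2 p.1 + ConjAlgebra.mul p.2 (ConjAlgebra.conj q.1))
  conj p := (ConjAlgebra.conj p.1, -p.2)
  re p := ConjAlgebra.re p.1

/-- The complexified complex numbers `ℂ ⊗ ℂ`. -/
abbrev BiComplex : Type := CayleyDickson ℂ

/-- The complexified quaternions `ℍ ⊗ ℂ`. -/
abbrev BiQuaternion : Type := CayleyDickson BiComplex

/-- The complexified octonions `𝕆 ⊗ ℂ`. -/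
abbrev BiOctonion : Type := CayleyDickson BiQuaternion

/-- The quadratic norm `x x̄` of a composition algebra. -/
def compNorm {A : Type} [ConjAlgebra A] (x : A) : ℂ :=
  ConjAlgebra.re (ConjAlgebra.mul x (ConjAlgebra.conj x))

/-- The space of `3 × 3` hermitian matrices over `A`: the pair `(l, v)` stands for the matrix with
rows `(l 0, v 0, v 1)`, `(conj (v 0), l 1, v 2)`, `(conj (v 1), conj (v 2), l 2)`. -/
abbrev Herm3 (A : Type) : Type := (Fin 3 → ℂ) × (Fin 3 → A)

/-- The determinant of a `3 × 3` hermitian matrix over a composition algebra. -/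
def hermDet {A : Type} [ConjAlgebra A] (t : Herm3 A) : ℂ :=
  t.1 0 * t.1 1 * t.1 2
    - t.1 0 * compNorm (t.2 2) - t.1 1 * compNorm (t.2 1) - t.1 2 * compNorm (t.2 0)
    + 2 * ConjAlgebra.re
        (ConjAlgebra.mul (ConjAlgebra.mul (t.2 0) (t.2 2)) (ConjAlgebra.conj (t.2 1)))

/-- The list of the cubic forms `t ↦ N t` of the complex cubic Jordan algebras attached to the
complex simple Lie groups that are not of type `A` or `C`. -/
inductive IsJordanCubic {W : Type*} [AddCommGroup W] [Module ℂ W] (N : W → ℂ) : Prop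
  /-- Type `G₂`: `W = ℂ`. -/
  | line (e : W ≃ₗ[ℂ] ℂ) (h : ∀ t, N t = (e t) ^ 3 / 3)
  /-- Types `B` and `D`: the spin factors `W = ℂ^m ⊕ ℂ`. -/
  | spin (m : ℕ) (hm : 1 ≤ m) (B : LinearMap.BilinForm ℂ (Fin m → ℂ)) (hB : B.IsSymm)
      (hB' : B.Nondegenerate) (e : W ≃ₗ[ℂ] (Fin m → ℂ) × ℂ)
      (h : ∀ t, N t = B (e t).1 (e t).1 * (e t).2)
  /-- Type `D₄`. -/
  | herm_zero (e : W ≃ₗ[ℂ] Herm3 PUnit.{1}) (h : ∀ t, N t = hermDet (e t))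
  /-- Type `F₄`. -/
  | herm_real (e : W ≃ₗ[ℂ] Herm3 ℂ) (h : ∀ t, N t = hermDet (e t))
  /-- Type `E₆`. -/
  | herm_complex (e : W ≃ₗ[ℂ] Herm3 BiComplex) (h : ∀ t, N t = hermDet (e t))
  /-- Type `E₇`. -/
  | herm_quaternion (e : W ≃ₗ[ℂ] Herm3 BiQuaternion) (h : ∀ t, N t = hermDet (e t))
  /-- Type `E₈`. -/
  | herm_octonion (e : W ≃ₗ[ℂ] Herm3 BiOctonion) (h : ∀ t, N t = hermDet (e t))

/-- `C ∈ S³ W*` is the cubic form of a complex cubic Jordan algebra `W`. -/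
structure IsJordanCubicForm {W : Type*} [AddCommGroup W] [Module ℂ W]
    (C : W →ₗ[ℂ] W →ₗ[ℂ] W →ₗ[ℂ] ℂ) : Prop where
  swap_left : ∀ r s t, C r s t = C s r t
  swap_right : ∀ r s t, C r s t = C r t s
  cubic : IsJordanCubic (fun t => C t t t)

/-! ## The first jet space and its contact structure -/

/-- The jet space `J¹(ℂⁿ, ℂ)`, `n = d + 1`, with coordinates `m = (x, u, p)`: `x i = xⁱ` and
`p i = u_i` for `0 ≤ i ≤ d`. The index `a = 1, …, d` of a basis of `W` is `Fin.succ` of an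
element of `Fin d`. -/
abbrev J1 (d : ℕ) : Type := (Fin (d + 1) → ℂ) × ℂ × (Fin (d + 1) → ℂ)

section
variable {d : ℕ}

/-- The coordinate vector `∂/∂xⁱ`. -/
def ddx (i : Fin (d + 1)) : J1 d := (Pi.single i 1, 0, 0)

/-- The coordinate vector `∂/∂u`. -/
def ddu : J1 d := (0, 1, 0)

/-- The coordinate vector `∂/∂u_i`. -/
def ddp (i : Fin (d + 1)) : J1 d := (0, 0, Pi.single i 1)

/-- The contact distribution, the kernel of `du - u_i dxⁱ`. -/
def contactDist (m : J1 d) : Set (J1 d) := {v | v.2.1 = ∑ i, m.2.2 i * v.1 i}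

/-- `S` is a contact vector field on `U`: brackets of `S` with sections of the contact
distribution are sections of the contact distribution. -/
def IsContactField (U : Set (J1 d)) (S : J1 d → J1 d) : Prop :=
  ∀ Y : J1 d → J1 d, DifferentiableOn ℂ Y U → (∀ m ∈ U, Y m ∈ contactDist m) →
    ∀ m ∈ U, VectorField.lieBracket ℂ S Y m ∈ contactDist m

/-- The vector field with generating function `f`:
`-f_{u_i} ∂_{xⁱ} + (f - u_i f_{u_i}) ∂_u + (f_{xⁱ} + u_i f_u) ∂_{u_i}`. -/
noncomputable def contactField (f : J1 d → ℂ) (m : J1 d) : J1 d :=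
  -(∑ i, fderiv ℂ f m (ddp i) • ddx i)
    + (f m - ∑ i, m.2.2 i * fderiv ℂ f m (ddp i)) • ddu
    + ∑ i, (fderiv ℂ f m (ddx i) + m.2.2 i * fderiv ℂ f m ddu) • ddp i

/-- The affine tangent space at `v` of a cone `K` in a complex vector space: the span of `v` and of
the velocities at `v` of the holomorphic curves in `K` through `v`. -/
def affineTangentSpace {E : Type*} [NormedAddCommGroup E] [NormedSpace ℂ E] (K : Set E) (v : E) :
    Submodule ℂ E :=
  Submodule.span ℂ ({v} ∪ {y | ∃ γ : ℂ → E, AnalyticAt ℂ γ 0 ∧ γ 0 = v ∧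
    (∀ᶠ z in nhds 0, γ z ∈ K) ∧ deriv γ 0 = y})

/-! ## The curved structure -/

/-- `X_0 = ∂_{x⁰} + u_0 ∂_u + x^c ∂_{u_0}`. -/
def frameX0 (c : Fin d) (m : J1 d) : J1 d := ddx 0 + m.2.2 0 • ddu + m.1 c.succ • ddp 0

/-- `X_a = ∂_{x^a} + u_a ∂_u`. -/
def frameX (a : Fin d) (m : J1 d) : J1 d := ddx a.succ + m.2.2 a.succ • ddu

variable {W : Type*} [AddCommGroup W] [Module ℂ W]

/-- The vector field
`V(l, t) = l³ X_0 - l² t^a X_a - (1/2) C(t³) ∂_{u_0} - (3/2) l C_a(t²) ∂_{u_a}`. -/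
noncomputable def fieldV (C : W →ₗ[ℂ] W →ₗ[ℂ] W →ₗ[ℂ] ℂ) (w : Module.Basis (Fin d) ℂ W)
    (c : Fin d) (l : ℂ) (t : W) (m : J1 d) : J1 d :=
  l ^ 3 • frameX0 c m - l ^ 2 • ∑ a, w.repr t a • frameX a m
    - (1 / 2 * C t t t) • ddp 0 - (3 / 2 * l) • ∑ a : Fin d, C (w a) t t • ddp a.succ

/-- The affine cone over the sub-adjoint variety at `m`, the closure of the values of all
`V(l, t)` at `m`. -/
def subadjointCone (C : W →ₗ[ℂ] W →ₗ[ℂ] W →ₗ[ℂ] ℂ) (w : Module.Basis (Fin d) ℂ W)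
    (c : Fin d) (m : J1 d) : Set (J1 d) :=
  closure {v | ∃ (l : ℂ) (t : W), fieldV C w c l t m = v}

/-- `S` is a (holomorphic, infinitesimal) symmetry on `U` of the contact distribution endowed with
the field of sub-adjoint varieties. -/
structure IsSymmetry (C : W →ₗ[ℂ] W →ₗ[ℂ] W →ₗ[ℂ] ℂ) (w : Module.Basis (Fin d) ℂ W)
    (c : Fin d) (U : Set (J1 d)) (S : J1 d → J1 d) : Prop where
  holomorphic : DifferentiableOn ℂ S U
  contact : IsContactField U S
  preserves : ∀ (l : ℂ) (t : W), ∀ m ∈ U,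
    VectorField.lieBracket ℂ S (fieldV C w c l t) m ∈
      affineTangentSpace (subadjointCone C w c m) (fieldV C w c l t m)

/-- The element `X = x^a w_a` of `W`. -/
noncomputable def pointX (w : Module.Basis (Fin d) ℂ W) (m : J1 d) : W :=
  ∑ a : Fin d, m.1 a.succ • w a

/-- The endomorphism `A` of `W`, with components `A a b = A^a_b`, annihilates the cubic:
the symmetrization of `A^a_b C_{eha}` over `b, e, h` vanishes. -/
def AnnihilatesCubic (C : W →ₗ[ℂ] W →ₗ[ℂ] W →ₗ[ℂ] ℂ) (w : Module.Basis (Fin d) ℂ W)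
    (A : Matrix (Fin d) (Fin d) ℂ) : Prop :=
  ∀ b e h : Fin d, ∑ a : Fin d, (A a b * C (w e) (w h) (w a) + A a e * C (w b) (w h) (w a)
    + A a h * C (w b) (w e) (w a)) = 0

/-- The listed generating functions. -/
inductive ListedFunction (C : W →ₗ[ℂ] W →ₗ[ℂ] W →ₗ[ℂ] ℂ) (w : Module.Basis (Fin d) ℂ W)
    (c : Fin d) : (J1 d → ℂ) → Prop
  /-- `1` -/
  | one : ListedFunction C w c (fun _ => 1)
  /-- `xⁱ` -/
  | coord (i : Fin (d + 1)) : ListedFunction C w c (fun m => m.1 i)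
  /-- `u_i - δ_i^c (x⁰)² / 2` -/
  | momentum (i : Fin (d + 1)) : ListedFunction C w c
      (fun m => m.2.2 i - if i = c.succ then (m.1 0) ^ 2 / 2 else 0)
  /-- `7 u - 2 x⁰ u_0 - 3 x^a u_a` -/
  | scaling : ListedFunction C w c
      (fun m => 7 * m.2.1 - 2 * (m.1 0 * m.2.2 0)
        - 3 * ∑ a : Fin d, m.1 a.succ * m.2.2 a.succ)
  /-- `x⁰ u_a + (3/2) C_a(X²) - (1/6) δ_a^c (x⁰)³` -/
  | shear (a : Fin d) : ListedFunction C w c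
      (fun m => m.1 0 * m.2.2 a.succ + 3 / 2 * C (w a) (pointX w m) (pointX w m)
        - if a = c then (m.1 0) ^ 3 / 6 else 0)
  /-- `7 A^a_b x^b u_a - k (3 x⁰ u_0 + x^a u_a)`, where `A` annihilates the cubic and
  `A^c_b = k δ^c_b` -/
  | linear (A : Matrix (Fin d) (Fin d) ℂ) (k : ℂ) (hA : AnnihilatesCubic C w A)
      (hk : ∀ b, A c b = if b = c then k else 0) : ListedFunction C w c
      (fun m => 7 * ∑ a : Fin d, ∑ b : Fin d, A a b * m.1 b.succ * m.2.2 a.succ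
        - k * (3 * (m.1 0 * m.2.2 0) + ∑ a : Fin d, m.1 a.succ * m.2.2 a.succ))

end

/-! Write N(t) = C(t,t,t), κ(t) = t^c, Z = ∂_u, U_0 = ∂_{u_0}, U_φ = φ(w_a) ∂_{u_a}, X_t = t^a X_a,
and let ω be the symplectic form on the contact distribution. A contact field S has the generating
function f = α(S), with α the contact form, so the task is to turn tangency of [S_f, V] to the cone
into an equation for f.

At points V(l, t) with l ≠ 0 the tangent spaces of the cone are Lagrangian: quadrics containing the
cone make them isotropic, and every vector orthogonal to V and to its t-derivatives is a combination
of these. Hence tangency implies ω([S_f, V], V) = 0. Conversely, differentiating this identity in t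
gives the pairings with the remaining tangent vectors. At l = 0 the vector V is a multiple of U_0,
its tangent space contains all vertical vectors, and tangency is checked separately. Thus
(`isSymmetry_contactField_iff`) S_f is a symmetry if and only if, for all l and t, V V f + l^5 κ(t)
U_0 f + l^6 U_κ f = 0. The last two terms come from x^c ∂_{u_0} in X_0, which is also the source of
the relation [X_t, X_0] = κ(t) U_0.

The left side is a polynomial of degree 6 in l, and its coefficients form an overdetermined system
(`ContactFrame.IsSolution.coefficients`), solved by cross-differentiation with the commutation
relations of the frame. Two facts about the cubic are used: the adjoints C(t,t) span W*, and, more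
strongly, no nonzero quadratic form on W* vanishes at all adjoints (`VanishesOnAdjoints.eq_zero`,
proved for each family by writing W* as a span of products C(r,s)). The decisive step is
`ContactFrame.IsSolution.X_U0`: if X_t U_0 f were nonzero for some t, there would be w in W with
C(s,t,w) = κ(s)κ(t), which contradicts the l^2 coefficient along e + a w. Then U_φ U_ψ f = 0 by the
fact on quadratic forms, and Z f, X_0 U_0 f, X_0 U_φ f, X_t U_φ f are killed by the whole frame,
hence constant on a connected set.

These constants determine a combination of listed functions with the same vertical derivatives as f;
the l^3 and l^6 coefficients give exactly the two conditions on the matrix A. The difference is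
affine in the x^i. That the listed functions are solutions is a direct computation of V V. -/

/-! ### Holomorphic functions of several variables: Cauchy's formula and higher derivatives. -/

/-- A function that is complex differentiable on an open set of a finite dimensional space is
Lipschitz on a small ball around each point. -/
theorem exists_lipschitzOnWith_ball_of_holomorphic {E : Type*} [NormedAddCommGroup E]
    [NormedSpace ℂ E] {f : E → ℂ} {U : Set E} (hU : IsOpen U) (hf : DifferentiableOn ℂ f U)
    {m : E} (hm : m ∈ U) :
    ∃ R > 0, Metric.ball m R ⊆ U ∧ ∃ K, LipschitzOnWith K f (Metric.ball m R) := by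
  obtain ⟨r, hr, hrU⟩ := Metric.isOpen_iff.1 hU m hm
  have hc : ContinuousAt f m := (hf.differentiableAt (hU.mem_nhds hm)).continuousAt
  obtain ⟨δ, hδ, hδf⟩ := Metric.continuousAt_iff.1 hc 1 one_pos
  set R := min r δ / 2 with hR
  have hRpos : 0 < R := by positivity
  have hsub : Metric.ball m (R + R) ⊆ U := by
    refine (Metric.ball_subset_ball ?_).trans hrU
    rw [hR]; linarith [min_le_left r δ]
  have hball : ∀ x ∈ Metric.ball m R, Metric.ball x R ⊆ Metric.ball m (R + R) := fun x hx y hy => by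
    rw [Metric.mem_ball] at *
    linarith [dist_triangle y x m]
  have hval : ∀ x ∈ Metric.ball m (R + R), dist (f x) (f m) < 1 := fun x hx => by
    apply hδf
    rw [Metric.mem_ball, hR] at hx
    linarith [min_le_right r δ]
  have hsub' : Metric.ball m R ⊆ Metric.ball m (R + R) :=
    Metric.ball_subset_ball (by linarith)
  -- On the ball of radius R around any x of the small ball, f stays within 2 of f x, both values
  -- being within 1 of f m; Cauchy's estimate then bounds the derivative by 2 / R.
  refine ⟨R, hRpos, hsub'.trans hsub, Real.toNNReal (2 / R),
    (convex_ball m R).lipschitzOnWith_of_nnnorm_fderiv_le (𝕜 := ℂ)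
      (fun x hx => hf.differentiableAt (hU.mem_nhds (hsub (hsub' hx)))) fun x hx => ?_⟩
  rw [← NNReal.coe_le_coe, coe_nnnorm, Real.coe_toNNReal _ (by positivity)]
  refine Complex.norm_fderiv_le_div_of_mapsTo_ball (hf.mono ((hball x hx).trans hsub))
    (fun y hy => ?_) hRpos
  rw [Metric.mem_closedBall]
  linarith [dist_triangle_right (f y) (f x) (f m), hval y (hball x hx hy), hval x (hsub' hx)]

/-- Directional derivatives of holomorphic functions are holomorphic. -/
theorem differentiableOn_fderiv_apply_of_holomorphic {E : Type*} [NormedAddCommGroup E]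
    [NormedSpace ℂ E] [FiniteDimensional ℂ E] {f : E → ℂ} {U : Set E} (hU : IsOpen U)
    (hf : DifferentiableOn ℂ f U) (v : E) :
    DifferentiableOn ℂ (fun m => fderiv ℂ f m v) U := by
  intro m hm
  refine DifferentiableAt.differentiableWithinAt ?_
  obtain ⟨R, hR, hRU, K, hK⟩ := exists_lipschitzOnWith_ball_of_holomorphic hU hf hm
  obtain ⟨r, hr, hrv⟩ : ∃ r : ℝ, 0 < r ∧ r * ‖v‖ < R / 2 := by
    refine ⟨R / 2 / (‖v‖ + 1), by positivity, ?_⟩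
    rw [div_mul_eq_mul_div, div_lt_iff₀ (by positivity)]
    nlinarith [norm_nonneg v]
  have hmem : ∀ x ∈ Metric.ball m (R / 2), ∀ z : ℂ, ‖z‖ ≤ r → x + z • v ∈ Metric.ball m R := by
    intro x hx z hz
    rw [Metric.mem_ball, dist_eq_norm] at *
    calc ‖x + z • v - m‖ = ‖(x - m) + z • v‖ := by congr 1; abel
      _ ≤ ‖x - m‖ + ‖z‖ * ‖v‖ := (norm_add_le _ _).trans_eq (by rw [norm_smul])
      _ < R / 2 + R / 2 := by
        have := mul_le_mul_of_nonneg_right hz (norm_nonneg v)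
        linarith
      _ = R := by ring
  have hcirc : ∀ θ : ℝ, ‖circleMap 0 r θ‖ ≤ r := fun θ => by simp [abs_of_pos hr]
  have hdiff : ∀ x ∈ Metric.ball m R, DifferentiableAt ℂ f x := fun x hx =>
    hf.differentiableAt (hU.mem_nhds (hRU hx))
  -- Cauchy's formula for the derivative at 0 of z ↦ f (x + z v). One radius r serves all x near m,
  -- so the right side can be differentiated in x under the integral sign.
  have hformula : ∀ x ∈ Metric.ball m (R / 2), fderiv ℂ f x v =
      (2 * Real.pi * Complex.I : ℂ)⁻¹ • ∮ z in C(0, r), ((z - 0) ^ 2)⁻¹ • f (x + z • v) := by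
    intro x hx
    have hopen : IsOpen {z : ℂ | x + z • v ∈ Metric.ball m R} :=
      Metric.isOpen_ball.preimage (by fun_prop)
    have hd : ∀ z : ℂ, x + z • v ∈ Metric.ball m R →
        HasDerivAt (fun z : ℂ => f (x + z • v)) (fderiv ℂ f (x + z • v) v) z := fun z hz => by
      have h1 : HasDerivAt (fun z : ℂ => x + z • v) v z := by
        simpa using ((hasDerivAt_id z).smul_const v).const_add x
      exact (hdiff _ hz).hasFDerivAt.comp_hasDerivAt z h1
    rw [Complex.two_pi_I_inv_smul_circleIntegral_sub_sq_inv_smul_of_differentiable hopen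
      (fun z hz => hmem x hx z (by simpa using hz))
      (fun z hz => (hd z hz).differentiableAt.differentiableWithinAt)
      (Metric.mem_ball_self hr)]
    rw [(hd 0 (hmem x hx 0 (by simpa using hr.le))).deriv]
    simp
  have hEq : (fun x => fderiv ℂ f x v) =ᶠ[nhds m] fun x =>
      (2 * Real.pi * Complex.I : ℂ)⁻¹ • ∮ z in C(0, r), ((z - 0) ^ 2)⁻¹ • f (x + z • v) := by
    filter_upwards [Metric.ball_mem_nhds m (half_pos hR)] with x hx using hformula x hx
  refine DifferentiableAt.congr_of_eventuallyEq ?_ hEq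
  refine DifferentiableAt.const_smul (R := ℂ) ?_ (2 * Real.pi * Complex.I : ℂ)⁻¹
  simp only [circleIntegral]
  have hne : ∀ θ : ℝ, circleMap 0 r θ ≠ 0 := fun θ => circleMap_ne_center hr.ne'
  have hcont : ∀ x ∈ Metric.ball m (R / 2), Continuous fun θ : ℝ =>
      deriv (circleMap 0 r) θ • ((circleMap 0 r θ - 0) ^ 2)⁻¹ • f (x + circleMap 0 r θ • v) := by
    intro x hx
    have h1 : Continuous fun θ : ℝ => f (x + circleMap 0 r θ • v) := by
      rw [continuous_iff_continuousAt]
      intro θ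
      refine ContinuousAt.comp (f := fun θ : ℝ => x + circleMap 0 r θ • v)
        (hdiff _ (hmem x hx _ (hcirc θ))).continuousAt ?_
      fun_prop
    have h2 : Continuous fun θ : ℝ => ((circleMap 0 r θ - 0) ^ 2)⁻¹ :=
      Continuous.inv₀ (by fun_prop) fun θ => by simpa using hne θ
    simp only [deriv_circleMap]
    exact ((continuous_circleMap 0 r).mul continuous_const).smul (h2.smul h1)
  borelize E
  -- Measurability suffices for the dominated theorem; continuity of the derivative is not yet
  -- known.
  have hmeas : Measurable fun θ : ℝ => fderiv ℂ f (m + circleMap 0 r θ • v) := by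
    have : Measurable fun θ : ℝ => m + circleMap 0 r θ • v := by
      apply Continuous.measurable; fun_prop
    exact (measurable_fderiv ℂ f).comp this
  have key := intervalIntegral.hasFDerivAt_integral_of_dominated_loc_of_lip
    (μ := MeasureTheory.volume) (a := 0) (b := 2 * Real.pi)
    (F := fun x θ => deriv (circleMap 0 r) θ • ((circleMap 0 r θ - 0) ^ 2)⁻¹ •
      f (x + circleMap 0 r θ • v))
    (F' := fun θ => deriv (circleMap 0 r) θ • ((circleMap 0 r θ - 0) ^ 2)⁻¹ •
      fderiv ℂ f (m + circleMap 0 r θ • v))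
    (bound := fun _ => r⁻¹ * K)
    (Metric.ball_mem_nhds m (half_pos hR))
    (by
      filter_upwards [Metric.ball_mem_nhds m (half_pos hR)] with x hx
      exact (hcont x hx).aestronglyMeasurable)
    ((hcont m (Metric.mem_ball_self (half_pos hR))).intervalIntegrable _ _)
    (by
      have h2 : Continuous fun θ : ℝ => ((circleMap 0 r θ - 0) ^ 2)⁻¹ :=
        Continuous.inv₀ (by fun_prop) fun θ => by simpa using hne θ
      have h3 : Continuous (deriv (circleMap 0 r)) := by
        have : deriv (circleMap 0 r) = fun θ => circleMap 0 r θ * Complex.I := by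
          ext θ; simp
        rw [this]
        fun_prop
      exact (h3.measurable.smul (h2.measurable.smul hmeas)).aestronglyMeasurable)
    (by
      refine Filter.Eventually.of_forall fun θ _ => ?_
      refine LipschitzOnWith.of_dist_le_mul fun x hx y hy => ?_
      have h1 := hK.dist_le_mul _ (hmem x hx _ (hcirc θ)) _ (hmem y hy _ (hcirc θ))
      rw [dist_add_right] at h1
      -- The kernel has modulus r · r⁻² on the circle, whence the bound `r⁻¹ * K`.
      have h2 : ‖deriv (circleMap 0 r) θ‖ * ‖((circleMap 0 r θ - 0) ^ 2)⁻¹‖ = r⁻¹ := by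
        simp [abs_of_pos hr]
        field_simp
      rw [dist_smul₀, dist_smul₀, ← mul_assoc, h2]
      have h3 : (0 : ℝ) ≤ r⁻¹ * K := by positivity
      rw [Real.coe_nnabs, abs_of_nonneg h3, mul_assoc]
      exact mul_le_mul_of_nonneg_left h1 (by positivity))
    (by simp)
    (by
      refine Filter.Eventually.of_forall fun θ _ => ?_
      have h1 : HasFDerivAt (fun x => f (x + circleMap 0 r θ • v))
          (fderiv ℂ f (m + circleMap 0 r θ • v)) m :=
        (hasFDerivAt_comp_add_right _).2
          (hdiff _ (hmem m (Metric.mem_ball_self (half_pos hR)) _ (hcirc θ))).hasFDerivAt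
      exact (h1.const_smul ((circleMap 0 r θ - 0) ^ 2)⁻¹).const_smul (deriv (circleMap 0 r) θ))
  exact key.2.differentiableAt

/-- The derivative of a holomorphic function is holomorphic. -/
theorem differentiableOn_fderiv_of_holomorphic {E : Type*} [NormedAddCommGroup E]
    [NormedSpace ℂ E] [FiniteDimensional ℂ E] {f : E → ℂ} {U : Set E} (hU : IsOpen U)
    (hf : DifferentiableOn ℂ f U) : DifferentiableOn ℂ (fderiv ℂ f) U := by
  let b := Module.finBasis ℂ E
  have h : fderiv ℂ f = fun m => ∑ i, fderiv ℂ f m (b i) •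
      LinearMap.toContinuousLinearMap (b.coord i) := by
    ext m v
    conv_lhs => rw [← b.sum_repr v, map_sum]
    simp [mul_comm]
  rw [h]
  exact DifferentiableOn.fun_sum fun i _ =>
    (differentiableOn_fderiv_apply_of_holomorphic hU hf (b i)).smul_const _

/-! ### Quadratic forms vanishing at the adjoints: polarized identities. -/

section Polarization

variable {W : Type*} [AddCommGroup W] [Module ℂ W] {C : W →ₗ[ℂ] W →ₗ[ℂ] W →ₗ[ℂ] ℂ}

theorem IsJordanCubicForm.comm (hC : IsJordanCubicForm C) (r s : W) : C r s = C s r :=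
  LinearMap.ext fun t => hC.swap_left r s t

theorem IsJordanCubicForm.polarization (hC : IsJordanCubicForm C) {N : W → ℂ}
    (hN : ∀ t, C t t t = N t) (r s t : W) :
    6 * C r s t = N (r + s + t) - N (r + s) - N (s + t) - N (r + t) + N r + N s + N t := by
  simp only [← hN, map_add, LinearMap.add_apply]
  have h1 := hC.swap_left
  have h2 := hC.swap_right
  simp only [h1 s r, h1 t r, h1 t s, h2 r s r, h2 r t r, h2 r t s, h2 s s r, h2 s t r, h2 t t r,
    h2 s t s, h2 t t s]
  ring

/-- A quadratic form on the dual of `W`, given by its polar form, that vanishes at all `C t t`. -/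
structure VanishesOnAdjoints (C : W →ₗ[ℂ] W →ₗ[ℂ] W →ₗ[ℂ] ℂ)
    (Q : (W →ₗ[ℂ] ℂ) →ₗ[ℂ] (W →ₗ[ℂ] ℂ) →ₗ[ℂ] ℂ) : Prop where
  symm : ∀ φ ψ, Q φ ψ = Q ψ φ
  vanishes : ∀ t, Q (C t t) (C t t) = 0

variable {Q : (W →ₗ[ℂ] ℂ) →ₗ[ℂ] (W →ₗ[ℂ] ℂ) →ₗ[ℂ] ℂ}

/-- The part of degree 2 in s of the vanishing at t + s, isolated by adding the equations for t + s
and t - s. -/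
theorem VanishesOnAdjoints.two_two (hQ : VanishesOnAdjoints C Q) (hC : IsJordanCubicForm C)
    (t s : W) : Q (C t t) (C s s) + 2 * Q (C t s) (C t s) = 0 := by
  have h1 := hQ.vanishes (t + s)
  have h2 := hQ.vanishes (t - s)
  have h3 := hQ.vanishes t
  have h4 := hQ.vanishes s
  simp only [map_add, map_sub, LinearMap.add_apply, LinearMap.sub_apply, hC.comm s t,
    hQ.symm (C t s) (C t t), hQ.symm (C s s) (C t t), hQ.symm (C s s) (C t s)] at h1 h2
  linear_combination (h1 + h2 - 2 * h3 - 2 * h4) / 4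

theorem VanishesOnAdjoints.two_one_one (hQ : VanishesOnAdjoints C Q) (hC : IsJordanCubicForm C)
    (t u s : W) : Q (C t u) (C s s) + 2 * Q (C t s) (C u s) = 0 := by
  have h1 := hQ.two_two hC (t + u) s
  have h2 := hQ.two_two hC t s
  have h3 := hQ.two_two hC u s
  simp only [map_add, LinearMap.add_apply, hC.comm u t, hQ.symm (C u s) (C t s)] at h1
  linear_combination (h1 - h2 - h3) / 2

/-- This four-linear form is the tool for the case analysis: arguments with C(r, s) = 0 for some
pairs remove terms and isolate a single value of Q. -/
theorem VanishesOnAdjoints.polarized (hQ : VanishesOnAdjoints C Q) (hC : IsJordanCubicForm C)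
    (t u s r : W) : Q (C t u) (C s r) + Q (C t s) (C u r) + Q (C t r) (C u s) = 0 := by
  have h1 := hQ.two_one_one hC t u (s + r)
  have h2 := hQ.two_one_one hC t u s
  have h3 := hQ.two_one_one hC t u r
  simp only [map_add, LinearMap.add_apply, hC.comm r s] at h1
  linear_combination (h1 - h2 - h3) / 2

end Polarization

/-! ### No quadric through the adjoints: the case W = ℂ. -/

section Line

variable {W : Type*} [AddCommGroup W] [Module ℂ W] {C : W →ₗ[ℂ] W →ₗ[ℂ] W →ₗ[ℂ] ℂ}
  {Q : (W →ₗ[ℂ] ℂ) →ₗ[ℂ] (W →ₗ[ℂ] ℂ) →ₗ[ℂ] ℂ}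

/-- W* is a line spanned by the adjoint of the unit, whose value at the unit is 1/3; hence the
factor 3. -/
theorem VanishesOnAdjoints.eq_zero_of_line (hQ : VanishesOnAdjoints C Q)
    (e : W ≃ₗ[ℂ] ℂ) (h : ∀ t, C t t t = (e t) ^ 3 / 3) (φ ψ : W →ₗ[ℂ] ℂ) : Q φ ψ = 0 := by
  have hspan : ∀ t : W, t = e t • e.symm 1 := fun t => by
    apply e.injective; simp
  have key : ∀ χ : W →ₗ[ℂ] ℂ, χ = (3 * χ (e.symm 1)) • C (e.symm 1) (e.symm 1) := fun χ => by
    ext t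
    rw [hspan t]
    simp only [map_smul, LinearMap.smul_apply, h, smul_eq_mul, LinearEquiv.apply_symm_apply]
    ring
  rw [key φ, key ψ]
  simp [hQ.vanishes]

end Line

/-! ### No quadric through the adjoints: spin factors. -/

section Spin

variable {W : Type*} [AddCommGroup W] [Module ℂ W] {C : W →ₗ[ℂ] W →ₗ[ℂ] W →ₗ[ℂ] ℂ}
  {Q : (W →ₗ[ℂ] ℂ) →ₗ[ℂ] (W →ₗ[ℂ] ℂ) →ₗ[ℂ] ℂ}

/-- Let e₀ span the line summand. Then C(e₀, e₀) = 0, and the products of two elements of the other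
summand are all multiples of C(v₁, v₁) for one anisotropic v₁. Together with the C(e₀, v) this
functional spans W*, and the few resulting pairings vanish by polarization. -/
theorem VanishesOnAdjoints.eq_zero_of_spin (hQ : VanishesOnAdjoints C Q)
    (hC : IsJordanCubicForm C) {m : ℕ} (hm : 1 ≤ m) {B : LinearMap.BilinForm ℂ (Fin m → ℂ)}
    (hB : B.IsSymm) (hB' : B.Nondegenerate) (e : W ≃ₗ[ℂ] (Fin m → ℂ) × ℂ)
    (h : ∀ t, C t t t = B (e t).1 (e t).1 * (e t).2) (φ ψ : W →ₗ[ℂ] ℂ) : Q φ ψ = 0 := by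
  have hBs : ∀ x y, B x y = B y x := fun x y => hB.eq x y
  have hform : ∀ r s t, 3 * C r s t = B (e r).1 (e s).1 * (e t).2 + B (e s).1 (e t).1 * (e r).2
      + B (e r).1 (e t).1 * (e s).2 := by
    intro r s t
    have := hC.polarization h r s t
    simp only [map_add, Prod.fst_add, Prod.snd_add, LinearMap.add_apply] at this
    rw [hBs (e t).1 (e r).1, hBs (e t).1 (e s).1, hBs (e s).1 (e r).1] at this
    linear_combination this / 2
  obtain ⟨v₁, hv₁⟩ : ∃ v, B v v ≠ 0 := by
    by_contra! hzero
    have hB0 : ∀ x y, B x y = 0 := fun x y => by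
      have := hzero (x + y)
      simp only [map_add, LinearMap.add_apply, hzero, hBs y x] at this
      linear_combination this / 2
    have h0 : (Pi.single ⟨0, hm⟩ 1 : Fin m → ℂ) = 0 := hB'.1 _ fun y => hB0 _ y
    simpa using congrFun h0 ⟨0, hm⟩
  set e₀ : W := e.symm (0, 1) with he₀
  set V : (Fin m → ℂ) → W := fun v => e.symm (v, 0) with hV
  have h00 : C e₀ e₀ = 0 := by
    ext t
    have := hform e₀ e₀ t
    simp only [he₀, LinearEquiv.apply_symm_apply, map_zero, LinearMap.zero_apply] at this
    simp only [LinearMap.zero_apply]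
    linear_combination this / 3
  have hVV : ∀ v w, C (V v) (V w) = (B v w / B v₁ v₁) • C (V v₁) (V v₁) := fun v w => by
    ext t
    have h1 := hform (V v) (V w) t
    have h2 := hform (V v₁) (V v₁) t
    simp only [hV, LinearEquiv.apply_symm_apply, mul_zero, add_zero] at h1 h2
    simp only [LinearMap.smul_apply, smul_eq_mul, hV]
    field_simp
    linear_combination (B v₁ v₁ / 3) * h1 - (B v w / 3) * h2
  have hdecomp : ∀ χ : W →ₗ[ℂ] ℂ, ∃ (v : Fin m → ℂ) (μ : ℂ),
      χ = C e₀ (V v) + μ • C (V v₁) (V v₁) := by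
    intro χ
    let χ' : (Fin m → ℂ) →ₗ[ℂ] ℂ := χ ∘ₗ e.symm.toLinearMap ∘ₗ LinearMap.inl ℂ _ _
    obtain ⟨z, hz⟩ : ∃ z, ∀ y, B z y = χ (V y) :=
      ⟨_, LinearMap.BilinForm.apply_toDual_symm_apply (hB := hB') χ'⟩
    refine ⟨(3 : ℂ) • z, 3 * χ e₀ / B v₁ v₁, ?_⟩
    ext t
    have ht : t = V (e t).1 + (e t).2 • e₀ := by
      apply e.injective
      simp [hV, he₀]
    have h1 := hform e₀ (V ((3 : ℂ) • z)) t
    have h2 := hform (V v₁) (V v₁) t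
    have h4 : χ t = χ (V (e t).1) + (e t).2 * χ e₀ := by
      conv_lhs => rw [ht]
      simp
    have e1 : e (V ((3 : ℂ) • z)) = ((3 : ℂ) • z, 0) := by simp [hV]
    have e2 : e (V v₁) = (v₁, 0) := by simp [hV]
    have e3 : e e₀ = (0, 1) := by simp [he₀]
    simp only [e1, e2, e3, mul_zero, add_zero, map_zero, map_smul,
      LinearMap.zero_apply, LinearMap.smul_apply, smul_eq_mul, mul_one, zero_mul, zero_add, hz]
      at h1 h2
    rw [h4]
    simp only [LinearMap.add_apply, LinearMap.smul_apply, smul_eq_mul]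
    field_simp
    linear_combination -(B v₁ v₁ / 3) * h1 - χ e₀ * h2
  have hq1 : ∀ v w, Q (C e₀ (V v)) (C e₀ (V w)) = 0 := fun v w => by
    have := hQ.polarized hC e₀ (V v) e₀ (V w)
    rw [h00, map_zero, LinearMap.zero_apply, hC.comm (V v) e₀, hQ.symm (C e₀ (V w))] at this
    linear_combination this / 2
  -- For v = v₁ the identity reads 3 Q = 0. In general C(v, v₁) is a multiple of C(v₁, v₁), so the
  -- second term is covered by that case.
  have hq2 : ∀ v, Q (C e₀ (V v)) (C (V v₁) (V v₁)) = 0 := fun v => by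
    have h1 := hQ.two_one_one hC e₀ (V v) (V v₁)
    have h2 := hQ.two_one_one hC e₀ (V v₁) (V v₁)
    rw [hVV v v₁, map_smul, smul_eq_mul] at h1
    linear_combination h1 - (2 * (B v v₁ / B v₁ v₁) / 3) * h2
  obtain ⟨v, μ, rfl⟩ := hdecomp φ
  obtain ⟨w, ν, rfl⟩ := hdecomp ψ
  simp [hq1, hq2, hQ.vanishes, hQ.symm (C (V v₁) (V v₁)) (C e₀ _)]

end Spin

/-! ### Composition algebras: the form re (x ȳ) under Cayley–Dickson doubling. -/

section Composition

/-- The product and conjugation are bilinear, respectively linear, and `re (x ȳ)` is a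
nondegenerate symmetric form, equal to `re (x̄ y)`. -/
structure HasCompositionForm (A : Type) [AddCommGroup A] [Module ℂ A] [ConjAlgebra A] : Prop where
  mul_add : ∀ x y z : A, ConjAlgebra.mul x (y + z) = ConjAlgebra.mul x y + ConjAlgebra.mul x z
  add_mul : ∀ x y z : A, ConjAlgebra.mul (x + y) z = ConjAlgebra.mul x z + ConjAlgebra.mul y z
  mul_smul : ∀ (a : ℂ) (x y : A), ConjAlgebra.mul x (a • y) = a • ConjAlgebra.mul x y
  smul_mul : ∀ (a : ℂ) (x y : A), ConjAlgebra.mul (a • x) y = a • ConjAlgebra.mul x y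
  conj_add : ∀ x y : A, ConjAlgebra.conj (x + y) = ConjAlgebra.conj x + ConjAlgebra.conj y
  conj_smul : ∀ (a : ℂ) (x : A), ConjAlgebra.conj (a • x) = a • ConjAlgebra.conj x
  re_add : ∀ x y : A, ConjAlgebra.re (x + y) = ConjAlgebra.re x + ConjAlgebra.re y
  re_smul : ∀ (a : ℂ) (x : A), ConjAlgebra.re (a • x) = a * ConjAlgebra.re x
  re_symm : ∀ x y : A, ConjAlgebra.re (ConjAlgebra.mul x (ConjAlgebra.conj y)) =
    ConjAlgebra.re (ConjAlgebra.mul y (ConjAlgebra.conj x))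
  re_conj : ∀ x y : A, ConjAlgebra.re (ConjAlgebra.mul (ConjAlgebra.conj x) y) =
    ConjAlgebra.re (ConjAlgebra.mul x (ConjAlgebra.conj y))
  nondegenerate : ∀ x : A,
    (∀ y : A, ConjAlgebra.re (ConjAlgebra.mul x (ConjAlgebra.conj y)) = 0) → x = 0

theorem hasCompositionForm_trivial : HasCompositionForm PUnit.{1} := by
  constructor <;> intros <;> first | rfl | simp [ConjAlgebra.re]

theorem hasCompositionForm_complex : HasCompositionForm ℂ where
  mul_add := _root_.mul_add
  add_mul := _root_.add_mul
  mul_smul a x y := mul_left_comm x a y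
  smul_mul a x y := mul_assoc a x y
  conj_add _ _ := rfl
  conj_smul _ _ := rfl
  re_add _ _ := rfl
  re_smul _ _ := rfl
  re_symm x y := mul_comm x y
  re_conj _ _ := rfl
  nondegenerate x h := by simpa using (mul_one x).symm.trans (h 1)

instance finite_cayleyDickson (A : Type) [AddCommGroup A] [Module ℂ A] [Module.Finite ℂ A] :
    Module.Finite ℂ (CayleyDickson A) :=
  inferInstanceAs (Module.Finite ℂ (A × A))

namespace HasCompositionForm

variable {A : Type} [AddCommGroup A] [Module ℂ A] [ConjAlgebra A]

section
variable (hA : HasCompositionForm A)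
include hA

theorem mul_neg (x y : A) : ConjAlgebra.mul x (-y) = -ConjAlgebra.mul x y := by
  simpa using hA.mul_smul (-1) x y

theorem conj_neg (x : A) : ConjAlgebra.conj (-x) = -ConjAlgebra.conj x := by
  simpa using hA.conj_smul (-1) x

theorem neg_mul (x y : A) : ConjAlgebra.mul (-x) y = -ConjAlgebra.mul x y := by
  simpa using hA.smul_mul (-1) x y

theorem mul_zero (x : A) : ConjAlgebra.mul x (0 : A) = 0 := by
  simpa using hA.mul_smul 0 x 0

theorem zero_mul (x : A) : ConjAlgebra.mul (0 : A) x = 0 := by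
  simpa using hA.smul_mul 0 0 x

theorem conj_zero : ConjAlgebra.conj (0 : A) = 0 := by
  simpa using hA.conj_smul 0 0

/-- The symmetric bilinear form `re (x ȳ)`. -/
def form (hA : HasCompositionForm A) : LinearMap.BilinForm ℂ A :=
  LinearMap.mk₂ ℂ (fun x y => ConjAlgebra.re (ConjAlgebra.mul x (ConjAlgebra.conj y)))
    (fun x y z => by rw [hA.add_mul, hA.re_add])
    (fun a x y => by rw [hA.smul_mul, hA.re_smul, smul_eq_mul])
    (fun x y z => by rw [hA.conj_add, hA.mul_add, hA.re_add])
    (fun a x y => by rw [hA.conj_smul, hA.mul_smul, hA.re_smul, smul_eq_mul])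

theorem form_apply (x y : A) :
    hA.form x y = ConjAlgebra.re (ConjAlgebra.mul x (ConjAlgebra.conj y)) := rfl

theorem compNorm_eq (x : A) : compNorm x = hA.form x x := rfl

theorem form_comm (x y : A) : hA.form x y = hA.form y x := hA.re_symm x y

theorem exists_form_eq [Module.Finite ℂ A] (χ : A →ₗ[ℂ] ℂ) : ∃ z, ∀ y, hA.form z y = χ y := by
  have hinj : Function.Injective hA.form :=
    (injective_iff_map_eq_zero _).2 fun x hx => hA.nondegenerate x fun y => LinearMap.congr_fun hx y
  have hsurj : Function.Surjective hA.form :=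
    (LinearMap.injective_iff_surjective_of_finrank_eq_finrank
      (Subspace.dual_finrank_eq (K := ℂ) (V := A)).symm).1 hinj
  obtain ⟨z, hz⟩ := hsurj χ
  exact ⟨z, fun y => LinearMap.congr_fun hz y⟩

/-- The form of the double is the orthogonal sum of two copies of the form of A. Neither
associativity nor multiplicativity of the norm enters, so the argument can be iterated up to the
octonions. -/
theorem cayleyDickson : HasCompositionForm (CayleyDickson A) where
  mul_add x y z := Prod.ext
    (by
      change ConjAlgebra.mul x.1 (y.1 + z.1) - ConjAlgebra.mul (ConjAlgebra.conj (y.2 + z.2)) x.2 =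
        (_ - _) + (_ - _)
      rw [hA.mul_add, hA.conj_add, hA.add_mul]; abel)
    (by
      change ConjAlgebra.mul (y.2 + z.2) x.1 + ConjAlgebra.mul x.2 (ConjAlgebra.conj (y.1 + z.1)) =
        (_ + _) + (_ + _)
      rw [hA.add_mul, hA.conj_add, hA.mul_add]; abel)
  add_mul x y z := Prod.ext
    (by
      change ConjAlgebra.mul (x.1 + y.1) z.1 - ConjAlgebra.mul (ConjAlgebra.conj z.2) (x.2 + y.2) =
        (_ - _) + (_ - _)
      rw [hA.add_mul, hA.mul_add]; abel)
    (by
      change ConjAlgebra.mul z.2 (x.1 + y.1) + ConjAlgebra.mul (x.2 + y.2) (ConjAlgebra.conj z.1) =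
        (_ + _) + (_ + _)
      rw [hA.add_mul, hA.mul_add]; abel)
  mul_smul a x y := Prod.ext
    (by
      change ConjAlgebra.mul x.1 (a • y.1) - ConjAlgebra.mul (ConjAlgebra.conj (a • y.2)) x.2 =
        a • (_ - _)
      rw [hA.mul_smul, hA.conj_smul, hA.smul_mul, smul_sub])
    (by
      change ConjAlgebra.mul (a • y.2) x.1 + ConjAlgebra.mul x.2 (ConjAlgebra.conj (a • y.1)) =
        a • (_ + _)
      rw [hA.smul_mul, hA.conj_smul, hA.mul_smul, smul_add])
  smul_mul a x y := Prod.ext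
    (by
      change ConjAlgebra.mul (a • x.1) y.1 - ConjAlgebra.mul (ConjAlgebra.conj y.2) (a • x.2) =
        a • (_ - _)
      rw [hA.mul_smul, hA.smul_mul, smul_sub])
    (by
      change ConjAlgebra.mul y.2 (a • x.1) + ConjAlgebra.mul (a • x.2) (ConjAlgebra.conj y.1) =
        a • (_ + _)
      rw [hA.smul_mul, hA.mul_smul, smul_add])
  conj_add x y := Prod.ext (hA.conj_add x.1 y.1) (neg_add x.2 y.2)
  conj_smul a x := Prod.ext (hA.conj_smul a x.1) (smul_neg a x.2).symm
  re_add x y := hA.re_add x.1 y.1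
  re_smul a x := hA.re_smul a x.1
  re_symm x y := by
    change ConjAlgebra.re (ConjAlgebra.mul x.1 (ConjAlgebra.conj y.1)
        - ConjAlgebra.mul (ConjAlgebra.conj (-y.2)) x.2) =
      ConjAlgebra.re (ConjAlgebra.mul y.1 (ConjAlgebra.conj x.1)
        - ConjAlgebra.mul (ConjAlgebra.conj (-x.2)) y.2)
    rw [hA.conj_neg, hA.conj_neg, hA.neg_mul, hA.neg_mul, sub_neg_eq_add, sub_neg_eq_add,
      hA.re_add, hA.re_add, hA.re_conj, hA.re_conj, hA.re_symm x.1, hA.re_symm x.2]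
  re_conj x y := by
    change ConjAlgebra.re (ConjAlgebra.mul (ConjAlgebra.conj x.1) y.1
        - ConjAlgebra.mul (ConjAlgebra.conj y.2) (-x.2)) =
      ConjAlgebra.re (ConjAlgebra.mul x.1 (ConjAlgebra.conj y.1)
        - ConjAlgebra.mul (ConjAlgebra.conj (-y.2)) x.2)
    rw [hA.conj_neg, hA.neg_mul, hA.mul_neg, sub_neg_eq_add, sub_neg_eq_add,
      hA.re_add, hA.re_add, hA.re_conj]
  nondegenerate x h := by
    have h1 : ∀ y : A × A, ConjAlgebra.re (ConjAlgebra.mul x.1 (ConjAlgebra.conj y.1)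
        - ConjAlgebra.mul (ConjAlgebra.conj (-y.2)) x.2) = 0 := h
    refine Prod.ext (hA.nondegenerate x.1 fun y => ?_) (hA.nondegenerate x.2 fun y => ?_)
    · simpa [hA.conj_zero, hA.zero_mul] using h1 (y, 0)
    · have h2 := h1 (0, y)
      rw [hA.conj_neg, hA.neg_mul, sub_neg_eq_add, hA.conj_zero, hA.mul_zero, zero_add,
        hA.re_conj] at h2
      rw [hA.re_symm, h2]

end

end HasCompositionForm

end Composition

/-! ### No quadric through the adjoints: hermitian matrices, via the Peirce decomposition. -/

section Hermitian

variable {W : Type*} [AddCommGroup W] [Module ℂ W] {C : W →ₗ[ℂ] W →ₗ[ℂ] W →ₗ[ℂ] ℂ}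
  {Q : (W →ₗ[ℂ] ℂ) →ₗ[ℂ] (W →ₗ[ℂ] ℂ) →ₗ[ℂ] ℂ}
  {A : Type} [AddCommGroup A] [Module ℂ A]

/-- The diagonal idempotents of the hermitian matrices. -/
def hermDiag (A : Type) [AddCommGroup A] (i : Fin 3) : Herm3 A := (Pi.single i 1, 0)

/-- The off-diagonal element at the position complementary to the diagonal position `i`. -/
def hermOff (i : Fin 3) (x : A) : Herm3 A := (0, Pi.single i.rev x)

theorem herm_decomposition (t : Herm3 A) :
    t = ∑ i, (t.1 i • hermDiag A i + hermOff i (t.2 i.rev)) := by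
  refine Prod.ext (funext fun j => ?_) (funext fun j => ?_)
  · fin_cases j <;> simp [Fin.sum_univ_three, hermDiag, hermOff]
  · fin_cases j <;> simp [Fin.sum_univ_three, hermDiag, hermOff, Fin.rev]

variable [ConjAlgebra A]

/-- The polarization of the determinant of hermitian matrices. -/
theorem hermDet_polarization (hA : HasCompositionForm A) (hC : IsJordanCubicForm C)
    (e : W ≃ₗ[ℂ] Herm3 A) (h : ∀ t, C t t t = hermDet (e t)) (r s t : Herm3 A) :
    6 * C (e.symm r) (e.symm s) (e.symm t) =
      r.1 0 * (s.1 1 * t.1 2 + t.1 1 * s.1 2 - 2 * hA.form (s.2 2) (t.2 2))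
      + r.1 1 * (s.1 0 * t.1 2 + t.1 0 * s.1 2 - 2 * hA.form (s.2 1) (t.2 1))
      + r.1 2 * (s.1 0 * t.1 1 + t.1 0 * s.1 1 - 2 * hA.form (s.2 0) (t.2 0))
      - 2 * (s.1 0 * hA.form (r.2 2) (t.2 2) + t.1 0 * hA.form (r.2 2) (s.2 2))
      - 2 * (s.1 1 * hA.form (r.2 1) (t.2 1) + t.1 1 * hA.form (r.2 1) (s.2 1))
      - 2 * (s.1 2 * hA.form (r.2 0) (t.2 0) + t.1 2 * hA.form (r.2 0) (s.2 0))
      + 2 * (hA.form (ConjAlgebra.mul (r.2 0) (s.2 2)) (t.2 1)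
        + hA.form (ConjAlgebra.mul (r.2 0) (t.2 2)) (s.2 1)
        + hA.form (ConjAlgebra.mul (s.2 0) (r.2 2)) (t.2 1)
        + hA.form (ConjAlgebra.mul (s.2 0) (t.2 2)) (r.2 1)
        + hA.form (ConjAlgebra.mul (t.2 0) (r.2 2)) (s.2 1)
        + hA.form (ConjAlgebra.mul (t.2 0) (s.2 2)) (r.2 1)) := by
  have := hC.polarization h (e.symm r) (e.symm s) (e.symm t)
  simp only [map_add, LinearEquiv.apply_symm_apply] at this
  rw [this]
  simp only [hermDet, hA.compNorm_eq, ← hA.form_apply]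
  simp only [Prod.fst_add, Prod.snd_add, Pi.add_apply,
    map_add, LinearMap.add_apply, hA.mul_add, hA.add_mul, hA.form_comm (s.2 _) (r.2 _),
    hA.form_comm (t.2 _) (r.2 _), hA.form_comm (t.2 _) (s.2 _)]
  ring

/-- For the diagonal idempotents D_i and the off-diagonal X_i(x) in the complementary position,
C(D_i, D_i) = 0 and C(D_j, X_i(x)) = 0 for j ≠ i. The surviving products C(D_{i+1}, D_{i+2}) and
C(D_i, X_i(x)) span W*, and Q vanishes on all pairs of them by polarized identities with vanishing
terms. -/
theorem VanishesOnAdjoints.eq_zero_of_herm [Module.Finite ℂ A] (hQ : VanishesOnAdjoints C Q)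
    (hC : IsJordanCubicForm C) (hA : HasCompositionForm A)
    (e : W ≃ₗ[ℂ] Herm3 A) (h : ∀ t, C t t t = hermDet (e t)) (φ ψ : W →ₗ[ℂ] ℂ) : Q φ ψ = 0 := by
  have hpol := hermDet_polarization hA hC e h
  set D : Fin 3 → W := fun i => e.symm (hermDiag A i) with hD
  set X : Fin 3 → A → W := fun i x => e.symm (hermOff i x) with hX
  have ext6 : ∀ {r s : W} {χ : W →ₗ[ℂ] ℂ},
      (∀ t, 6 * C r s (e.symm t) = 6 * χ (e.symm t)) → C r s = χ := fun hrs => by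
    ext t
    simpa using hrs (e t)
  have hDD : ∀ i, C (D i) (D i) = 0 := fun i => ext6 fun t => by
    rw [hpol]
    fin_cases i <;> simp [hermDiag, hA.mul_zero]
  have hDX : ∀ i x, C (D (i + 1)) (X i x) = 0 := fun i x => ext6 fun t => by
    rw [hpol]
    fin_cases i <;> simp [hermDiag, hermOff, Fin.rev, hA.mul_zero, hA.zero_mul]
  have hDX' : ∀ i x, C (D (i + 2)) (X i x) = 0 := fun i x => ext6 fun t => by
    rw [hpol]
    fin_cases i <;> simp [hermDiag, hermOff, Fin.rev, hA.mul_zero, hA.zero_mul]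
  have hdiag : ∀ i t, 6 * C (D (i + 1)) (D (i + 2)) (e.symm t) = t.1 i := fun i t => by
    rw [hpol]
    fin_cases i <;> simp [hermDiag, hA.mul_zero, hA.zero_mul]
  have hoff : ∀ i x t, 6 * C (D i) (X i x) (e.symm t) = -2 * hA.form x (t.2 i.rev) :=
      fun i x t => by
    rw [hpol]
    fin_cases i <;> simp [hermDiag, hermOff, Fin.rev, hA.mul_zero, hA.zero_mul]
  -- C(D_{i+1}, D_{i+2}) is 1/6 of the i-th diagonal entry and C(D_i, X_i(z)) is -1/3 of the pairing
  -- of z with the complementary entry; hence the constants 6 and -3 below.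
  have hdecomp : ∀ χ : W →ₗ[ℂ] ℂ, ∃ (a : Fin 3 → ℂ) (z : Fin 3 → A),
      χ = ∑ i, (a i • C (D (i + 1)) (D (i + 2)) + C (D i) (X i (z i))) := by
    intro χ
    have hz : ∀ i, ∃ z, ∀ x, hA.form z x = -3 * χ (X i x) := fun i => by
      let χ' : A →ₗ[ℂ] ℂ := (-3 : ℂ) • χ ∘ₗ e.symm.toLinearMap ∘ₗ
        LinearMap.inr ℂ _ _ ∘ₗ LinearMap.single ℂ (fun _ => A) i.rev
      exact hA.exists_form_eq χ'
    choose z hz using hz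
    refine ⟨fun i => 6 * χ (D i), z, ?_⟩
    ext t
    obtain ⟨t, rfl⟩ := e.symm.surjective t
    conv_lhs => rw [herm_decomposition t, map_sum, map_sum]
    rw [LinearMap.sum_apply]
    refine Finset.sum_congr rfl fun i _ => ?_
    simp only [LinearMap.add_apply, LinearMap.smul_apply, smul_eq_mul, map_add, map_smul]
    linear_combination -χ (D i) * hdiag i t - hoff i (z i) t / 6 + hz i (t.2 i.rev) / 3
  have heps : ∀ i j, Q (C (D (i + 1)) (D (i + 2))) (C (D (j + 1)) (D (j + 2))) = 0 := by
    have h0 : ∀ i, Q (C (D (i + 1)) (D (i + 2))) (C (D (i + 1)) (D (i + 2))) = 0 := fun i => by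
      have := hQ.two_two hC (D (i + 1)) (D (i + 2))
      rw [hDD, hDD, map_zero] at this
      linear_combination this / 2
    have h1 : ∀ i j k, Q (C (D i) (D j)) (C (D j) (D k)) = 0 := fun i j k => by
      have := hQ.two_one_one hC (D i) (D k) (D j)
      rw [hDD, map_zero, hC.comm (D k)] at this
      linear_combination this / 2
    intro i j
    obtain rfl | rfl | rfl : j = i ∨ j = i + 1 ∨ j = i + 2 := by
      revert i j; decide
    · exact h0 _
    · have h2 : i + 1 + 1 = i + 2 := by revert i; decide
      rw [h2]
      exact h1 _ _ _
    · have h2 : i + 2 + 2 = i + 1 := by revert i; decide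
      rw [h2, hQ.symm]
      exact h1 _ _ _
  have hepsoff : ∀ i j x, Q (C (D (i + 1)) (D (i + 2))) (C (D j) (X j x)) = 0 := by
    intro i j x
    obtain rfl | rfl | rfl : j = i ∨ j = i + 1 ∨ j = i + 2 := by
      revert i j; decide
    · have := hQ.polarized hC (D (j + 1)) (D (j + 2)) (D j) (X j x)
      rw [hDX, hDX', map_zero, map_zero, LinearMap.zero_apply] at this
      linear_combination this
    · have := hQ.polarized hC (D (i + 1)) (D (i + 2)) (D (i + 1)) (X (i + 1) x)
      rw [hDD, map_zero, LinearMap.zero_apply, hC.comm (D (i + 2)) (D (i + 1)),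
        hQ.symm (C (D (i + 1)) (X (i + 1) x))] at this
      linear_combination this / 2
    · have := hQ.polarized hC (D (i + 2)) (D (i + 1)) (D (i + 2)) (X (i + 2) x)
      rw [hDD, map_zero, LinearMap.zero_apply, hC.comm (D (i + 2)) (D (i + 1)),
        hQ.symm (C (D (i + 2)) (X (i + 2) x))] at this
      linear_combination this / 2
  have heps' : ∀ i χ, Q (C (D (i + 1)) (D (i + 2))) χ = 0 := fun i χ => by
    obtain ⟨a, z, rfl⟩ := hdecomp χ
    simp [heps, hepsoff]
  have hoff' : ∀ i j x y, Q (C (D i) (X i x)) (C (D j) (X j y)) = 0 := by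
    -- The term with C(X_i, X_{i+1}) is paired with C(D_i, D_{i+1}), which `heps'` makes orthogonal
    -- to everything, and the third contains C(D_i, X_{i+1}) = 0. The product of off-diagonal
    -- elements is therefore never computed.
    have hadj : ∀ i x y, Q (C (D i) (X i x)) (C (D (i + 1)) (X (i + 1) y)) = 0 := fun i x y => by
      have := hQ.polarized hC (D i) (X i x) (D (i + 1)) (X (i + 1) y)
      have h2 : ∀ i : Fin 3, i = i + 1 + 2 := by decide
      have h3 : C (D i) (D (i + 1)) = C (D (i + 2 + 1)) (D (i + 2 + 2)) := by
        have h5 : ∀ i : Fin 3, i + 2 + 1 = i ∧ i + 2 + 2 = i + 1 := by decide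
        rw [(h5 i).1, (h5 i).2]
      have h4 : C (D i) (X (i + 1) y) = 0 := by
        have := hDX' (i + 1) y
        rwa [← h2] at this
      rw [h3, heps', h4, map_zero, LinearMap.zero_apply] at this
      linear_combination this
    intro i j x y
    obtain rfl | rfl | rfl : j = i ∨ j = i + 1 ∨ j = i + 2 := by
      revert i j; decide
    · have := hQ.polarized hC (D j) (X j x) (D j) (X j y)
      rw [hDD, map_zero, LinearMap.zero_apply, hC.comm (X j x), hQ.symm (C (D j) (X j y))] at this
      linear_combination this / 2
    · exact hadj i x y
    · rw [hQ.symm]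
      have h2 : ∀ i : Fin 3, i = i + 2 + 1 := by decide
      have := hadj (i + 2) y x
      rwa [← h2] at this
  obtain ⟨a, z, rfl⟩ := hdecomp φ
  obtain ⟨b, y, rfl⟩ := hdecomp ψ
  simp [heps', hoff', hQ.symm _ (C (D (_ + 1)) (D (_ + 2)))]

end Hermitian

/-! ### Consequences for cubic Jordan algebras: nondegeneracy, and adjoints span the dual. -/

section Consequences

variable {W : Type*} [AddCommGroup W] [Module ℂ W] {C : W →ₗ[ℂ] W →ₗ[ℂ] W →ₗ[ℂ] ℂ}

/-- A quadratic form on the dual of a cubic Jordan algebra that vanishes at all adjoints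
vanishes. -/
theorem VanishesOnAdjoints.eq_zero {Q : (W →ₗ[ℂ] ℂ) →ₗ[ℂ] (W →ₗ[ℂ] ℂ) →ₗ[ℂ] ℂ}
    (hQ : VanishesOnAdjoints C Q) (hC : IsJordanCubicForm C) (φ ψ : W →ₗ[ℂ] ℂ) : Q φ ψ = 0 := by
  rcases hC.cubic with ⟨e, h⟩ | ⟨m, hm, B, hB, hB', e, h⟩ | ⟨e, h⟩ | ⟨e, h⟩ | ⟨e, h⟩ | ⟨e, h⟩ | ⟨e, h⟩
  · exact hQ.eq_zero_of_line e h φ ψ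
  · exact hQ.eq_zero_of_spin hC hm hB hB' e h φ ψ
  · exact hQ.eq_zero_of_herm hC hasCompositionForm_trivial e h φ ψ
  · exact hQ.eq_zero_of_herm hC hasCompositionForm_complex e h φ ψ
  · exact hQ.eq_zero_of_herm hC hasCompositionForm_complex.cayleyDickson e h φ ψ
  · exact hQ.eq_zero_of_herm hC hasCompositionForm_complex.cayleyDickson.cayleyDickson e h φ ψ
  · exact hQ.eq_zero_of_herm hC
      hasCompositionForm_complex.cayleyDickson.cayleyDickson.cayleyDickson e h φ ψ

/-- Apply the vanishing theorem to the rank-one quadratic form φ ↦ φ(w)² on W*. -/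
theorem IsJordanCubicForm.nondegenerate (hC : IsJordanCubicForm C) {w : W}
    (hw : ∀ t, C t t w = 0) : w = 0 := by
  let ev : (W →ₗ[ℂ] ℂ) →ₗ[ℂ] ℂ := Module.Dual.eval ℂ W w
  let Q : (W →ₗ[ℂ] ℂ) →ₗ[ℂ] (W →ₗ[ℂ] ℂ) →ₗ[ℂ] ℂ := ev.smulRight ev
  have hQ : VanishesOnAdjoints C Q := ⟨fun φ ψ => mul_comm _ _, fun t => by
    change C t t w * C t t w = 0
    rw [hw, mul_zero]⟩
  rw [← Module.forall_dual_apply_eq_zero_iff ℂ]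
  intro φ
  exact mul_self_eq_zero.1 (hQ.eq_zero hC φ φ)

/-- The adjoints span the dual space. -/
theorem IsJordanCubicForm.linearMap_ext (hC : IsJordanCubicForm C) [Module.Finite ℂ W]
    {H : Type*} [AddCommGroup H] [Module ℂ H] {L : (W →ₗ[ℂ] ℂ) →ₗ[ℂ] H}
    (hL : ∀ t, L (C t t) = 0) (φ : W →ₗ[ℂ] ℂ) : L φ = 0 := by
  rw [← Module.forall_dual_apply_eq_zero_iff ℂ]
  intro χ
  -- By W** = W, the functional χ ∘ L is evaluation at a vector w, and nondegeneracy gives w = 0.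
  obtain ⟨w, hw⟩ := (Module.evalEquiv ℂ W).surjective (χ ∘ₗ L)
  have h1 : ∀ φ : W →ₗ[ℂ] ℂ, φ w = χ (L φ) := fun φ => LinearMap.congr_fun hw φ
  have h2 : w = 0 := hC.nondegenerate fun t => by rw [h1, hL, map_zero]
  rw [← h1, h2, map_zero]

theorem IsJordanCubicForm.exists_ne_zero (hC : IsJordanCubicForm C) [Nontrivial W] :
    ∃ t, C t t t ≠ 0 := by
  by_contra! h
  obtain ⟨w, hw⟩ := exists_ne (0 : W)
  refine hw (hC.nondegenerate fun t => ?_)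
  have := hC.polarization h t t w
  simpa using this

/-- The adjoints of the elements at which the cubic form does not vanish span the dual space. -/
theorem IsJordanCubicForm.linearMap_ext_of_smul (hC : IsJordanCubicForm C) [Module.Finite ℂ W]
    [Nontrivial W] {H : Type*} [AddCommGroup H] [Module ℂ H] {L : (W →ₗ[ℂ] ℂ) →ₗ[ℂ] H}
    (hL : ∀ t, C t t t • L (C t t) = 0) (φ : W →ₗ[ℂ] ℂ) : L φ = 0 := by
  obtain ⟨t₀, ht₀⟩ := hC.exists_ne_zero
  refine hC.linearMap_ext (fun t => ?_) φ
  rw [← Module.forall_dual_apply_eq_zero_iff ℂ]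
  intro χ
  -- the product of two polynomials vanishes on the line through `t` and `t₀`
  let p : Polynomial ℂ := Polynomial.C (C t t t) + Polynomial.C (3 * C t t t₀) * Polynomial.X
    + Polynomial.C (3 * C t t₀ t₀) * Polynomial.X ^ 2 + Polynomial.C (C t₀ t₀ t₀) * Polynomial.X ^ 3
  let b : W → W → ℂ := fun r s => χ (L (C r s))
  let q : Polynomial ℂ := Polynomial.C (b t t) + Polynomial.C (2 * b t t₀) * Polynomial.X
    + Polynomial.C (b t₀ t₀) * Polynomial.X ^ 2
  have hpq : p * q = 0 := Polynomial.funext fun l => by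
    have h := congrArg χ (hL (t + l • t₀))
    simp only [map_add, map_smul, LinearMap.add_apply, LinearMap.smul_apply, hC.comm t₀ t,
      hC.swap_right t t₀ t, hC.swap_right t₀ t₀ t, smul_eq_mul, map_zero] at h
    simp only [p, q, b, Polynomial.eval_mul, Polynomial.eval_add, Polynomial.eval_C,
      Polynomial.eval_X, Polynomial.eval_pow]
    rw [Polynomial.eval_zero]
    linear_combination h
  have hp : p ≠ 0 := fun h => ht₀ (by
    have := congrArg (fun p => Polynomial.coeff p 3) h
    simp only [p, Polynomial.coeff_add, Polynomial.coeff_C_mul, Polynomial.coeff_X_pow,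
      Polynomial.coeff_X, Polynomial.coeff_C, Polynomial.coeff_zero] at this
    simpa using this)
  have hq : q = 0 := (mul_eq_zero.1 hpq).resolve_left hp
  have := congrArg (Polynomial.eval 0) hq
  simpa [q, b] using this

end Consequences

/-! ### Comparison of coefficients. -/

section Polynomials

/-- A polynomial with coefficients in a complex vector space that vanishes identically has
vanishing coefficients. -/
theorem eq_zero_of_forall_sum_pow_smul_eq_zero {H : Type*} [AddCommGroup H] [Module ℂ H] {n : ℕ}
    {a : Fin n → H} (h : ∀ l : ℂ, ∑ i : Fin n, l ^ (i : ℕ) • a i = 0) (i : Fin n) : a i = 0 := by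
  rw [← Module.forall_dual_apply_eq_zero_iff ℂ]
  intro χ
  let p : Polynomial ℂ := ∑ j : Fin n, Polynomial.C (χ (a j)) * Polynomial.X ^ (j : ℕ)
  have hp : p = 0 := Polynomial.funext fun l => by
    have := congrArg χ (h l)
    simp only [map_sum, map_smul, map_zero, smul_eq_mul] at this
    simp only [p, Polynomial.eval_finsetSum, Polynomial.eval_mul, Polynomial.eval_C,
      Polynomial.eval_pow, Polynomial.eval_X, Polynomial.eval_zero]
    rw [← this]
    exact Finset.sum_congr rfl fun j _ => mul_comm _ _
  have hc : p.coeff i = χ (a i) := by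
    simp only [p, Polynomial.finsetSum_coeff, Polynomial.coeff_C_mul, Polynomial.coeff_X_pow]
    rw [Finset.sum_eq_single i]
    · simp
    · intro j _ hj
      simp [Fin.val_inj, hj.symm]
    · simp
  rw [← hc, hp, Polynomial.coeff_zero]

end Polynomials

/-! ### The equation of the generating functions, solved by commutation relations. -/

section Frame

variable {W : Type*} [AddCommGroup W] [Module ℂ W]

/-- Operators on a complex vector space with the commutation relations of the frame
`X_0, X_a, ∂_{u_0}, ∂_{u_a}, ∂_u`. -/
structure ContactFrame (κ : W →ₗ[ℂ] ℂ) (H : Type*) [AddCommGroup H] [Module ℂ H] where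
  X0 : H →ₗ[ℂ] H
  U0 : H →ₗ[ℂ] H
  Z : H →ₗ[ℂ] H
  X : W →ₗ[ℂ] H →ₗ[ℂ] H
  U : (W →ₗ[ℂ] ℂ) →ₗ[ℂ] H →ₗ[ℂ] H
  X_X0 : ∀ t h, X t (X0 h) = X0 (X t h) + κ t • U0 h
  U0_X0 : ∀ h, U0 (X0 h) = X0 (U0 h) + Z h
  U_X : ∀ φ t h, U φ (X t h) = X t (U φ h) + φ t • Z h
  X_X : ∀ s t h, X s (X t h) = X t (X s h)
  U_U : ∀ φ ψ h, U φ (U ψ h) = U ψ (U φ h)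
  U0_U : ∀ φ h, U0 (U φ h) = U φ (U0 h)
  U_X0 : ∀ φ h, U φ (X0 h) = X0 (U φ h)
  U0_X : ∀ t h, U0 (X t h) = X t (U0 h)
  Z_X0 : ∀ h, Z (X0 h) = X0 (Z h)
  Z_X : ∀ t h, Z (X t h) = X t (Z h)
  Z_U0 : ∀ h, Z (U0 h) = U0 (Z h)
  Z_U : ∀ φ h, Z (U φ h) = U φ (Z h)

namespace ContactFrame

variable {κ : W →ₗ[ℂ] ℂ} {H : Type*} [AddCommGroup H] [Module ℂ H] (𝓕 : ContactFrame κ H)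
  (C : W →ₗ[ℂ] W →ₗ[ℂ] W →ₗ[ℂ] ℂ)

/-- The operator of the vector field `V(l, t)`. -/
noncomputable def V (l : ℂ) (t : W) : H →ₗ[ℂ] H :=
  l ^ 3 • 𝓕.X0 - l ^ 2 • 𝓕.X t - (1 / 2 * C t t t) • 𝓕.U0 - (3 / 2 * l) • 𝓕.U (C t t)

/-- The equation of the generating functions of symmetries. -/
def IsSolution (f : H) : Prop :=
  ∀ l t, 𝓕.V C l t (𝓕.V C l t f) + (l ^ 5 * κ t) • 𝓕.U0 f + l ^ 6 • 𝓕.U κ f = 0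

variable {𝓕 C} {f : H}

/-- Coefficients of l^6 down to l^0, after ordering the products by the commutation relations. In
degree 5 the commutator of X_t and X_0 cancels the term l^5 κ(t) U_0 f; in degree 3 the
contributions -1/2 and 3/2 to N(t) Z f add up to 1. -/
theorem IsSolution.coefficients (hf : 𝓕.IsSolution C f) (t : W) :
    𝓕.X0 (𝓕.X0 f) = -𝓕.U κ f ∧ 𝓕.X0 (𝓕.X t f) = 0 ∧
      𝓕.X t (𝓕.X t f) = (3 : ℂ) • 𝓕.X0 (𝓕.U (C t t) f) ∧
      (3 : ℂ) • 𝓕.X t (𝓕.U (C t t) f) = C t t t • (𝓕.X0 (𝓕.U0 f) - 𝓕.Z f) ∧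
      C t t t • 𝓕.X t (𝓕.U0 f) + (9 / 4 : ℂ) • 𝓕.U (C t t) (𝓕.U (C t t) f) = 0 ∧
      C t t t • 𝓕.U (C t t) (𝓕.U0 f) = 0 ∧ (C t t t) ^ 2 • 𝓕.U0 (𝓕.U0 f) = 0 := by
  have key := eq_zero_of_forall_sum_pow_smul_eq_zero (H := H) (n := 7)
    (a := ![(1 / 4 * (C t t t) ^ 2) • 𝓕.U0 (𝓕.U0 f), (3 / 2 * C t t t) • 𝓕.U (C t t) (𝓕.U0 f),
      C t t t • 𝓕.X t (𝓕.U0 f) + (9 / 4 : ℂ) • 𝓕.U (C t t) (𝓕.U (C t t) f),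
      (3 : ℂ) • 𝓕.X t (𝓕.U (C t t) f) - C t t t • (𝓕.X0 (𝓕.U0 f) - 𝓕.Z f),
      𝓕.X t (𝓕.X t f) - (3 : ℂ) • 𝓕.X0 (𝓕.U (C t t) f),
      -(2 : ℂ) • 𝓕.X0 (𝓕.X t f), 𝓕.X0 (𝓕.X0 f) + 𝓕.U κ f]) fun l => by
    rw [← hf l t]
    simp only [V, LinearMap.sub_apply, LinearMap.smul_apply, map_sub, map_smul, 𝓕.X_X0, 𝓕.U0_X0,
      𝓕.U_X, 𝓕.U0_U, 𝓕.U_X0, 𝓕.U0_X, Fin.sum_univ_succ, Fin.sum_univ_zero, Matrix.cons_val_zero,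
      Matrix.cons_val_succ, Fin.val_zero, Fin.val_succ]
    module
  have h0 := key 0
  have h1 := key 1
  have h2 := key 2
  have h3 := key 3
  have h4 := key 4
  have h5 := key 5
  have h6 := key 6
  simp only [Matrix.cons_val] at h0 h1 h2 h3 h4 h5 h6
  refine ⟨eq_neg_of_add_eq_zero_left h6, ?_, sub_eq_zero.1 h4, sub_eq_zero.1 h3, h2, ?_, ?_⟩
  · simpa using h5
  · linear_combination (norm := module) (2 / 3 : ℂ) • h1
  · linear_combination (norm := module) (4 : ℂ) • h0

section
variable [Module.Finite ℂ W] (hC : IsJordanCubicForm C) {e : W} (he : κ e = 1)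
  (hf : 𝓕.IsSolution C f)
include hC he hf

omit [Module.Finite ℂ W] in
theorem IsSolution.U0_U0 : 𝓕.U0 (𝓕.U0 f) = 0 := by
  have : Nontrivial W := ⟨e, 0, fun h => by simp [h] at he⟩
  obtain ⟨t, ht⟩ := hC.exists_ne_zero
  exact (smul_eq_zero.1 (hf.coefficients t).2.2.2.2.2.2).resolve_left (pow_ne_zero 2 ht)

theorem IsSolution.U_U0 (φ : W →ₗ[ℂ] ℂ) : 𝓕.U φ (𝓕.U0 f) = 0 := by
  have : Nontrivial W := ⟨e, 0, fun h => by simp [h] at he⟩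
  exact hC.linearMap_ext_of_smul (L := 𝓕.U.flip (𝓕.U0 f))
    (fun t => (hf.coefficients t).2.2.2.2.2.1) φ

omit [Module.Finite ℂ W] he in
theorem IsSolution.X_X (s t : W) : 𝓕.X s (𝓕.X t f) = (3 : ℂ) • 𝓕.X0 (𝓕.U (C s t) f) := by
  have h1 := (hf.coefficients (s + t)).2.2.1
  have h2 := (hf.coefficients s).2.2.1
  have h3 := (hf.coefficients t).2.2.1
  simp only [map_add, LinearMap.add_apply, hC.comm t s, 𝓕.X_X t s] at h1
  linear_combination (norm := module) (1 / 2 : ℂ) • (h1 - h2 - h3)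

omit [Module.Finite ℂ W] hC he in
theorem IsSolution.X_X0 (t : W) : 𝓕.X t (𝓕.X0 f) = κ t • 𝓕.U0 f := by
  rw [𝓕.X_X0, (hf.coefficients t).2.1, zero_add]

-- X_s and X_e commute, and applied to X_0 f they give κ(e) X_s U_0 f and κ(s) X_e U_0 f. A single
-- function thus controls all X_s U_0 f.
omit [Module.Finite ℂ W] hC in
theorem IsSolution.X_U0_eq (s : W) : 𝓕.X s (𝓕.U0 f) = κ s • 𝓕.X e (𝓕.U0 f) := by
  have h1 := 𝓕.X_X s e (𝓕.X0 f)
  rw [hf.X_X0, hf.X_X0, map_smul, map_smul, he, one_smul] at h1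
  exact h1

-- Apply X_0 to X_s X_t f = 3 X_0 U_{C(s,t)} f. On the left X_0 X_t f = 0 leaves only a commutator,
-- -κ(s) κ(t) X_e U_0 f; on the right X_0 X_0 f = -U_κ f.
omit [Module.Finite ℂ W] in
theorem IsSolution.U_U_eq (s t : W) :
    (3 : ℂ) • 𝓕.U (C s t) (𝓕.U κ f) = (κ s * κ t) • 𝓕.X e (𝓕.U0 f) := by
  have h1 := congrArg 𝓕.X0 (hf.X_X hC s t)
  have h2 : 𝓕.X0 (𝓕.X s (𝓕.X t f)) = -((κ s * κ t) • 𝓕.X e (𝓕.U0 f)) := by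
    have h3 := 𝓕.X_X0 s (𝓕.X t f)
    rw [(hf.coefficients t).2.1, map_zero, 𝓕.U0_X, hf.X_U0_eq he t, smul_smul] at h3
    exact eq_neg_of_add_eq_zero_left h3.symm
  rw [h2, map_smul, ← 𝓕.U_X0, ← 𝓕.U_X0, (hf.coefficients t).1, map_neg] at h1
  linear_combination (norm := module) h1

/-- If σ = X_e U_0 f were nonzero, `U_U_eq` would give a vector w with C(s,t,w) = κ(s) κ(t). Along t
= e + a w both C(t,t) and N(t) are then explicit polynomials in a, and the l^2 coefficient becomes a
polynomial identity in a that fails. -/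
theorem IsSolution.X_U0 (s : W) : 𝓕.X s (𝓕.U0 f) = 0 := by
  rw [hf.X_U0_eq he]
  suffices h : 𝓕.X e (𝓕.U0 f) = 0 by rw [h, smul_zero]
  set σ := 𝓕.X e (𝓕.U0 f) with hσ
  by_contra hne
  obtain ⟨χ, hχ⟩ : ∃ χ : H →ₗ[ℂ] ℂ, χ σ = 1 := by
    obtain ⟨χ, hχ⟩ : ∃ χ : Module.Dual ℂ H, χ σ ≠ 0 := by
      by_contra! h
      exact hne ((Module.forall_dual_apply_eq_zero_iff ℂ σ).1 h)
    exact ⟨(χ σ)⁻¹ • χ, by simp [hχ]⟩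
  -- The functional φ ↦ 3 χ(U_φ U_κ f) on W* is evaluation at a vector w.
  obtain ⟨w, hw⟩ := (Module.evalEquiv ℂ W).surjective ((3 : ℂ) • χ ∘ₗ 𝓕.U.flip (𝓕.U κ f))
  have hw' : ∀ φ : W →ₗ[ℂ] ℂ, φ w = 3 * χ (𝓕.U φ (𝓕.U κ f)) := fun φ => LinearMap.congr_fun hw φ
  have hCw : ∀ s t, C s t w = κ s * κ t := fun s t => by
    have := congrArg χ (hf.U_U_eq hC he s t)
    rw [map_smul, map_smul, smul_eq_mul, smul_eq_mul, ← hσ, hχ] at this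
    rw [hw', this, mul_one]
  have hCw' : ∀ t, C t w = κ t • κ := fun t => by
    ext s
    rw [hC.swap_right, hCw]
    rfl
  have h2 : ∀ a : ℂ, _ := fun a => congrArg χ (hf.coefficients (e + a • w)).2.2.2.2.1
  simp only [map_add, map_smul, LinearMap.add_apply, LinearMap.smul_apply, hC.comm w, hCw',
    ← hσ, hf.X_U0_eq he w, smul_eq_mul, map_zero, hχ, he, one_smul] at h2
  have h3 := hw' (C e e)
  have h4 := hw' κ
  rw [hCw, he] at h3
  have h5 : χ (𝓕.U κ (𝓕.U (C e e) f)) = χ (𝓕.U (C e e) (𝓕.U κ f)) := by rw [𝓕.U_U]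
  rw [hCw, he] at h2
  set ω := κ w
  have e1 : χ (𝓕.U (C e e) (𝓕.U κ f)) = 1 / 3 := by linear_combination -h3 / 3
  have e2 : χ (𝓕.U κ (𝓕.U κ f)) = ω / 3 := by linear_combination -h4 / 3
  simp only [h5, e1, e2] at h2
  -- The a^4 coefficient is (7/4) ω³, with ω³ from N(t) κ(t) and (3/4) ω³ from the quadratic term.
  -- The fourth difference multiplies it by 24, which gives 42.
  have h6 : ω ^ 3 = 0 := by
    linear_combination (h2 2 + h2 (-2) - 4 * h2 1 - 4 * h2 (-1) + 6 * h2 0) / 42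
  have h7 : ω = 0 := pow_eq_zero_iff three_ne_zero |>.1 h6
  have h8 := h2 1
  have h9 := h2 (-1)
  simp only [h7] at h8 h9
  norm_num at h8 h9
  -- With ω = 0 the linear term is 6 a, namely 3 a from N(e + a w) and 3 a from the mixed second
  -- derivative.
  have h10 : (12 : ℂ) = 0 := by linear_combination h8 - h9
  norm_num at h10

theorem IsSolution.Z_U0 : 𝓕.Z (𝓕.U0 f) = 0 := by
  have h := 𝓕.U_X κ e (𝓕.U0 f)
  rw [hf.X_U0 hC he, hf.U_U0 hC he, map_zero, map_zero, he, one_smul, zero_add] at h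
  exact h.symm

theorem IsSolution.U_Uκ (φ : W →ₗ[ℂ] ℂ) : 𝓕.U φ (𝓕.U κ f) = 0 := by
  refine hC.linearMap_ext (L := 𝓕.U.flip (𝓕.U κ f)) (fun t => ?_) φ
  have h := hf.U_U_eq hC he t t
  rw [hf.X_U0 hC he, smul_zero] at h
  exact (smul_eq_zero.1 h).resolve_left three_ne_zero

/-- U_0 applied to X_t X_t f = 3 X_0 U_{C(t,t)} f leaves only 3 Z U_{C(t,t)} f, and the adjoints
span W*. -/
theorem IsSolution.Z_U (φ : W →ₗ[ℂ] ℂ) : 𝓕.Z (𝓕.U φ f) = 0 := by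
  refine hC.linearMap_ext (L := 𝓕.Z ∘ₗ 𝓕.U.flip f) (fun t => ?_) φ
  have h := congrArg 𝓕.U0 (hf.X_X hC t t)
  rw [𝓕.U0_X, 𝓕.U0_X, hf.X_U0 hC he, map_zero, map_smul, 𝓕.U0_X0, 𝓕.U0_U, hf.U_U0 hC he,
    map_zero, zero_add] at h
  exact (smul_eq_zero.1 h.symm).resolve_left three_ne_zero

/-- Once X_t U_0 f = 0, the l^2 coefficient says that the quadratic form U_φ U_φ f on W* vanishes at
the adjoints. Spanning alone would not suffice here; the vanishing theorem for quadratic forms is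
needed. -/
theorem IsSolution.U_U (φ ψ : W →ₗ[ℂ] ℂ) : 𝓕.U φ (𝓕.U ψ f) = 0 := by
  rw [← Module.forall_dual_apply_eq_zero_iff ℂ]
  intro χ
  let Q : (W →ₗ[ℂ] ℂ) →ₗ[ℂ] (W →ₗ[ℂ] ℂ) →ₗ[ℂ] ℂ :=
    LinearMap.mk₂ ℂ (fun φ ψ => χ (𝓕.U φ (𝓕.U ψ f))) (by simp) (by simp) (by simp) (by simp)
  have hQ : VanishesOnAdjoints C Q := ⟨fun φ ψ => congrArg χ (𝓕.U_U φ ψ f), fun t => by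
    have h := (hf.coefficients t).2.2.2.2.1
    rw [hf.X_U0 hC he, smul_zero, zero_add] at h
    have h' := (smul_eq_zero.1 h).resolve_left (by norm_num)
    change χ _ = 0
    rw [h', map_zero]⟩
  exact hQ.eq_zero hC φ ψ

theorem IsSolution.U0_Z : 𝓕.U0 (𝓕.Z f) = 0 := by
  rw [← 𝓕.Z_U0, hf.Z_U0 hC he]

theorem IsSolution.U_Z (φ : W →ₗ[ℂ] ℂ) : 𝓕.U φ (𝓕.Z f) = 0 := by
  rw [← 𝓕.Z_U, hf.Z_U hC he]

theorem IsSolution.Z_Z : 𝓕.Z (𝓕.Z f) = 0 := by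
  have : Nontrivial W := ⟨e, 0, fun h => by simp [h] at he⟩
  obtain ⟨t, ht⟩ := hC.exists_ne_zero
  have h := congrArg 𝓕.Z (hf.coefficients t).2.2.2.1
  rw [map_smul, map_smul, 𝓕.Z_X, hf.Z_U hC he, map_zero, smul_zero, map_sub, 𝓕.Z_X0,
    hf.Z_U0 hC he, map_zero, zero_sub, smul_neg, eq_comm, neg_eq_zero] at h
  exact (smul_eq_zero.1 h).resolve_left ht

theorem IsSolution.X_Z (t : W) : 𝓕.X t (𝓕.Z f) = 0 := by
  have h := congrArg 𝓕.U0 (hf.coefficients t).2.1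
  rwa [𝓕.U0_X0, 𝓕.U0_X, hf.X_U0 hC he, map_zero, map_zero, 𝓕.Z_X, zero_add] at h

theorem IsSolution.X0_X0_U0_eq : 𝓕.X0 (𝓕.X0 (𝓕.U0 f)) + (2 : ℂ) • 𝓕.X0 (𝓕.Z f) = 0 := by
  have h := congrArg 𝓕.U0 (hf.coefficients e).1
  rw [𝓕.U0_X0, 𝓕.U0_X0, map_add, map_neg, 𝓕.U0_U, hf.U_U0 hC he, 𝓕.Z_X0, neg_zero] at h
  linear_combination (norm := module) h

omit [Module.Finite ℂ W] hC he in
theorem IsSolution.X_Uκ (t : W) :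
    𝓕.X t (𝓕.U κ f) = -(κ t • ((2 : ℂ) • 𝓕.X0 (𝓕.U0 f) + 𝓕.Z f)) := by
  have h := congrArg (𝓕.X t) (hf.coefficients t).1
  rw [𝓕.X_X0, 𝓕.U0_X0, hf.X_X0, map_smul, map_neg] at h
  linear_combination (norm := module) h

/-- The relation X_0 X_0 f = -U_κ f differentiated by U_0, the same differentiated by X_e and then
X_0, and X_0 X_e f = 0 differentiated by U_κ give three linear relations among X_0 Z f, X_0 X_0 U_0
f and X_0 X_e U_κ f. Their only solution is zero. -/
theorem IsSolution.X0_Z : 𝓕.X0 (𝓕.Z f) = 0 := by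
  have h1 := congrArg 𝓕.X0 (hf.X_Uκ e)
  have h2 := congrArg (𝓕.U κ) (hf.coefficients e).2.1
  rw [𝓕.U_X0, 𝓕.U_X, map_add, map_zero, he, one_smul] at h2
  rw [he, one_smul, map_neg, map_add, map_smul] at h1
  have h3 := hf.X0_X0_U0_eq hC he
  have h4 : (4 : ℂ) • 𝓕.X0 (𝓕.Z f) = 0 := by
    linear_combination (norm := module) h2 - h1 + (2 : ℂ) • h3
  exact (smul_eq_zero.1 h4).resolve_left (by norm_num)

theorem IsSolution.X0_X0_U0 : 𝓕.X0 (𝓕.X0 (𝓕.U0 f)) = 0 := by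
  simpa [hf.X0_Z hC he] using hf.X0_X0_U0_eq hC he

theorem IsSolution.X0_X_U (t : W) (φ : W →ₗ[ℂ] ℂ) : 𝓕.X0 (𝓕.X t (𝓕.U φ f)) = 0 := by
  have h := congrArg (𝓕.U φ) (hf.coefficients t).2.1
  rwa [𝓕.U_X0, 𝓕.U_X, map_add, map_smul, hf.X0_Z hC he, smul_zero, add_zero, map_zero] at h

theorem IsSolution.X0_X0_U (φ : W →ₗ[ℂ] ℂ) : 𝓕.X0 (𝓕.X0 (𝓕.U φ f)) = 0 := by
  have h := congrArg (𝓕.U φ) (hf.coefficients e).1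
  rwa [𝓕.U_X0, 𝓕.U_X0, map_neg, hf.U_Uκ hC he, neg_zero] at h

theorem IsSolution.X_X_U (s t : W) (φ : W →ₗ[ℂ] ℂ) : 𝓕.X s (𝓕.X t (𝓕.U φ f)) = 0 := by
  have h := congrArg (𝓕.U φ) (hf.X_X hC s t)
  rwa [𝓕.U_X, 𝓕.U_X, map_add, map_smul, map_smul, 𝓕.Z_X, hf.X_Z hC he, smul_zero, add_zero,
    hf.X_Z hC he, smul_zero, add_zero, 𝓕.U_X0, hf.U_U hC he, map_zero, smul_zero] at h

theorem IsSolution.X_X0_U (t : W) (φ : W →ₗ[ℂ] ℂ) : 𝓕.X t (𝓕.X0 (𝓕.U φ f)) = 0 := by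
  rw [𝓕.X_X0, hf.X0_X_U hC he, 𝓕.U0_U, hf.U_U0 hC he, smul_zero, zero_add]

-- Polarization of the l^3 coefficient. It will say that the matrix of the X_b U^a f multiplies the
-- cubic by the scalar X_0 U_0 f - Z f, hence annihilates it after a shift by a multiple of the
-- identity.
omit [Module.Finite ℂ W] he in
theorem IsSolution.X_U_polarized (r s t : W) :
    𝓕.X r (𝓕.U (C s t) f) + 𝓕.X s (𝓕.U (C r t) f) + 𝓕.X t (𝓕.U (C r s) f) =
      C r s t • (𝓕.X0 (𝓕.U0 f) - 𝓕.Z f) := by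
  have key : ∀ s t, (2 : ℂ) • 𝓕.X t (𝓕.U (C t s) f) + 𝓕.X s (𝓕.U (C t t) f) =
      C t t s • (𝓕.X0 (𝓕.U0 f) - 𝓕.Z f) := fun s t => by
    have h1 := (hf.coefficients (t + s)).2.2.2.1
    have h2 := (hf.coefficients (t - s)).2.2.2.1
    have h3 := (hf.coefficients s).2.2.2.1
    simp only [map_add, map_sub, LinearMap.add_apply, LinearMap.sub_apply, hC.comm s t,
      hC.swap_right t s t, hC.swap_right s s t] at h1 h2
    linear_combination (norm := module) (1 / 6 : ℂ) • h1 - (1 / 6 : ℂ) • h2 - (1 / 3 : ℂ) • h3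
  have h1 := key t (r + s)
  have h2 := key t r
  have h3 := key t s
  simp only [map_add, LinearMap.add_apply, hC.comm s r] at h1
  linear_combination (norm := module) (1 / 2 : ℂ) • h1 - (1 / 2 : ℂ) • h2 - (1 / 2 : ℂ) • h3

end

end ContactFrame

end Frame

open TopologicalSpace (Opens)

/-! ### Holomorphic functions on an open set and derivations along vector fields. -/

section Holomorphic

variable {E : Type*} [NormedAddCommGroup E] [NormedSpace ℂ E]

/-- The algebra of holomorphic functions on an open set. -/
def HolFun (U : Opens E) : Subalgebra ℂ (U → ℂ) where
  carrier := {F | ∃ f : E → ℂ, DifferentiableOn ℂ f U ∧ ∀ m : U, F m = f m}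
  mul_mem' := by
    rintro F G ⟨f, hf, hF⟩ ⟨g, hg, hG⟩
    exact ⟨fun m => f m * g m, hf.fun_mul hg, fun m => by rw [Pi.mul_apply, hF, hG]⟩
  add_mem' := by
    rintro F G ⟨f, hf, hF⟩ ⟨g, hg, hG⟩
    exact ⟨fun m => f m + g m, hf.fun_add hg, fun m => by rw [Pi.add_apply, hF, hG]⟩
  algebraMap_mem' a := ⟨fun _ => a, differentiableOn_const a, fun _ => rfl⟩

namespace HolFun

variable {U : Opens E}

/-- The restriction to `U` of a function that is holomorphic on `U`. -/
def mk (f : E → ℂ) (hf : DifferentiableOn ℂ f U) : HolFun U := ⟨fun m => f m, f, hf, fun _ => rfl⟩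

@[simp] theorem mk_apply (f : E → ℂ) (hf : DifferentiableOn ℂ f U) (m : U) :
    (mk f hf).1 m = f m := rfl

theorem exists_eq_mk (F : HolFun U) : ∃ f, ∃ hf : DifferentiableOn ℂ f U, F = mk f hf := by
  obtain ⟨F, f, hf, h⟩ := F
  exact ⟨f, hf, Subtype.ext (funext h)⟩

/-- The extension by zero. -/
noncomputable def extend (F : HolFun U) : E → ℂ := Function.extend Subtype.val F.1 0

theorem extend_apply (F : HolFun U) (m : U) : (extend F) m = F.1 m :=
  Subtype.val_injective.extend_apply _ _ _

/-- U is open, so the extension by zero coincides with f near every point of U; its values off U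
never matter. -/
theorem fderiv_extend_mk {f : E → ℂ} (hf : DifferentiableOn ℂ f U) {m : E} (hm : m ∈ U) :
    fderiv ℂ (extend (mk f hf)) m = fderiv ℂ f m := by
  refine Filter.EventuallyEq.fderiv_eq ?_
  filter_upwards [U.isOpen.mem_nhds hm] with x hx using extend_apply (mk f hf) ⟨x, hx⟩

theorem differentiableOn_extend (F : HolFun U) : DifferentiableOn ℂ (extend F) U := by
  obtain ⟨f, hf, rfl⟩ := exists_eq_mk F
  exact hf.congr fun x hx => extend_apply (mk f hf) ⟨x, hx⟩

variable [FiniteDimensional ℂ E]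

theorem differentiableOn_fderiv_field {f : E → ℂ} (hf : DifferentiableOn ℂ f U) {v : E → E}
    (hv : Differentiable ℂ v) : DifferentiableOn ℂ (fun m => fderiv ℂ f m (v m)) U :=
  (differentiableOn_fderiv_of_holomorphic U.isOpen hf).clm_apply hv.differentiableOn

/-- The derivative along a holomorphic vector field. -/
noncomputable def along (U : Opens E) (v : E → E) (hv : Differentiable ℂ v) :
    Derivation ℂ (HolFun U) (HolFun U) :=
  Derivation.mk'
    { toFun := fun F => mk (fun m => fderiv ℂ (extend F) m (v m))
        (differentiableOn_fderiv_field (differentiableOn_extend F) hv)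
      map_add' := fun F G => by
        obtain ⟨f, hf, rfl⟩ := exists_eq_mk F
        obtain ⟨g, hg, rfl⟩ := exists_eq_mk G
        refine Subtype.ext (funext fun m => ?_)
        have h : mk f hf + mk g hg = mk (fun m => f m + g m) (hf.fun_add hg) := rfl
        have hm := U.isOpen.mem_nhds m.2
        simp only [h, mk_apply, fderiv_extend_mk _ m.2, Subalgebra.coe_add, Pi.add_apply]
        rw [fderiv_fun_add (hf.differentiableAt hm) (hg.differentiableAt hm)]
        rfl
      map_smul' := fun a F => by
        obtain ⟨f, hf, rfl⟩ := exists_eq_mk F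
        refine Subtype.ext (funext fun m => ?_)
        have h : a • mk f hf = mk (fun m => a • f m) (hf.fun_const_smul a) := rfl
        have hm := U.isOpen.mem_nhds m.2
        simp only [h, mk_apply, fderiv_extend_mk _ m.2, Subalgebra.coe_smul, Pi.smul_apply,
          RingHom.id_apply]
        rw [fderiv_fun_const_smul (hf.differentiableAt hm)]
        rfl }
    fun F G => by
      obtain ⟨f, hf, rfl⟩ := exists_eq_mk F
      obtain ⟨g, hg, rfl⟩ := exists_eq_mk G
      refine Subtype.ext (funext fun m => ?_)
      have h : mk f hf * mk g hg = mk (fun m => f m * g m) (hf.fun_mul hg) := rfl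
      have hm := U.isOpen.mem_nhds m.2
      simp only [h, LinearMap.coe_mk, AddHom.coe_mk, mk_apply, fderiv_extend_mk _ m.2,
        Subalgebra.coe_add, Pi.add_apply, smul_eq_mul, Subalgebra.coe_mul, Pi.mul_apply]
      rw [fderiv_fun_mul (hf.differentiableAt hm) (hg.differentiableAt hm)]
      rfl

theorem along_mk {v : E → E} (hv : Differentiable ℂ v) {f : E → ℂ} (hf : DifferentiableOn ℂ f U) :
    along U v hv (mk f hf) =
      mk (fun m => fderiv ℂ f m (v m)) (differentiableOn_fderiv_field hf hv) := by
  refine Subtype.ext (funext fun m => ?_)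
  change fderiv ℂ (extend (mk f hf)) m (v m) = fderiv ℂ f m (v m)
  rw [fderiv_extend_mk hf m.2]

theorem along_mk_apply {v : E → E} (hv : Differentiable ℂ v) {f : E → ℂ}
    (hf : DifferentiableOn ℂ f U) (m : U) :
    (along U v hv (mk f hf)).1 m = fderiv ℂ f m (v m) := by
  rw [along_mk, mk_apply]

/-- The commutator of the derivatives along two vector fields is the derivative along their
bracket. -/
theorem along_along {u v w : E → E} (hu : Differentiable ℂ u) (hv : Differentiable ℂ v)
    (hw : Differentiable ℂ w) (a : ℂ) (h : ∀ m, VectorField.lieBracket ℂ u v m = a • w m)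
    (F : HolFun U) :
    along U u hu (along U v hv F) = along U v hv (along U u hu F) + a • along U w hw F := by
  obtain ⟨f, hf, rfl⟩ := exists_eq_mk F
  simp only [along_mk]
  refine Subtype.ext (funext fun m => ?_)
  have hm := U.isOpen.mem_nhds m.2
  have hd : DifferentiableAt ℂ (fderiv ℂ f) m :=
    (differentiableOn_fderiv_of_holomorphic U.isOpen hf).differentiableAt hm
  have hsymm := second_derivative_symmetric_of_eventually (𝕜 := ℂ) (f := f) (f' := fderiv ℂ f)
    (by filter_upwards [hm] with y hy using
          (hf.differentiableAt (U.isOpen.mem_nhds hy)).hasFDerivAt) hd.hasFDerivAt (u m) (v m)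
  simp only [mk_apply, Subalgebra.coe_add, Pi.add_apply, Subalgebra.coe_smul, Pi.smul_apply,
    ← map_smul]
  rw [fderiv_clm_apply hd (hv m), fderiv_clm_apply hd (hu m)]
  simp only [_root_.add_apply, ContinuousLinearMap.comp_apply,
    ContinuousLinearMap.flip_apply, hsymm, ← h, VectorField.lieBracket, map_sub]
  ring

theorem along_comm {u v : E → E} (hu : Differentiable ℂ u) (hv : Differentiable ℂ v)
    (h : ∀ m, VectorField.lieBracket ℂ u v m = 0) (F : HolFun U) :
    along U u hu (along U v hv F) = along U v hv (along U u hu F) := by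
  rw [along_along hu hv hu 0 (by simpa using h), zero_smul, add_zero]

-- Connectedness of the domain enters the classification through this statement.
omit [FiniteDimensional ℂ E] in
theorem exists_eq_algebraMap {F : HolFun U} (hU : IsPreconnected (U : Set E))
    (h : ∀ m : U, fderiv ℂ (extend F) m = 0) : ∃ a : ℂ, F = algebraMap ℂ _ a := by
  obtain ⟨a, ha⟩ := U.isOpen.exists_is_const_of_fderiv_eq_zero hU (differentiableOn_extend F)
    fun x hx => h ⟨x, hx⟩
  exact ⟨a, Subtype.ext (funext fun m => (extend_apply F m).symm.trans (ha m m.2))⟩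

end HolFun

end Holomorphic

/-! ### The frame of the jet space and its commutation relations. -/

section JetFrame

variable {d : ℕ} {W : Type*} [AddCommGroup W] [Module ℂ W] (w : Module.Basis (Fin d) ℂ W)
  (c : Fin d)

/-- The vector field `t^a X_a`. -/
noncomputable def fieldX (t : W) (m : J1 d) : J1 d := ∑ a, w.repr t a • frameX a m

/-- The vector field `φ(w_a) ∂_{u_a}`. -/
noncomputable def fieldU (φ : W →ₗ[ℂ] ℂ) (_ : J1 d) : J1 d := ∑ a, φ (w a) • ddp a.succ

theorem fieldX_eq (t : W) (m : J1 d) : fieldX w t m =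
    (Fin.cons 0 (w.repr t), ∑ a, w.repr t a * m.2.2 a.succ, 0) := by
  refine Prod.ext (funext fun i => ?_) (Prod.ext ?_ (funext fun i => ?_))
  · refine Fin.cases ?_ (fun a => ?_) i
    · simp [fieldX, frameX, ddx, ddu, Prod.fst_sum]
    · simp [fieldX, frameX, ddx, ddu, Prod.fst_sum, Pi.single_apply]
  · simp [fieldX, frameX, ddx, ddu, Prod.fst_sum, Prod.snd_sum]
  · simp [fieldX, frameX, ddx, ddu, Prod.snd_sum]

theorem fieldU_eq (φ : W →ₗ[ℂ] ℂ) (m : J1 d) : fieldU w φ m =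
    (0, 0, Fin.cons 0 fun a => φ (w a)) := by
  refine Prod.ext (funext fun i => ?_) (Prod.ext ?_ (funext fun i => ?_))
  · simp [fieldU, ddp, Prod.fst_sum]
  · simp [fieldU, ddp, Prod.snd_sum, Prod.fst_sum]
  · refine Fin.cases ?_ (fun a => ?_) i
    · simp [fieldU, ddp, Prod.snd_sum]
    · simp [fieldU, ddp, Prod.snd_sum, Pi.single_apply]

theorem frameX0_eq (m : J1 d) : frameX0 c m = (Pi.single 0 1, m.2.2 0, Pi.single 0 (m.1 c.succ)) := by
  refine Prod.ext ?_ (Prod.ext ?_ (funext fun i => ?_))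
  · simp [frameX0, ddx, ddu, ddp]
  · simp [frameX0, ddx, ddu, ddp]
  · refine Fin.cases ?_ (fun a => ?_) i <;> simp [frameX0, ddx, ddu, ddp]

theorem hasFDerivAt_frameX0 (m : J1 d) : ∃ L : J1 d →L[ℂ] J1 d, HasFDerivAt (frameX0 c) L m ∧
    ∀ v, L v = (0, v.2.2 0, Pi.single 0 (v.1 c.succ)) := by
  let L : J1 d →ₗ[ℂ] J1 d :=
    { toFun := fun v => (0, v.2.2 0, Pi.single 0 (v.1 c.succ))
      map_add' := fun u v => by ext <;> simp [Pi.single_add]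
      map_smul' := fun a v => by
        refine Prod.ext ?_ (Prod.ext ?_ ?_)
        · simp
        · simp
        · exact Pi.single_smul' 0 a _ }
  refine ⟨LinearMap.toContinuousLinearMap L, ?_, fun v => rfl⟩
  have h : frameX0 c = fun m => (Pi.single 0 1, 0, 0) + LinearMap.toContinuousLinearMap L m := by
    funext m
    rw [frameX0_eq]
    refine Prod.ext ?_ (Prod.ext ?_ ?_) <;> simp [L]
  rw [h]
  exact (LinearMap.toContinuousLinearMap L).hasFDerivAt.const_add _

theorem hasFDerivAt_fieldX (t : W) (m : J1 d) : ∃ L : J1 d →L[ℂ] J1 d,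
    HasFDerivAt (fieldX w t) L m ∧ ∀ v, L v = (0, ∑ a, w.repr t a * v.2.2 a.succ, 0) := by
  let L : J1 d →ₗ[ℂ] J1 d :=
    { toFun := fun v => (0, ∑ a, w.repr t a * v.2.2 a.succ, 0)
      map_add' := fun u v => by ext <;> simp [mul_add, Finset.sum_add_distrib]
      map_smul' := fun a v => by ext <;> simp [Finset.mul_sum, mul_left_comm] }
  refine ⟨LinearMap.toContinuousLinearMap L, ?_, fun v => rfl⟩
  have h : fieldX w t =
      fun m => (Fin.cons 0 (w.repr t), 0, 0) + LinearMap.toContinuousLinearMap L m := by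
    funext m
    rw [fieldX_eq]
    refine Prod.ext ?_ (Prod.ext ?_ ?_) <;> simp [L]
  rw [h]
  exact (LinearMap.toContinuousLinearMap L).hasFDerivAt.const_add _

theorem fderiv_frameX0 (m v : J1 d) :
    fderiv ℂ (frameX0 c) m v = (0, v.2.2 0, Pi.single 0 (v.1 c.succ)) := by
  obtain ⟨L, hL, h⟩ := hasFDerivAt_frameX0 c m
  rw [hL.fderiv, h]

theorem fderiv_fieldX (t : W) (m v : J1 d) :
    fderiv ℂ (fieldX w t) m v = (0, ∑ a, w.repr t a * v.2.2 a.succ, 0) := by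
  obtain ⟨L, hL, h⟩ := hasFDerivAt_fieldX w t m
  rw [hL.fderiv, h]

theorem differentiable_frameX0 : Differentiable ℂ (frameX0 c) := fun m => by
  obtain ⟨L, hL, -⟩ := hasFDerivAt_frameX0 c m
  exact hL.differentiableAt

theorem differentiable_fieldX (t : W) : Differentiable ℂ (fieldX w t) := fun m => by
  obtain ⟨L, hL, -⟩ := hasFDerivAt_fieldX w t m
  exact hL.differentiableAt

theorem differentiable_fieldU (φ : W →ₗ[ℂ] ℂ) : Differentiable ℂ (fieldU w φ) :=
  differentiable_const (∑ a, φ (w a) • ddp a.succ)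

theorem fderiv_fieldU (φ : W →ₗ[ℂ] ℂ) (m v : J1 d) : fderiv ℂ (fieldU w φ) m v = 0 := by
  change fderiv ℂ (fun _ : J1 d => ∑ a, φ (w a) • ddp a.succ) m v = 0
  rw [fderiv_fun_const]
  rfl

end JetFrame

section JetFrame

variable {d : ℕ} {W : Type*} [AddCommGroup W] [Module ℂ W] (w : Module.Basis (Fin d) ℂ W)
  (c : Fin d) (U : Opens (J1 d))

theorem fieldX_add (s t : W) (m : J1 d) : fieldX w (s + t) m = fieldX w s m + fieldX w t m := by
  simp [fieldX, add_smul, Finset.sum_add_distrib]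

theorem fieldX_smul (a : ℂ) (t : W) (m : J1 d) : fieldX w (a • t) m = a • fieldX w t m := by
  simp [fieldX, mul_smul, Finset.smul_sum]

theorem fieldU_add (φ ψ : W →ₗ[ℂ] ℂ) (m : J1 d) :
    fieldU w (φ + ψ) m = fieldU w φ m + fieldU w ψ m := by
  simp [fieldU, add_smul, Finset.sum_add_distrib]

theorem fieldU_smul (a : ℂ) (φ : W →ₗ[ℂ] ℂ) (m : J1 d) :
    fieldU w (a • φ) m = a • fieldU w φ m := by
  simp [fieldU, mul_smul, Finset.smul_sum]

theorem sum_repr_mul (φ : W →ₗ[ℂ] ℂ) (t : W) : ∑ a, w.repr t a * φ (w a) = φ t := by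
  conv_rhs => rw [← w.sum_repr t, map_sum]
  simp

/-- The derivatives along the frame of the first jet space. -/
noncomputable def jetFrame : ContactFrame (w.coord c) (HolFun U) where
  X0 := HolFun.along U (frameX0 c) (differentiable_frameX0 c)
  U0 := HolFun.along U (fun _ => ddp 0) (differentiable_const _)
  Z := HolFun.along U (fun _ => ddu) (differentiable_const _)
  X :=
    { toFun := fun t => HolFun.along U (fieldX w t) (differentiable_fieldX w t)
      map_add' := fun s t => LinearMap.ext fun F => Subtype.ext (funext fun m => by
        change fderiv ℂ (HolFun.extend F) m (fieldX w (s + t) m) = fderiv ℂ (HolFun.extend F) m _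
          + fderiv ℂ (HolFun.extend F) m _
        rw [fieldX_add, map_add])
      map_smul' := fun a t => LinearMap.ext fun F => Subtype.ext (funext fun m => by
        change fderiv ℂ (HolFun.extend F) m (fieldX w (a • t) m) =
          a • fderiv ℂ (HolFun.extend F) m _
        rw [fieldX_smul, map_smul]) }
  U :=
    { toFun := fun φ => HolFun.along U (fieldU w φ) (differentiable_fieldU w φ)
      map_add' := fun s t => LinearMap.ext fun F => Subtype.ext (funext fun m => by
        change fderiv ℂ (HolFun.extend F) m (fieldU w (s + t) m) = fderiv ℂ (HolFun.extend F) m _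
          + fderiv ℂ (HolFun.extend F) m _
        rw [fieldU_add, map_add])
      map_smul' := fun a t => LinearMap.ext fun F => Subtype.ext (funext fun m => by
        change fderiv ℂ (HolFun.extend F) m (fieldU w (a • t) m) =
          a • fderiv ℂ (HolFun.extend F) m _
        rw [fieldU_smul, map_smul]) }
  -- The term x^c ∂_{u_0} of X_0 produces this bracket, the only nonzero one that is not a multiple
  -- of ∂_u.
  X_X0 t F := HolFun.along_along (differentiable_fieldX w t) (differentiable_frameX0 c)
    (differentiable_const (ddp 0)) _ (fun m => by
    simp only [VectorField.lieBracket, fderiv_frameX0, fderiv_fieldX]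
    simp [fieldX_eq, frameX0_eq, ddp, ← Pi.single_smul']) F
  U0_X0 F := by
    have := HolFun.along_along (U := U) (differentiable_const (ddp 0)) (differentiable_frameX0 c)
      (differentiable_const ddu) 1 (fun m => by
        simp only [VectorField.lieBracket, fderiv_frameX0, fderiv_fun_const]
        simp [ddp, ddu]) F
    rwa [one_smul] at this
  U_X φ t F := HolFun.along_along (differentiable_fieldU w φ) (differentiable_fieldX w t)
    (differentiable_const ddu) _ (fun m => by
    simp only [VectorField.lieBracket, fderiv_fieldX, fderiv_fieldU, fieldU_eq, Fin.cons_succ,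
      sum_repr_mul]
    simp [ddu]) F
  X_X s t F := HolFun.along_comm (differentiable_fieldX w s) (differentiable_fieldX w t) (fun m => by
    simp only [VectorField.lieBracket, fderiv_fieldX, fieldX_eq]
    simp) F
  U_U φ ψ F := HolFun.along_comm (differentiable_fieldU w φ) (differentiable_fieldU w ψ) (fun m => by
    simp only [VectorField.lieBracket, fderiv_fieldU, sub_zero]) F
  U0_U φ F := HolFun.along_comm (differentiable_const (ddp 0)) (differentiable_fieldU w φ) (fun m => by
    simp only [VectorField.lieBracket, fderiv_fieldU, fderiv_fun_const]
    simp) F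
  U_X0 φ F := HolFun.along_comm (differentiable_fieldU w φ) (differentiable_frameX0 c) (fun m => by
    simp only [VectorField.lieBracket, fderiv_fieldU, fderiv_frameX0, fieldU_eq]
    simp) F
  U0_X t F := HolFun.along_comm (differentiable_const (ddp 0)) (differentiable_fieldX w t) (fun m => by
    simp only [VectorField.lieBracket, fderiv_fieldX, fderiv_fun_const]
    simp [ddp]) F
  Z_X0 F := HolFun.along_comm (differentiable_const ddu) (differentiable_frameX0 c) (fun m => by
    simp only [VectorField.lieBracket, fderiv_frameX0, fderiv_fun_const]
    simp [ddu]) F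
  Z_X t F := HolFun.along_comm (differentiable_const ddu) (differentiable_fieldX w t) (fun m => by
    simp only [VectorField.lieBracket, fderiv_fieldX, fderiv_fun_const]
    simp [ddu]) F
  Z_U0 F := HolFun.along_comm (differentiable_const ddu) (differentiable_const (ddp 0)) (fun m => by
    simp only [VectorField.lieBracket, fderiv_fun_const]
    simp) F
  Z_U φ F := HolFun.along_comm (differentiable_const ddu) (differentiable_fieldU w φ) (fun m => by
    simp only [VectorField.lieBracket, fderiv_fieldU, fderiv_fun_const]
    simp) F

variable (C : W →ₗ[ℂ] W →ₗ[ℂ] W →ₗ[ℂ] ℂ)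

theorem fieldV_eq (hC : IsJordanCubicForm C) (l : ℂ) (t : W) (m : J1 d) : fieldV C w c l t m =
    l ^ 3 • frameX0 c m - l ^ 2 • fieldX w t m - (1 / 2 * C t t t) • ddp 0
      - (3 / 2 * l) • fieldU w (C t t) m := by
  have : ∀ a, C (w a) t t = C t t (w a) := fun a => by rw [hC.swap_left, hC.swap_right]
  simp [fieldV, fieldX, fieldU, this]

/-- The derivation given by the vector field `V(l, t)`. -/
noncomputable def derivV (l : ℂ) (t : W) : Derivation ℂ (HolFun U) (HolFun U) :=
  l ^ 3 • HolFun.along U (frameX0 c) (differentiable_frameX0 c)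
    - l ^ 2 • HolFun.along U (fieldX w t) (differentiable_fieldX w t)
    - (1 / 2 * C t t t) • HolFun.along U (fun _ => ddp 0) (differentiable_const _)
    - (3 / 2 * l) • HolFun.along U (fieldU w (C t t)) (differentiable_fieldU w _)

theorem jetFrame_V (l : ℂ) (t : W) (F : HolFun U) :
    (jetFrame w c U).V C l t F = derivV w c U C l t F := rfl

end JetFrame

/-! ### Evaluation, coordinate functions, and verification that the listed functions are solutions.
-/

namespace HolFun

section Evaluation

variable {E : Type*} [NormedAddCommGroup E] [NormedSpace ℂ E] {U : Opens E}

/-- The evaluation at a point. -/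
def evalAt (m : U) : HolFun U →ₐ[ℂ] ℂ := (Pi.evalAlgHom ℂ (fun _ : U => ℂ) m).comp (HolFun U).val

theorem evalAt_eq (m : U) (F : HolFun U) : evalAt m F = F.1 m := rfl

@[simp] theorem evalAt_mk (m : U) {f : E → ℂ} (hf : DifferentiableOn ℂ f U) :
    evalAt m (mk f hf) = f m := rfl

theorem ext_evalAt {F G : HolFun U} (h : ∀ m, evalAt m F = evalAt m G) : F = G :=
  Subtype.ext (funext h)

theorem evalAt_deriv_deriv_mul (D : Derivation ℂ (HolFun U) (HolFun U)) (F G : HolFun U) (m : U) :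
    evalAt m (D (D (F * G))) = evalAt m F * evalAt m (D (D G))
      + 2 * (evalAt m (D F) * evalAt m (D G)) + evalAt m (D (D F)) * evalAt m G := by
  simp only [Derivation.leibniz, map_add, map_mul, smul_eq_mul]
  ring

end Evaluation

section Coordinates

variable {d : ℕ} (U : Opens (J1 d))

/-- The coordinate function `x^i`. -/
noncomputable def cx (i : Fin (d + 1)) : HolFun U := mk (fun m => m.1 i) (by fun_prop)

/-- The coordinate function `u`. -/
noncomputable def cu : HolFun U := mk (fun m => m.2.1) (by fun_prop)

/-- The coordinate function `u_i`. -/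
noncomputable def cp (i : Fin (d + 1)) : HolFun U := mk (fun m => m.2.2 i) (by fun_prop)

variable {U}

@[simp] theorem evalAt_cx (m : U) (i : Fin (d + 1)) : evalAt m (cx U i) = m.1.1 i := rfl
@[simp] theorem evalAt_cu (m : U) : evalAt m (cu U) = m.1.2.1 := rfl
@[simp] theorem evalAt_cp (m : U) (i : Fin (d + 1)) : evalAt m (cp U i) = m.1.2.2 i := rfl

theorem evalAt_along_cx {v : J1 d → J1 d} (hv : Differentiable ℂ v) (m : U) (i : Fin (d + 1)) :
    evalAt m (along U v hv (cx U i)) = (v m).1 i := by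
  rw [evalAt_eq, cx, along_mk_apply]
  let L : J1 d →L[ℂ] ℂ := ContinuousLinearMap.proj i ∘L ContinuousLinearMap.fst ℂ _ _
  exact congrArg (fun L' : J1 d →L[ℂ] ℂ => L' (v m)) L.hasFDerivAt.fderiv

theorem evalAt_along_cu {v : J1 d → J1 d} (hv : Differentiable ℂ v) (m : U) :
    evalAt m (along U v hv (cu U)) = (v m).2.1 := by
  rw [evalAt_eq, cu, along_mk_apply]
  let L : J1 d →L[ℂ] ℂ := ContinuousLinearMap.fst ℂ _ _ ∘L ContinuousLinearMap.snd ℂ _ _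
  exact congrArg (fun L' : J1 d →L[ℂ] ℂ => L' (v m)) L.hasFDerivAt.fderiv

theorem evalAt_along_cp {v : J1 d → J1 d} (hv : Differentiable ℂ v) (m : U) (i : Fin (d + 1)) :
    evalAt m (along U v hv (cp U i)) = (v m).2.2 i := by
  rw [evalAt_eq, cp, along_mk_apply]
  let L : J1 d →L[ℂ] ℂ := ContinuousLinearMap.proj i ∘L
    (ContinuousLinearMap.snd ℂ _ _ ∘L ContinuousLinearMap.snd ℂ _ _)
  exact congrArg (fun L' : J1 d →L[ℂ] ℂ => L' (v m)) L.hasFDerivAt.fderiv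

end Coordinates

end HolFun

open HolFun

section FrameDerivations

variable {d : ℕ} {W : Type*} [AddCommGroup W] [Module ℂ W] (w : Module.Basis (Fin d) ℂ W)
  (c : Fin d) (U : Opens (J1 d))

/-- The derivation `X_0`. -/
noncomputable def derivX0 : Derivation ℂ (HolFun U) (HolFun U) :=
  along U (frameX0 c) (differentiable_frameX0 c)

/-- The derivation `t^a X_a`. -/
noncomputable def derivX (t : W) : Derivation ℂ (HolFun U) (HolFun U) :=
  along U (fieldX w t) (differentiable_fieldX w t)

/-- The derivation `∂/∂u_0`. -/
noncomputable def derivU0 : Derivation ℂ (HolFun U) (HolFun U) :=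
  along U (fun _ => ddp 0) (differentiable_const _)

/-- The derivation `φ(w_a) ∂/∂u_a`. -/
noncomputable def derivU (φ : W →ₗ[ℂ] ℂ) : Derivation ℂ (HolFun U) (HolFun U) :=
  along U (fieldU w φ) (differentiable_fieldU w φ)

/-- The derivation `∂/∂u`. -/
noncomputable def derivZ : Derivation ℂ (HolFun U) (HolFun U) :=
  along U (fun _ => ddu) (differentiable_const _)

variable {w c U}

theorem jetFrame_X0 (F : HolFun U) : (jetFrame w c U).X0 F = derivX0 c U F := rfl
theorem jetFrame_X (t : W) (F : HolFun U) : (jetFrame w c U).X t F = derivX w U t F := rfl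
theorem jetFrame_U0 (F : HolFun U) : (jetFrame w c U).U0 F = derivU0 U F := rfl
theorem jetFrame_U (φ : W →ₗ[ℂ] ℂ) (F : HolFun U) :
    (jetFrame w c U).U φ F = derivU w U φ F := rfl
theorem jetFrame_Z (F : HolFun U) : (jetFrame w c U).Z F = derivZ U F := rfl

theorem derivX0_cx_zero : derivX0 c U (cx U 0) = 1 := ext_evalAt fun m => by
  simp [derivX0, evalAt_along_cx, frameX0_eq]

theorem derivX0_cx_succ (a : Fin d) : derivX0 c U (cx U a.succ) = 0 := ext_evalAt fun m => by
  simp [derivX0, evalAt_along_cx, frameX0_eq]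

theorem derivX_cx_zero (t : W) : derivX w U t (cx U 0) = 0 := ext_evalAt fun m => by
  simp [derivX, evalAt_along_cx, fieldX_eq]

theorem derivX_cx_succ (t : W) (a : Fin d) :
    derivX w U t (cx U a.succ) = algebraMap ℂ _ (w.repr t a) := ext_evalAt fun m => by
  simp [derivX, evalAt_along_cx, fieldX_eq]

theorem derivU0_cx (i : Fin (d + 1)) : derivU0 U (cx U i) = 0 := ext_evalAt fun m => by
  simp [derivU0, evalAt_along_cx, ddp]

theorem derivU0_cu : derivU0 U (cu U) = 0 := ext_evalAt fun m => by
  simp [derivU0, evalAt_along_cu, ddp]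

theorem derivU0_cp_zero : derivU0 U (cp U 0) = 1 := ext_evalAt fun m => by
  simp [derivU0, evalAt_along_cp, ddp]

theorem derivU0_cp_succ (a : Fin d) : derivU0 U (cp U a.succ) = 0 := ext_evalAt fun m => by
  simp [derivU0, evalAt_along_cp, ddp]

theorem derivU_cx (φ : W →ₗ[ℂ] ℂ) (i : Fin (d + 1)) : derivU w U φ (cx U i) = 0 :=
  ext_evalAt fun m => by simp [derivU, evalAt_along_cx, fieldU_eq]

theorem derivU_cu (φ : W →ₗ[ℂ] ℂ) : derivU w U φ (cu U) = 0 :=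
  ext_evalAt fun m => by simp [derivU, evalAt_along_cu, fieldU_eq]

theorem derivU_cp_zero (φ : W →ₗ[ℂ] ℂ) : derivU w U φ (cp U 0) = 0 :=
  ext_evalAt fun m => by simp [derivU, evalAt_along_cp, fieldU_eq]

theorem derivU_cp_succ (φ : W →ₗ[ℂ] ℂ) (a : Fin d) :
    derivU w U φ (cp U a.succ) = algebraMap ℂ _ (φ (w a)) :=
  ext_evalAt fun m => by simp [derivU, evalAt_along_cp, fieldU_eq]

theorem derivZ_cx (i : Fin (d + 1)) : derivZ U (cx U i) = 0 := ext_evalAt fun m => by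
  simp [derivZ, evalAt_along_cx, ddu]

theorem derivZ_cu : derivZ U (cu U) = 1 := ext_evalAt fun m => by
  simp [derivZ, evalAt_along_cu, ddu]

theorem derivZ_cp (i : Fin (d + 1)) : derivZ U (cp U i) = 0 := ext_evalAt fun m => by
  simp [derivZ, evalAt_along_cp, ddu]

variable {C : W →ₗ[ℂ] W →ₗ[ℂ] W →ₗ[ℂ] ℂ}

section
variable (l : ℂ) (t : W)

theorem derivV_cx_zero : derivV w c U C l t (cx U 0) = algebraMap ℂ _ (l ^ 3) :=
  ext_evalAt fun m => by
    simp [derivV, evalAt_along_cx, fieldU_eq, fieldX_eq, frameX0_eq, ddp]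

theorem derivV_cx_succ (a : Fin d) :
    derivV w c U C l t (cx U a.succ) = algebraMap ℂ _ (-(l ^ 2 * w.repr t a)) :=
  ext_evalAt fun m => by
    simp [derivV, evalAt_along_cx, fieldU_eq, fieldX_eq, frameX0_eq, ddp]

theorem derivV_cp_zero : derivV w c U C l t (cp U 0) =
    l ^ 3 • cx U c.succ - algebraMap ℂ _ (1 / 2 * C t t t) :=
  ext_evalAt fun m => by
    simp [derivV, evalAt_along_cp, fieldU_eq, fieldX_eq, frameX0_eq, ddp]

theorem derivV_cp_succ (a : Fin d) : derivV w c U C l t (cp U a.succ) =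
    algebraMap ℂ _ (-(3 / 2 * l * C t t (w a))) :=
  ext_evalAt fun m => by
    simp [derivV, evalAt_along_cp, fieldU_eq, fieldX_eq, frameX0_eq, ddp]

theorem derivV_cu : derivV w c U C l t (cu U) =
    l ^ 3 • cp U 0 - l ^ 2 • ∑ a, w.repr t a • cp U a.succ :=
  ext_evalAt fun m => by
    simp [derivV, evalAt_along_cu, fieldU_eq, fieldX_eq, frameX0_eq, ddp]

theorem derivV_derivV_cx (i : Fin (d + 1)) :
    derivV w c U C l t (derivV w c U C l t (cx U i)) = 0 := by
  refine Fin.cases ?_ (fun a => ?_) i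
  · rw [derivV_cx_zero, Derivation.map_algebraMap]
  · rw [derivV_cx_succ, Derivation.map_algebraMap]

/-- V u_0 contains l³ x^c, and V x^c = -l² t^c. The term l^5 κ(t) U_0 f of the equation compensates
this, so u_0 needs no correction. -/
theorem derivV_derivV_cp_zero : derivV w c U C l t (derivV w c U C l t (cp U 0)) =
    algebraMap ℂ _ (-(l ^ 5 * w.repr t c)) := by
  rw [derivV_cp_zero, map_sub, Derivation.map_smul, derivV_cx_succ, Derivation.map_algebraMap,
    sub_zero, Algebra.smul_def, ← map_mul]
  congr 1
  ring

theorem derivV_derivV_cu : derivV w c U C l t (derivV w c U C l t (cu U)) =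
    l ^ 6 • cx U c.succ + algebraMap ℂ _ (l ^ 3 * C t t t) := by
  rw [derivV_cu, map_sub, Derivation.map_smul, Derivation.map_smul, derivV_cp_zero, map_sum]
  simp only [Derivation.map_smul, derivV_cp_succ]
  refine ext_evalAt fun m => ?_
  have h := sum_repr_mul w (C t t) t
  simp only [map_add, map_sub, map_smul, map_sum, AlgHom.commutes, evalAt_cx, smul_eq_mul,
    Algebra.algebraMap_self, RingHom.id_apply]
  have h2 : ∑ a, w.repr t a * -(3 / 2 * l * C t t (w a)) = -(3 / 2 * l) * C t t t := by
    rw [← h, Finset.mul_sum]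
    exact Finset.sum_congr rfl fun a _ => by ring
  rw [h2]
  ring

end

/-- The equation of the generating functions, in terms of derivations. -/
theorem isSolution_iff {F : HolFun U} : (jetFrame w c U).IsSolution C F ↔
    ∀ l t m, evalAt m (derivV w c U C l t (derivV w c U C l t F))
      + l ^ 5 * w.repr t c * evalAt m (derivU0 U F)
      + l ^ 6 * evalAt m (derivU w U (w.coord c) F) = 0 := by
  refine forall_congr' fun l => forall_congr' fun t => ?_
  rw [jetFrame_V, jetFrame_V, jetFrame_U0, jetFrame_U, Module.Basis.coord_apply]
  refine ⟨fun h m => ?_, fun h => ext_evalAt fun m => ?_⟩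
  · have := congrArg (evalAt m) h
    simpa only [map_add, map_smul, map_zero, smul_eq_mul] using this
  · simpa only [map_add, map_smul, map_zero, smul_eq_mul] using h m

theorem isSolution_algebraMap (a : ℂ) :
    (jetFrame w c U).IsSolution C (algebraMap ℂ (HolFun U) a) :=
  isSolution_iff.2 fun l t m => by simp

theorem isSolution_cx (i : Fin (d + 1)) : (jetFrame w c U).IsSolution C (cx U i) :=
  isSolution_iff.2 fun l t m => by simp [derivV_derivV_cx, derivU0_cx, derivU_cx]

theorem isSolution_cp_zero : (jetFrame w c U).IsSolution C (cp U 0) :=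
  isSolution_iff.2 fun l t m => by
    simp [derivV_derivV_cp_zero, derivU0_cp_zero, derivU_cp_zero]

variable (c U) in
/-- The functions `u_a - δ_a^c (x⁰)² / 2`. -/
noncomputable def holMomentum (a : Fin d) : HolFun U :=
  cp U a.succ - (if a = c then (1 / 2 : ℂ) else 0) • (cx U 0 * cx U 0)

variable (U) in
/-- The function `7 u - 2 x⁰ u_0 - 3 x^a u_a`. -/
noncomputable def holScaling : HolFun U :=
  (7 : ℂ) • cu U - (2 : ℂ) • (cx U 0 * cp U 0) - (3 : ℂ) • ∑ a : Fin d, cx U a.succ * cp U a.succ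

variable (C w c U) in
/-- The functions `x⁰ u_a + (3/2) C_a(X²) - (1/6) δ_a^c (x⁰)³`. -/
noncomputable def holShear (a : Fin d) : HolFun U :=
  cx U 0 * cp U a.succ
    + (3 / 2 : ℂ) • ∑ b, ∑ e, C (w a) (w b) (w e) • (cx U b.succ * cx U e.succ)
    - (if a = c then (1 / 6 : ℂ) else 0) • (cx U 0 * (cx U 0 * cx U 0))

variable (U) in
/-- The functions `7 A^a_b x^b u_a - k (3 x⁰ u_0 + x^a u_a)`. -/
noncomputable def holLinear (A : Matrix (Fin d) (Fin d) ℂ) (k : ℂ) : HolFun U :=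
  (7 : ℂ) • ∑ a : Fin d, ∑ b : Fin d, A a b • (cx U b.succ * cp U a.succ)
    - k • ((3 : ℂ) • (cx U 0 * cp U 0) + ∑ a : Fin d, cx U a.succ * cp U a.succ)

/-- V V ((x⁰)²/2) = l^6 cancels the term l^6 U_κ u_c = l^6. -/
theorem isSolution_holMomentum (a : Fin d) :
    (jetFrame w c U).IsSolution C (holMomentum c U a) :=
  isSolution_iff.2 fun l t m => by
    simp only [holMomentum, map_sub, Derivation.map_smul, map_smul, evalAt_deriv_deriv_mul,
      derivV_cx_zero, derivV_cp_succ, Derivation.map_algebraMap]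
    simp only [Derivation.leibniz, derivU0_cp_succ, derivU_cp_succ, derivU0_cx, derivU_cx,
      AlgHom.commutes, map_zero, smul_zero, map_add]
    simp only [Module.Basis.coord_apply, Module.Basis.repr_self, Finsupp.single_apply]
    split_ifs <;> simp
    ring

section
variable (l : ℂ) (t : W) (m : U)

theorem evalAt_derivV_derivV_sum :
    evalAt m (derivV w c U C l t (derivV w c U C l t
      (∑ a : Fin d, cx U a.succ * cp U a.succ))) = 3 * l ^ 3 * C t t t := by
  simp only [map_sum, evalAt_deriv_deriv_mul, derivV_cx_succ, derivV_cp_succ,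
    Derivation.map_algebraMap, map_zero, AlgHom.commutes, Algebra.algebraMap_self, RingHom.id_apply]
  rw [← sum_repr_mul w (C t t) t, Finset.mul_sum]
  exact Finset.sum_congr rfl fun a _ => by ring

theorem evalAt_derivV_derivV_mul :
    evalAt m (derivV w c U C l t (derivV w c U C l t (cx U 0 * cp U 0))) =
      -(l ^ 5 * w.repr t c) * m.1.1 0 + 2 * l ^ 6 * m.1.1 c.succ - l ^ 3 * C t t t := by
  rw [evalAt_deriv_deriv_mul, derivV_derivV_cp_zero, derivV_derivV_cx, derivV_cx_zero,
    derivV_cp_zero]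
  simp only [map_zero, AlgHom.commutes, Algebra.algebraMap_self,
    RingHom.id_apply, map_sub, map_smul, evalAt_cx, smul_eq_mul]
  ring

end

/-- The weights are fixed by two cancellations: 7 + 2 - 9 = 0 for l³ N(t), and 7 - 4 - 3 = 0 for l^6
x^c. -/
theorem isSolution_holScaling : (jetFrame w c U).IsSolution C (holScaling U) :=
  isSolution_iff.2 fun l t m => by
    simp only [holScaling, map_sub, Derivation.map_smul, map_smul, evalAt_derivV_derivV_sum,
      evalAt_derivV_derivV_mul, derivV_derivV_cu, derivU0_cu, derivU_cu]
    simp only [map_sum, Derivation.leibniz, derivU0_cx, derivU_cx, derivU0_cp_zero, derivU_cp_zero,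
      derivU0_cp_succ, derivU_cp_succ, map_add, map_smul, smul_eq_mul, map_mul,
      map_one, map_zero, AlgHom.commutes, evalAt_cx]
    simp only [Module.Basis.coord_apply, Module.Basis.repr_self, Finsupp.single_apply]
    simp
    ring

/-- V V of x⁰ u_a is -3 l^4 C_a(t²), cancelled by the quadratic term in X. For a = c the cubic term
contributes -l^6 x⁰, which cancels l^6 U_κ(x⁰ u_c). -/
theorem isSolution_holShear (hC : IsJordanCubicForm C) (a : Fin d) :
    (jetFrame w c U).IsSolution C (holShear w c U C a) :=
  isSolution_iff.2 fun l t m => by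
    have h : ∑ b, ∑ e, C (w a) (w b) (w e) * (2 * (l ^ 2 * w.repr t b * (l ^ 2 * w.repr t e))) =
        2 * l ^ 4 * C t t (w a) := by
      have h1 : C t t (w a) = C (w a) t t := by rw [hC.swap_right, hC.swap_left]
      rw [h1, ← sum_repr_mul w (C (w a) t) t, Finset.mul_sum, Finset.sum_comm]
      refine Finset.sum_congr rfl fun e _ => ?_
      rw [hC.swap_right, ← sum_repr_mul w (C (w a) (w e)) t, Finset.mul_sum, Finset.mul_sum]
      refine Finset.sum_congr rfl fun b _ => ?_
      rw [hC.swap_right (w a) (w e) (w b)]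
      ring
    simp only [holShear, map_sub, map_add, Derivation.map_smul, map_smul, map_sum,
      evalAt_deriv_deriv_mul, derivV_cx_zero, derivV_cx_succ, derivV_cp_succ,
      Derivation.map_algebraMap, AlgHom.commutes]
    simp only [Derivation.leibniz, derivU0_cx, derivU_cx, derivU0_cp_succ, derivU_cp_succ,
      derivV_cx_zero, add_zero, map_add, smul_eq_mul, map_mul, map_zero,
      AlgHom.commutes, evalAt_cx, mul_zero, zero_mul, zero_add, Algebra.algebraMap_self,
      RingHom.id_apply, neg_mul_neg, h, Finset.sum_const_zero, sub_zero]
    simp only [Module.Basis.coord_apply, Module.Basis.repr_self, Finsupp.single_apply]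
    split_ifs <;> ring

omit c in
/-- An endomorphism that annihilates the cubic form annihilates it on all vectors. -/
theorem AnnihilatesCubic.apply_self {A : Matrix (Fin d) (Fin d) ℂ}
    (hA : AnnihilatesCubic C w A) (t : W) :
    C t t (∑ a, (∑ b, A a b * w.repr t b) • w a) = 0 := by
  let L : W →ₗ[ℂ] W := Matrix.toLin w w A
  have hL : ∀ b, L (w b) = ∑ a, A a b • w a := fun b => Matrix.toLin_self w w A b
  have hLt : L t = ∑ a, (∑ b, A a b * w.repr t b) • w a := by
    conv_lhs => rw [← w.sum_repr t]
    simp only [map_sum, map_smul, hL, Finset.smul_sum, smul_smul, Finset.sum_smul]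
    rw [Finset.sum_comm]
    simp only [mul_comm]
  have ext : ∀ g : W → ℂ, IsLinearMap ℂ g → (∀ b, g (w b) = 0) → ∀ r, g r = 0 :=
    fun g hg h r => LinearMap.congr_fun
      (w.ext (f₁ := hg.mk' g) (f₂ := 0) (by simpa using h)) r
  let T : W → W → W → ℂ := fun r s t => C s t (L r) + C r t (L s) + C r s (L t)
  have h1 : ∀ b e h, T (w b) (w e) (w h) = 0 := fun b e h => by
    have := hA b e h
    simp only [T, hL, map_sum, map_smul, smul_eq_mul, ← Finset.sum_add_distrib]
    exact this
  have h2 : ∀ r e h, T r (w e) (w h) = 0 := fun r e h =>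
    ext (fun r => T r (w e) (w h)) ⟨fun x y => by simp [T]; ring, fun x y => by simp [T]; ring⟩
      (fun b => h1 b e h) r
  have h3 : ∀ r s h, T r s (w h) = 0 := fun r s h =>
    ext (fun s => T r s (w h)) ⟨fun x y => by simp [T]; ring, fun x y => by simp [T]; ring⟩
      (fun b => h2 r b h) s
  have h4 : ∀ r s t, T r s t = 0 := fun r s t =>
    ext (fun t => T r s t) ⟨fun x y => by simp [T]; ring, fun x y => by simp [T]; ring⟩
      (fun b => h3 r s b) t
  have h5 := h4 t t t
  simp only [T] at h5
  rw [← hLt]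
  linear_combination h5 / 3

/-- Annihilation of the cubic removes V V of A^a_b x^b u_a, while N(t) cancels in V V of 3 x⁰ u_0 +
x^a u_a. The condition on row c balances the l^6 x^c terms: -6 k + 7 k - k = 0. -/
theorem isSolution_holLinear {A : Matrix (Fin d) (Fin d) ℂ} {k : ℂ}
    (hA : AnnihilatesCubic C w A) (hk : ∀ b, A c b = if b = c then k else 0) :
    (jetFrame w c U).IsSolution C (holLinear U A k) :=
  isSolution_iff.2 fun l t m => by
    have h : ∑ a, ∑ b, A a b * (w.repr t b * C t t (w a)) = 0 := by
      have h1 := hA.apply_self t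
      simp only [map_sum, map_smul, smul_eq_mul, Finset.sum_mul] at h1
      rw [← h1]
      exact Finset.sum_congr rfl fun a _ => Finset.sum_congr rfl fun b _ => by ring
    have h' : ∑ a, ∑ b, A a b * (2 * (l ^ 2 * w.repr t b * (3 / 2 * l * C t t (w a)))) = 0 := by
      have h3 := congrArg (fun z => 3 * l ^ 3 * z) h
      simp only [mul_zero, Finset.mul_sum] at h3
      rw [← h3]
      exact Finset.sum_congr rfl fun a _ => Finset.sum_congr rfl fun b _ => by ring
    simp only [holLinear, map_sub, Derivation.map_smul, map_add, map_smul,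
      evalAt_derivV_derivV_sum, evalAt_derivV_derivV_mul]
    simp only [map_sum, Derivation.map_smul, map_smul, evalAt_deriv_deriv_mul,
      derivV_cx_succ, derivV_cp_succ, Derivation.map_algebraMap]
    simp only [Derivation.leibniz, derivU0_cx, derivU_cx, derivU0_cp_zero, derivU_cp_zero,
      derivU0_cp_succ, derivU_cp_succ, add_zero, smul_eq_mul, map_mul,
      map_one, map_zero, AlgHom.commutes, evalAt_cx, mul_zero, zero_mul, zero_add,
      Algebra.algebraMap_self, RingHom.id_apply, neg_mul_neg, h', Finset.sum_const_zero]
    simp only [Module.Basis.coord_apply, Module.Basis.repr_self, Finsupp.single_apply]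
    simp [hk]
    ring

end FrameDerivations

namespace ContactFrame

variable {W : Type*} [AddCommGroup W] [Module ℂ W] {κ : W →ₗ[ℂ] ℂ} {H : Type*} [AddCommGroup H]
  [Module ℂ H] (𝓕 : ContactFrame κ H) (C : W →ₗ[ℂ] W →ₗ[ℂ] W →ₗ[ℂ] ℂ)

/-- The space of solutions. -/
def solutions : Submodule ℂ H where
  carrier := {f | 𝓕.IsSolution C f}
  zero_mem' := fun l t => by simp
  add_mem' := fun {f g} hf hg l t => by
    have h1 := hf l t
    have h2 := hg l t
    simp only [map_add]
    linear_combination (norm := module) h1 + h2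
  smul_mem' := fun a f hf l t => by
    have h1 := hf l t
    simp only [map_smul]
    linear_combination (norm := module) a • h1

end ContactFrame

/-! ### The listed functions on U, and functions annihilated by the frame. -/

section Listed

variable {d : ℕ} {W : Type*} [AddCommGroup W] [Module ℂ W] (w : Module.Basis (Fin d) ℂ W)
  (c : Fin d) (U : Opens (J1 d)) (C : W →ₗ[ℂ] W →ₗ[ℂ] W →ₗ[ℂ] ℂ)

/-- The restrictions to `U` of the functions in the span of the listed ones. -/
def listedRestrictions : Submodule ℂ (HolFun U) where
  carrier := {F | ∃ g ∈ Submodule.span ℂ {g | ListedFunction C w c g}, ∀ m : U, evalAt m F = g m}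
  zero_mem' := ⟨0, Submodule.zero_mem _, fun m => map_zero _⟩
  add_mem' := by
    rintro F G ⟨f, hf, hF⟩ ⟨g, hg, hG⟩
    exact ⟨f + g, Submodule.add_mem _ hf hg, fun m => by rw [map_add, hF, hG, Pi.add_apply]⟩
  smul_mem' := by
    rintro a F ⟨f, hf, hF⟩
    exact ⟨a • f, Submodule.smul_mem _ _ hf, fun m => by rw [map_smul, hF, Pi.smul_apply]⟩

variable {w c U C}

theorem mem_listedRestrictions {F : HolFun U} {g : J1 d → ℂ} (hg : ListedFunction C w c g)
    (h : ∀ m : U, evalAt m F = g m) : F ∈ listedRestrictions w c U C :=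
  ⟨g, Submodule.subset_span hg, h⟩

theorem evalAt_holMomentum (a : Fin d) (m : U) : evalAt m (holMomentum c U a) =
    m.1.2.2 a.succ - if a.succ = c.succ then (m.1.1 0) ^ 2 / 2 else 0 := by
  simp only [holMomentum, map_sub, map_smul, map_mul, evalAt_cx, evalAt_cp, smul_eq_mul,
    Fin.succ_inj]
  split_ifs <;> ring

theorem evalAt_holScaling (m : U) : evalAt m (holScaling U) = 7 * m.1.2.1
    - 2 * (m.1.1 0 * m.1.2.2 0) - 3 * ∑ a : Fin d, m.1.1 a.succ * m.1.2.2 a.succ := by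
  simp [holScaling]

theorem evalAt_holShear (a : Fin d) (m : U) : evalAt m (holShear w c U C a) =
    m.1.1 0 * m.1.2.2 a.succ + 3 / 2 * C (w a) (pointX w m) (pointX w m)
      - if a = c then (m.1.1 0) ^ 3 / 6 else 0 := by
  simp only [holShear, map_sub, map_add, map_smul, map_sum, map_mul, evalAt_cx, evalAt_cp,
    smul_eq_mul, pointX, LinearMap.sum_apply, LinearMap.smul_apply, Finset.mul_sum]
  congr 1
  · congr 1
    rw [Finset.sum_comm]
    refine Finset.sum_congr rfl fun b _ => Finset.sum_congr rfl fun e _ => ?_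
    ring
  · split_ifs <;> ring

theorem evalAt_holLinear (A : Matrix (Fin d) (Fin d) ℂ) (k : ℂ) (m : U) :
    evalAt m (holLinear U A k) =
      7 * ∑ a : Fin d, ∑ b : Fin d, A a b * m.1.1 b.succ * m.1.2.2 a.succ
        - k * (3 * (m.1.1 0 * m.1.2.2 0) + ∑ a : Fin d, m.1.1 a.succ * m.1.2.2 a.succ) := by
  simp [holLinear, mul_assoc, mul_add]

theorem algebraMap_mem_listedRestrictions (a : ℂ) :
    algebraMap ℂ (HolFun U) a ∈ listedRestrictions w c U C := by
  rw [Algebra.algebraMap_eq_smul_one]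
  exact Submodule.smul_mem _ _ (mem_listedRestrictions .one fun m => map_one _)

theorem cx_mem_listedRestrictions (i : Fin (d + 1)) : cx U i ∈ listedRestrictions w c U C :=
  mem_listedRestrictions (.coord i) fun _ => rfl

theorem cp_zero_mem_listedRestrictions : cp U 0 ∈ listedRestrictions w c U C :=
  mem_listedRestrictions (.momentum 0) fun m => by simp [(Fin.succ_ne_zero c).symm]

theorem holMomentum_mem_listedRestrictions (a : Fin d) :
    holMomentum c U a ∈ listedRestrictions w c U C :=
  mem_listedRestrictions (.momentum a.succ) fun m => evalAt_holMomentum a m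

theorem holScaling_mem_listedRestrictions : holScaling U ∈ listedRestrictions w c U C :=
  mem_listedRestrictions .scaling fun m => evalAt_holScaling m

theorem holShear_mem_listedRestrictions (a : Fin d) :
    holShear w c U C a ∈ listedRestrictions w c U C :=
  mem_listedRestrictions (.shear a) fun m => evalAt_holShear a m

theorem holLinear_mem_listedRestrictions {A : Matrix (Fin d) (Fin d) ℂ} {k : ℂ}
    (hA : AnnihilatesCubic C w A) (hk : ∀ b, A c b = if b = c then k else 0) :
    holLinear U A k ∈ listedRestrictions w c U C :=
  mem_listedRestrictions (.linear A k hA hk) fun m => evalAt_holLinear A k m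

theorem ListedFunction.exists_solution (hC : IsJordanCubicForm C) {g : J1 d → ℂ}
    (hg : ListedFunction C w c g) :
    ∃ F : HolFun U, (jetFrame w c U).IsSolution C F ∧ ∀ m : U, evalAt m F = g m := by
  cases hg with
  | one => exact ⟨_, isSolution_algebraMap 1, fun m => by simp⟩
  | coord i => exact ⟨_, isSolution_cx i, fun _ => rfl⟩
  | momentum i =>
    refine Fin.cases ?_ (fun a => ?_) i
    · exact ⟨_, isSolution_cp_zero, fun m => by simp [(Fin.succ_ne_zero c).symm]⟩
    · exact ⟨_, isSolution_holMomentum a, fun m => evalAt_holMomentum a m⟩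
  | scaling => exact ⟨_, isSolution_holScaling, fun m => evalAt_holScaling m⟩
  | shear a => exact ⟨_, isSolution_holShear hC a, fun m => evalAt_holShear a m⟩
  | linear A k hA hk => exact ⟨_, isSolution_holLinear hA hk, fun m => evalAt_holLinear A k m⟩

/-- The listed functions solve the equation of the generating functions. -/
theorem exists_solution_of_mem_span (hC : IsJordanCubicForm C) {g : J1 d → ℂ}
    (hg : g ∈ Submodule.span ℂ {g | ListedFunction C w c g}) :
    ∃ F ∈ (jetFrame w c U).solutions C, ∀ m : U, evalAt m F = g m := by
  induction hg using Submodule.span_induction with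
  | mem g hg => exact ListedFunction.exists_solution hC hg
  | zero => exact ⟨0, Submodule.zero_mem _, fun m => map_zero _⟩
  | add f g _ _ hf hg =>
    obtain ⟨F, hF, h1⟩ := hf
    obtain ⟨G, hG, h2⟩ := hg
    exact ⟨F + G, Submodule.add_mem _ hF hG, fun m => by rw [map_add, h1, h2, Pi.add_apply]⟩
  | smul a f _ hf =>
    obtain ⟨F, hF, h1⟩ := hf
    exact ⟨a • F, Submodule.smul_mem _ _ hF, fun m => by rw [map_smul, h1, Pi.smul_apply]⟩

section
variable {D : Derivation ℂ (HolFun U) (HolFun U)} (hD : ∀ i, D (cx U i) = 0)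
include hD

theorem deriv_holMomentum (a : Fin d) : D (holMomentum c U a) = D (cp U a.succ) := by
  simp only [holMomentum, map_sub, Derivation.map_smul, Derivation.leibniz, hD, smul_zero, add_zero,
    sub_zero]

theorem deriv_holShear (a : Fin d) : D (holShear w c U C a) = cx U 0 * D (cp U a.succ) := by
  simp only [holShear, map_sub, map_add, map_sum, Derivation.map_smul, Derivation.leibniz, hD,
    smul_zero, mul_zero, add_zero, sub_zero, Finset.sum_const_zero, smul_eq_mul]

theorem deriv_holScaling : D (holScaling U) = (7 : ℂ) • D (cu U)
    - (2 : ℂ) • (cx U 0 * D (cp U 0)) - (3 : ℂ) • ∑ a : Fin d, cx U a.succ * D (cp U a.succ) := by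
  simp [holScaling, hD]

theorem deriv_holLinear (A : Matrix (Fin d) (Fin d) ℂ) (k : ℂ) : D (holLinear U A k) =
    (7 : ℂ) • ∑ a : Fin d, ∑ b : Fin d, A a b • (cx U b.succ * D (cp U a.succ))
      - k • ((3 : ℂ) • (cx U 0 * D (cp U 0)) + ∑ a : Fin d, cx U a.succ * D (cp U a.succ)) := by
  simp [holLinear, hD]

end

/-- A function that is annihilated by the frame is constant. -/
theorem exists_eq_algebraMap_of_frame (hU : IsPreconnected (U : Set (J1 d))) {F : HolFun U}
    (h0 : (jetFrame w c U).X0 F = 0) (h1 : ∀ t, (jetFrame w c U).X t F = 0)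
    (h2 : (jetFrame w c U).U0 F = 0) (h3 : ∀ φ, (jetFrame w c U).U φ F = 0)
    (h4 : (jetFrame w c U).Z F = 0) : ∃ a : ℂ, F = algebraMap ℂ _ a := by
  refine HolFun.exists_eq_algebraMap hU fun m => ContinuousLinearMap.ext fun v => ?_
  have e0 : fderiv ℂ (extend F) m (frameX0 c m) = 0 := congrArg (evalAt m) h0
  have e1 : ∀ t, fderiv ℂ (extend F) m (fieldX w t m) = 0 := fun t => congrArg (evalAt m) (h1 t)
  have e2 : fderiv ℂ (extend F) m (ddp 0) = 0 := congrArg (evalAt m) h2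
  have e3 : ∀ φ, fderiv ℂ (extend F) m (fieldU w φ m) = 0 := fun φ => congrArg (evalAt m) (h3 φ)
  have e4 : fderiv ℂ (extend F) m ddu = 0 := congrArg (evalAt m) h4
  let t : W := ∑ a, v.1 a.succ • w a
  let φ : W →ₗ[ℂ] ℂ := ∑ a, v.2.2 a.succ • w.coord a
  have ht : ∀ a, w.repr t a = v.1 a.succ := fun a => by
    simp [t, Finsupp.single_apply]
  have hφ : ∀ a, φ (w a) = v.2.2 a.succ := fun a => by
    simp [φ, LinearMap.sum_apply, Finsupp.single_apply]
  -- The frame and ∂_u span the tangent space: the position components fix the X part, and the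
  -- remaining coefficients correct the u and u_0 components.
  have hv : v = v.1 0 • frameX0 c m + fieldX w t m + fieldU w φ m
      + (v.2.2 0 - v.1 0 * m.1.1 c.succ) • ddp 0
      + (v.2.1 - v.1 0 * m.1.2.2 0 - ∑ a, w.repr t a * m.1.2.2 a.succ) • ddu := by
    refine Prod.ext (funext fun i => ?_) (Prod.ext ?_ (funext fun i => ?_))
    · refine Fin.cases ?_ (fun a => ?_) i <;>
        simp [frameX0_eq, fieldX_eq, fieldU_eq, ddp, ddu, ht]
    · simp [frameX0_eq, fieldX_eq, fieldU_eq, ddp, ddu]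
    · refine Fin.cases ?_ (fun a => ?_) i <;>
        simp [frameX0_eq, fieldX_eq, fieldU_eq, ddp, ddu, hφ]
  rw [hv]
  simp [e0, e1, e2, e3, e4]

end Listed

/-! ### Integration of the equation on a connected set. -/

section Reconstruction

attribute [local irreducible] jetFrame

variable {d : ℕ} {W : Type*} [AddCommGroup W] [Module ℂ W] {w : Module.Basis (Fin d) ℂ W}
  {c : Fin d} {U : Opens (J1 d)} {C : W →ₗ[ℂ] W →ₗ[ℂ] W →ₗ[ℂ] ℂ}

/-- The expansion of a functional in the dual basis. -/
theorem sum_apply_smul_coord (φ : W →ₗ[ℂ] ℂ) : ∑ a, φ (w a) • w.coord a = φ :=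
  w.ext fun b => by simp

theorem LinearMap.apply_apply_eq_sum {E V M : Type*} [AddCommGroup E] [Module ℂ E] [AddCommGroup V]
    [Module ℂ V] [AddCommGroup M] [Module ℂ M] {ι : Type*} [Fintype ι] (L : E →ₗ[ℂ] V →ₗ[ℂ] M)
    (r : ι → ℂ) (e : ι → E) (F : V) : L (∑ a, r a • e a) F = ∑ a, r a • L (e a) F := by
  simp [map_sum, LinearMap.sum_apply]

theorem jetFrame_U_eq_sum (φ : W →ₗ[ℂ] ℂ) (F : HolFun U) :
    (jetFrame w c U).U φ F = ∑ a, φ (w a) • (jetFrame w c U).U (w.coord a) F := by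
  rw [← LinearMap.apply_apply_eq_sum, sum_apply_smul_coord]

theorem jetFrame_X_eq_sum (t : W) (F : HolFun U) :
    (jetFrame w c U).X t F = ∑ a, w.repr t a • (jetFrame w c U).X (w a) F := by
  rw [← LinearMap.apply_apply_eq_sum, w.sum_repr]

set_option maxHeartbeats 4000000 in
/-- A solution that is annihilated by the vertical derivatives is an affine function of the
coordinates `x^i`. -/
theorem mem_listedRestrictions_of_vertical (hC : IsJordanCubicForm C)
    (hU : IsPreconnected (U : Set (J1 d))) {K : HolFun U} (hK : (jetFrame w c U).IsSolution C K)
    (h0 : (jetFrame w c U).U0 K = 0) (hU' : ∀ φ, (jetFrame w c U).U φ K = 0)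
    (hZ : (jetFrame w c U).Z K = 0) : K ∈ listedRestrictions w c U C := by
  set 𝓕 := jetFrame w c U with h𝓕
  obtain ⟨l₀, hl₀⟩ : ∃ a, 𝓕.X0 K = algebraMap ℂ _ a := by
    refine exists_eq_algebraMap_of_frame (w := w) (c := c) hU ?_ (fun t => ?_) ?_ (fun φ => ?_) ?_
    · rw [← h𝓕, (hK.coefficients 0).1, hU', neg_zero]
    · rw [← h𝓕, hK.X_X0, h0, smul_zero]
    · rw [← h𝓕, 𝓕.U0_X0, h0, hZ, map_zero, zero_add]
    · rw [← h𝓕, 𝓕.U_X0, hU', map_zero]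
    · rw [← h𝓕, 𝓕.Z_X0, hZ, map_zero]
  have hl : ∀ b, ∃ a, 𝓕.X (w b) K = algebraMap ℂ _ a := fun b => by
    refine exists_eq_algebraMap_of_frame (w := w) (c := c) hU ?_ (fun t => ?_) ?_ (fun φ => ?_) ?_
    · rw [← h𝓕, (hK.coefficients (w b)).2.1]
    · rw [← h𝓕, hK.X_X hC, hU', map_zero, smul_zero]
    · rw [← h𝓕, 𝓕.U0_X, h0, map_zero]
    · rw [← h𝓕, 𝓕.U_X, hU', hZ, map_zero, smul_zero, zero_add]
    · rw [← h𝓕, 𝓕.Z_X, hZ, map_zero]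
  choose l hl using hl
  obtain ⟨a, ha⟩ : ∃ a, K - (l₀ • cx U 0 + ∑ b, l b • cx U b.succ) = algebraMap ℂ _ a := by
    refine exists_eq_algebraMap_of_frame (w := w) (c := c) hU ?_ (fun t => ?_) ?_ (fun φ => ?_) ?_
    · rw [← h𝓕, LinearMap.map_sub, hl₀, jetFrame_X0]
      simp [derivX0_cx_zero, derivX0_cx_succ, Algebra.algebraMap_eq_smul_one]
    · rw [← h𝓕, LinearMap.map_sub, jetFrame_X_eq_sum, jetFrame_X]
      simp only [← h𝓕, hl, map_add, Derivation.map_smul, derivX_cx_zero, map_sum, derivX_cx_succ,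
        smul_zero, zero_add, ← Finset.sum_sub_distrib, Algebra.algebraMap_eq_smul_one, smul_smul]
      exact Finset.sum_eq_zero fun b _ => by rw [mul_comm, sub_self]
    · rw [← h𝓕, LinearMap.map_sub, h0, jetFrame_U0]
      simp [derivU0_cx]
    · rw [← h𝓕, LinearMap.map_sub, hU', jetFrame_U]
      simp [derivU_cx]
    · rw [← h𝓕, LinearMap.map_sub, hZ, jetFrame_Z]
      simp [derivZ_cx]
  rw [sub_eq_iff_eq_add.1 ha]
  refine Submodule.add_mem _ (algebraMap_mem_listedRestrictions a) (Submodule.add_mem _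
    (Submodule.smul_mem _ _ (cx_mem_listedRestrictions 0)) (Submodule.sum_mem _ fun b _ =>
      Submodule.smul_mem _ _ (cx_mem_listedRestrictions b.succ)))

set_option maxHeartbeats 4000000 in
/-- The solutions of the equation of the generating functions on a connected open set are the
restrictions of the functions in the span of the listed ones. -/
theorem ContactFrame.IsSolution.mem_listedRestrictions (hC : IsJordanCubicForm C)
    (hU : IsConnected (U : Set (J1 d))) {F : HolFun U} (hF : (jetFrame w c U).IsSolution C F) :
    F ∈ listedRestrictions w c U C := by
  have : Module.Finite ℂ W := Module.Finite.of_basis w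
  obtain ⟨m₀, hm₀⟩ := hU.nonempty
  have hconst := fun {G : HolFun U} => exists_eq_algebraMap_of_frame (w := w) (c := c)
    hU.isPreconnected (F := G)
  set 𝓕 := jetFrame w c U with h𝓕
  have he : w.coord c (w c) = 1 := by simp
  -- The functions X_0 U_0 F, Z F, X_b U^a F and X_0 U^a F are annihilated by the frame, hence
  -- constants β, ζ, M, q.
  obtain ⟨β, hβ⟩ : ∃ β, 𝓕.X0 (𝓕.U0 F) = algebraMap ℂ _ β := by
    refine hconst (hF.X0_X0_U0 hC he) (fun t => ?_) ?_ (fun φ => ?_) ?_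
    · rw [𝓕.X_X0, hF.X_U0 hC he, hF.U0_U0 hC he, map_zero, smul_zero, zero_add]
    · rw [𝓕.U0_X0, hF.U0_U0 hC he, hF.Z_U0 hC he, map_zero, zero_add]
    · rw [𝓕.U_X0, hF.U_U0 hC he, map_zero]
    · rw [𝓕.Z_X0, hF.Z_U0 hC he, map_zero]
  obtain ⟨ζ, hζ⟩ : ∃ ζ, 𝓕.Z F = algebraMap ℂ _ ζ :=
    hconst (hF.X0_Z hC he) (hF.X_Z hC he) (hF.U0_Z hC he) (hF.U_Z hC he) (hF.Z_Z hC he)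
  have hM : ∀ a b, ∃ μ, 𝓕.X (w b) (𝓕.U (w.coord a) F) = algebraMap ℂ _ μ := fun a b => by
    refine hconst (hF.X0_X_U hC he _ _) (fun t => hF.X_X_U hC he _ _ _) ?_ (fun φ => ?_) ?_
    · rw [𝓕.U0_X, 𝓕.U0_U, hF.U_U0 hC he, map_zero]
    · rw [𝓕.U_X, hF.U_U hC he, hF.Z_U hC he, map_zero, smul_zero, zero_add]
    · rw [𝓕.Z_X, hF.Z_U hC he, map_zero]
  choose M hM using hM
  have hq : ∀ a, ∃ q, 𝓕.X0 (𝓕.U (w.coord a) F) = algebraMap ℂ _ q := fun a => by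
    refine hconst (hF.X0_X0_U hC he _) (fun t => hF.X_X0_U hC he _ _) ?_ (fun φ => ?_) ?_
    · rw [𝓕.U0_X0, 𝓕.U0_U, hF.U_U0 hC he, hF.Z_U hC he, map_zero, zero_add]
    · rw [𝓕.U_X0, hF.U_U hC he, map_zero]
    · rw [𝓕.Z_X0, hF.Z_U hC he, map_zero]
  choose q hq using hq
  -- The vertical derivatives therefore have constant derivatives and integrate to U_0 F = α + β x⁰
  -- and U^a F = p_a + q_a x⁰ + M_{ab} x^b.
  obtain ⟨α, hα⟩ : ∃ α, 𝓕.U0 F - β • cx U 0 = algebraMap ℂ _ α := by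
    refine hconst ?_ (fun t => ?_) ?_ (fun φ => ?_) ?_
    · rw [LinearMap.map_sub, hβ, jetFrame_X0, Derivation.map_smul, derivX0_cx_zero,
        Algebra.algebraMap_eq_smul_one, sub_self]
    · rw [LinearMap.map_sub, hF.X_U0 hC he, jetFrame_X, Derivation.map_smul, derivX_cx_zero, smul_zero,
        sub_zero]
    · rw [LinearMap.map_sub, hF.U0_U0 hC he, jetFrame_U0, Derivation.map_smul, derivU0_cx, smul_zero,
        sub_zero]
    · rw [LinearMap.map_sub, hF.U_U0 hC he, jetFrame_U, Derivation.map_smul, derivU_cx, smul_zero, sub_zero]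
    · rw [LinearMap.map_sub, hF.Z_U0 hC he, jetFrame_Z, Derivation.map_smul, derivZ_cx, smul_zero, sub_zero]
  have hp : ∀ a, ∃ p, 𝓕.U (w.coord a) F - (q a • cx U 0 + ∑ b, M a b • cx U b.succ) =
      algebraMap ℂ _ p := fun a => by
    refine hconst ?_ (fun t => ?_) ?_ (fun φ => ?_) ?_
    · rw [LinearMap.map_sub, hq, jetFrame_X0]
      simp [derivX0_cx_zero, derivX0_cx_succ, Algebra.algebraMap_eq_smul_one]
    · rw [LinearMap.map_sub, jetFrame_X_eq_sum, jetFrame_X]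
      simp only [← h𝓕, hM, map_add, Derivation.map_smul, derivX_cx_zero, map_sum, derivX_cx_succ,
        smul_zero, zero_add, ← Finset.sum_sub_distrib, Algebra.algebraMap_eq_smul_one, smul_smul]
      exact Finset.sum_eq_zero fun b _ => by rw [mul_comm, sub_self]
    · rw [LinearMap.map_sub, 𝓕.U0_U, hF.U_U0 hC he, jetFrame_U0]
      simp [derivU0_cx]
    · rw [LinearMap.map_sub, hF.U_U hC he, jetFrame_U]
      simp [derivU_cx]
    · rw [LinearMap.map_sub, hF.Z_U hC he, jetFrame_Z]
      simp [derivZ_cx]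
  choose p hp using hp
  -- By `X_U_polarized` M scales the cubic by β - ζ, so the shift of M by (ζ - β)/3 annihilates it.
  -- By `X_Uκ` row c of M is -(2β + ζ) δ, which after the shift and division by 7 gives k. The 7 is
  -- the factor in the listed function.
  set k : ℂ := -(7 * β + 2 * ζ) / 21 with hk
  let A : Matrix (Fin d) (Fin d) ℂ := fun a b => (M a b + if a = b then (ζ - β) / 3 else 0) / 7
  have hA : AnnihilatesCubic C w A := fun b e h => by
    have h1 := hF.X_U_polarized hC (w b) (w e) (w h)
    rw [hβ, hζ, jetFrame_U_eq_sum (C (w e) (w h)), jetFrame_U_eq_sum (C (w b) (w h)),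
      jetFrame_U_eq_sum (C (w b) (w e))] at h1
    simp only [← h𝓕, map_sum, map_smul, hM, ← map_sub] at h1
    have h2 := congrArg (evalAt ⟨m₀, hm₀⟩) h1
    simp only [map_add, map_sum, map_smul, AlgHom.commutes, Algebra.algebraMap_self,
      RingHom.id_apply, smul_eq_mul] at h2
    simp only [A, Finset.sum_add_distrib, add_div, add_mul, ite_mul, ite_div, zero_div, zero_mul,
      Finset.sum_ite_eq', Finset.mem_univ, if_true, div_mul_eq_mul_div, ← Finset.sum_div]
    have h3 := hC.swap_left
    have h4 := hC.swap_right
    rw [h4 (w e) (w h) (w b), h3 (w e) (w b) (w h), h4 (w b) (w h) (w e)]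
    simp only [mul_comm (M _ _)]
    linear_combination h2 / 7
  have hAk : ∀ b, A c b = if b = c then k else 0 := fun b => by
    have h1 := hF.X_Uκ (w b)
    rw [hM, hβ, hζ] at h1
    have h2 := congrArg (evalAt ⟨m₀, hm₀⟩) h1
    simp only [map_neg, map_add, map_smul, AlgHom.commutes, Algebra.algebraMap_self,
      RingHom.id_apply, smul_eq_mul, Module.Basis.coord_apply, Module.Basis.repr_self,
      Finsupp.single_apply] at h2
    simp only [A, h2, eq_comm (a := c) (b := b)]
    split_ifs
    · rw [hk]; ring
    · ring
  -- Z of the scaling function is 7, hence ζ / 7. Its part -2 x⁰ u_0 and the part -3 k x⁰ u_0 of the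
  -- linear function together yield β x⁰ in U_0 P.
  let P : HolFun U := α • cp U 0 + ∑ a, p a • holMomentum c U a + ∑ a, q a • holShear w c U C a
    + (ζ / 7) • holScaling U + holLinear U A k
  have hP : P ∈ listedRestrictions w c U C := by
    refine Submodule.add_mem _ (Submodule.add_mem _ (Submodule.add_mem _ (Submodule.add_mem _
      (Submodule.smul_mem _ _ cp_zero_mem_listedRestrictions) (Submodule.sum_mem _ fun a _ =>
        Submodule.smul_mem _ _ (holMomentum_mem_listedRestrictions a)))
      (Submodule.sum_mem _ fun a _ => Submodule.smul_mem _ _ (holShear_mem_listedRestrictions a)))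
      (Submodule.smul_mem _ _ holScaling_mem_listedRestrictions))
      (holLinear_mem_listedRestrictions hA hAk)
  have hP' : P ∈ 𝓕.solutions C := by
    refine Submodule.add_mem _ (Submodule.add_mem _ (Submodule.add_mem _ (Submodule.add_mem _
      (Submodule.smul_mem _ _ isSolution_cp_zero) (Submodule.sum_mem _ fun a _ =>
        Submodule.smul_mem _ _ (isSolution_holMomentum a)))
      (Submodule.sum_mem _ fun a _ => Submodule.smul_mem _ _ (isSolution_holShear hC a)))
      (Submodule.smul_mem _ _ isSolution_holScaling))
      (isSolution_holLinear hA hAk)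
  have hPU0 : 𝓕.U0 P = 𝓕.U0 F := by
    rw [sub_eq_iff_eq_add.1 hα, jetFrame_U0]
    simp only [P, map_add, map_sum, Derivation.map_smul, deriv_holMomentum derivU0_cx,
      deriv_holShear derivU0_cx, deriv_holScaling derivU0_cx, deriv_holLinear derivU0_cx,
      derivU0_cp_zero, derivU0_cp_succ, derivU0_cu]
    refine ext_evalAt fun m => ?_
    simp only [map_add, map_sub, map_sum, map_smul, map_zero, map_one, AlgHom.commutes,
      smul_eq_mul, mul_zero, mul_one, Finset.sum_const_zero, add_zero, sub_zero, zero_sub,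
      evalAt_cx, Algebra.algebraMap_self, RingHom.id_apply]
    rw [hk]
    ring
  have hPU : ∀ a, 𝓕.U (w.coord a) P = 𝓕.U (w.coord a) F := fun a => by
    have hd : ∀ i, derivU w U (w.coord a) (cx U i) = 0 := derivU_cx _
    rw [sub_eq_iff_eq_add.1 (hp a), jetFrame_U]
    simp only [P, map_add, map_sum, Derivation.map_smul, deriv_holMomentum hd,
      deriv_holShear hd, deriv_holScaling hd, deriv_holLinear hd,
      derivU_cp_zero, derivU_cp_succ, derivU_cu]
    refine ext_evalAt fun m => ?_
    simp only [map_add, map_sub, map_sum, map_smul, map_mul, map_zero, AlgHom.commutes,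
      smul_eq_mul, mul_zero, mul_one, sub_zero, zero_sub, zero_add,
      evalAt_cx, Algebra.algebraMap_self, RingHom.id_apply, Module.Basis.coord_apply,
      Module.Basis.repr_self, Finsupp.single_apply, mul_ite, Finset.sum_ite_eq', Finset.mem_univ,
      if_true]
    have h1 : ∑ x, ∑ b, (if x = a then A x b * m.1.1 b.succ else 0) =
        ∑ b, A a b * m.1.1 b.succ := by
      rw [Finset.sum_comm]
      exact Finset.sum_congr rfl fun b _ => by simp
    have h2 : 7 * ∑ b, A a b * m.1.1 b.succ =
        ∑ b, M a b * m.1.1 b.succ + (ζ - β) / 3 * m.1.1 a.succ := by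
      simp only [A, add_div, add_mul, Finset.sum_add_distrib, ite_div, zero_div, ite_mul, zero_mul,
        Finset.sum_ite_eq, Finset.mem_univ, if_true, div_mul_eq_mul_div, ← Finset.sum_div]
      ring
    rw [h1, h2, hk]
    ring
  have hPZ : 𝓕.Z P = 𝓕.Z F := by
    rw [hζ, jetFrame_Z]
    simp only [P, map_add, map_sum, Derivation.map_smul, deriv_holMomentum derivZ_cx,
      deriv_holShear derivZ_cx, deriv_holScaling derivZ_cx, deriv_holLinear derivZ_cx,
      derivZ_cp, derivZ_cu]
    refine ext_evalAt fun m => ?_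
    simp
  have hK : F - P ∈ listedRestrictions w c U C := by
    refine mem_listedRestrictions_of_vertical hC hU.isPreconnected
      (Submodule.sub_mem (𝓕.solutions C) hF hP') ?_ (fun φ => ?_) ?_
    · rw [LinearMap.map_sub, ← h𝓕, hPU0, sub_self]
    · rw [jetFrame_U_eq_sum]
      exact Finset.sum_eq_zero fun a _ => by rw [LinearMap.map_sub, ← h𝓕, hPU, sub_self, smul_zero]
    · rw [LinearMap.map_sub, ← h𝓕, hPZ, sub_self]
  simpa using Submodule.add_mem _ hK hP

end Reconstruction

/-! ### Contact fields and their generating functions. -/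

section ContactGeometry

variable {d : ℕ}

/-- The pairing of the momenta of a vector with the positions of another one. -/
noncomputable def momentumPairing (d : ℕ) : J1 d →L[ℂ] J1 d →L[ℂ] ℂ :=
  LinearMap.toContinuousBilinearMap (LinearMap.mk₂ ℂ (fun v v' => ∑ i, v.2.2 i * v'.1 i)
    (fun u v v' => by simp [add_mul, Finset.sum_add_distrib])
    (fun a v v' => by simp [mul_assoc, Finset.mul_sum])
    (fun u v v' => by simp [mul_add, Finset.sum_add_distrib])
    (fun a v v' => by simp [mul_left_comm, Finset.mul_sum]))

theorem momentumPairing_apply (v v' : J1 d) : momentumPairing d v v' = ∑ i, v.2.2 i * v'.1 i := rfl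

/-- The symplectic form on the contact distribution. -/
noncomputable def symplecticForm (d : ℕ) : J1 d →L[ℂ] J1 d →L[ℂ] ℂ :=
  (momentumPairing d).flip - momentumPairing d

theorem symplecticForm_eq (v v' : J1 d) :
    symplecticForm d v v' = momentumPairing d v' v - momentumPairing d v v' := rfl

theorem symplecticForm_apply (v v' : J1 d) :
    symplecticForm d v v' = ∑ i, v'.2.2 i * v.1 i - ∑ i, v.2.2 i * v'.1 i := rfl

theorem symplecticForm_swap (v v' : J1 d) : symplecticForm d v v' = -symplecticForm d v' v := by
  rw [symplecticForm_eq, symplecticForm_eq, neg_sub]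

/-- The contact form `du - u_i dx^i`. -/
noncomputable def contactForm (m v : J1 d) : ℂ := v.2.1 - momentumPairing d m v

theorem mem_contactDist {m v : J1 d} : v ∈ contactDist m ↔ contactForm m v = 0 := sub_eq_zero.symm

theorem contactForm_sub (m v v' : J1 d) :
    contactForm m (v - v') = contactForm m v - contactForm m v' := by
  simp only [contactForm, map_sub, Prod.snd_sub, Prod.fst_sub]
  ring

theorem hasFDerivAt_contactForm {Y : J1 d → J1 d} {m : J1 d} (hY : DifferentiableAt ℂ Y m) :
    ∃ L : J1 d →L[ℂ] ℂ, HasFDerivAt (fun x => contactForm x (Y x)) L m ∧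
      ∀ v, L v = contactForm m (fderiv ℂ Y m v) - momentumPairing d v (Y m) := by
  have h1 := (momentumPairing d).hasFDerivAt_of_bilinear (hasFDerivAt_id m) hY.hasFDerivAt
  have h2 := ((ContinuousLinearMap.fst ℂ ℂ (Fin (d + 1) → ℂ)).comp (ContinuousLinearMap.snd ℂ
    (Fin (d + 1) → ℂ) _)).hasFDerivAt.comp m hY.hasFDerivAt
  refine ⟨_, h2.sub h1, fun v => ?_⟩
  simp [contactForm, sub_sub]

theorem fderiv_contactForm {Y : J1 d → J1 d} {m : J1 d} (hY : DifferentiableAt ℂ Y m) (v : J1 d) :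
    fderiv ℂ (fun x => contactForm x (Y x)) m v =
      contactForm m (fderiv ℂ Y m v) - momentumPairing d v (Y m) := by
  obtain ⟨L, hL, h⟩ := hasFDerivAt_contactForm hY
  rw [hL.fderiv, h]

/-- The formula for the exterior derivative of the contact form. -/
theorem contactForm_lieBracket {S Y : J1 d → J1 d} {m : J1 d} (hS : DifferentiableAt ℂ S m)
    (hY : DifferentiableAt ℂ Y m) : contactForm m (VectorField.lieBracket ℂ S Y m) =
      fderiv ℂ (fun x => contactForm x (Y x)) m (S m)
        - fderiv ℂ (fun x => contactForm x (S x)) m (Y m) + symplecticForm d (Y m) (S m) := by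
  rw [fderiv_contactForm hS, fderiv_contactForm hY, symplecticForm_eq, VectorField.lieBracket,
    contactForm_sub]
  ring

theorem sum_smul_ddx (v : Fin (d + 1) → ℂ) : ∑ i, v i • ddx i = ((v, 0, 0) : J1 d) := by
  refine Prod.ext ?_ (Prod.ext ?_ ?_)
  · ext j
    simp [ddx, Prod.fst_sum, Pi.single_apply]
  · simp [ddx, Prod.snd_sum]
  · simp [ddx, Prod.snd_sum]

theorem sum_smul_ddp (v : Fin (d + 1) → ℂ) : ∑ i, v i • ddp i = ((0, 0, v) : J1 d) := by
  refine Prod.ext ?_ (Prod.ext ?_ ?_)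
  · simp [ddp, Prod.fst_sum]
  · simp [ddp, Prod.snd_sum, Prod.fst_sum]
  · ext j
    simp [ddp, Prod.snd_sum, Pi.single_apply]

theorem contactField_eq (f : J1 d → ℂ) (m : J1 d) : contactField f m =
    (fun i => -fderiv ℂ f m (ddp i), f m - ∑ i, m.2.2 i * fderiv ℂ f m (ddp i),
      fun i => fderiv ℂ f m (ddx i) + m.2.2 i * fderiv ℂ f m ddu) := by
  rw [contactField, sum_smul_ddx, sum_smul_ddp]
  refine Prod.ext ?_ (Prod.ext ?_ ?_)
  · ext i
    simp [ddu]
  · simp [ddu]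
  · simp [ddu]

theorem contactForm_contactField (f : J1 d → ℂ) (m : J1 d) :
    contactForm m (contactField f m) = f m := by
  simp [contactForm, momentumPairing_apply, contactField_eq]

theorem fderiv_apply_eq_sum (f : J1 d → ℂ) (m v : J1 d) : fderiv ℂ f m v =
    ∑ i, v.1 i * fderiv ℂ f m (ddx i) + v.2.1 * fderiv ℂ f m ddu
      + ∑ i, v.2.2 i * fderiv ℂ f m (ddp i) := by
  have h : v = ∑ i, v.1 i • ddx i + v.2.1 • ddu + ∑ i, v.2.2 i • ddp i := by
    rw [sum_smul_ddx, sum_smul_ddp]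
    refine Prod.ext ?_ (Prod.ext ?_ ?_) <;> simp [ddu]
  conv_lhs => rw [h]
  simp only [map_add, map_sum, map_smul, smul_eq_mul]

/-- S_f is Hamiltonian along the contact distribution. With α(S_f) = f this characterizes S_f. -/
theorem fderiv_eq_symplecticForm (f : J1 d → ℂ) {m v : J1 d} (hv : v ∈ contactDist m) :
    fderiv ℂ f m v = symplecticForm d v (contactField f m) := by
  rw [fderiv_apply_eq_sum, symplecticForm_apply, contactField_eq]
  have : v.2.1 = ∑ i, m.2.2 i * v.1 i := hv
  simp only [this, add_mul, mul_neg, Finset.sum_add_distrib, Finset.sum_neg_distrib,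
    Finset.sum_mul, mul_comm (v.1 _), mul_right_comm]
  ring

theorem differentiableOn_contactField {U : Set (J1 d)} (hU : IsOpen U) {f : J1 d → ℂ}
    (hf : DifferentiableOn ℂ f U) : DifferentiableOn ℂ (contactField f) U := by
  have h : ∀ v, DifferentiableOn ℂ (fun m => fderiv ℂ f m v) U := fun v =>
    (differentiableOn_fderiv_of_holomorphic hU hf).clm_apply (differentiableOn_const v)
  have h' := fun i => h (ddp i)
  have h'' := fun i => h (ddx i)
  have hp : ∀ i : Fin (d + 1), DifferentiableOn ℂ (fun m : J1 d => m.2.2 i) U := fun i => by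
    fun_prop
  rw [funext (contactField_eq f)]
  refine (differentiableOn_pi.2 fun i => (h' i).neg).prodMk (DifferentiableOn.prodMk
    (hf.sub (DifferentiableOn.fun_sum fun i _ => (hp i).mul (h' i)))
    (differentiableOn_pi.2 fun i => (h'' i).add ((hp i).mul (h ddu))))

/-- For Y in the distribution the formula for dα has the terms S_f(α(Y)) = 0, -Y(f) and ω(Y, S_f);
the last two cancel. -/
theorem isContactField_contactField {U : Set (J1 d)} (hU : IsOpen U) {f : J1 d → ℂ}
    (hf : DifferentiableOn ℂ f U) : IsContactField U (contactField f) := by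
  intro Y hY hY' m hm
  have hm' := hU.mem_nhds hm
  rw [mem_contactDist, contactForm_lieBracket
    ((differentiableOn_contactField hU hf).differentiableAt hm') (hY.differentiableAt hm')]
  have h0 : (fun x => contactForm x (Y x)) =ᶠ[nhds m] fun _ => 0 := by
    filter_upwards [hm'] with x hx using mem_contactDist.1 (hY' x hx)
  simp only [h0.fderiv_eq, contactForm_contactField, fderiv_eq_symplecticForm f (hY' m hm)]
  simp

/-- A contact vector field has a generating function. -/
theorem IsContactField.exists_eqOn {U : Set (J1 d)} (hU : IsOpen U) {S : J1 d → J1 d}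
    (hS : DifferentiableOn ℂ S U) (h : IsContactField U S) :
    ∃ f : J1 d → ℂ, DifferentiableOn ℂ f U ∧ Set.EqOn S (contactField f) U := by
  -- The generating function is α(S). The contact condition tested on ∂_{u_j} and on ∂_{x^j} + u_j
  -- ∂_u recovers the position and momentum components of S.
  refine ⟨fun m => contactForm m (S m), fun m hm => ?_, fun m hm => ?_⟩
  · obtain ⟨L, hL, -⟩ := hasFDerivAt_contactForm (hS.differentiableAt (hU.mem_nhds hm))
    exact hL.differentiableAt.differentiableWithinAt
  · have key : ∀ Y : J1 d → J1 d, Differentiable ℂ Y → (∀ x, Y x ∈ contactDist x) →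
        fderiv ℂ (fun x => contactForm x (S x)) m (Y m) = symplecticForm d (Y m) (S m) :=
      fun Y hY hY' => by
        have h1 := mem_contactDist.1 (h Y hY.differentiableOn (fun x _ => hY' x) m hm)
        rw [contactForm_lieBracket (hS.differentiableAt (hU.mem_nhds hm)) (hY m)] at h1
        simp only [mem_contactDist.1 (hY' _)] at h1
        simp only [fderiv_fun_const, Pi.zero_apply, zero_apply, zero_sub] at h1
        linear_combination -h1
    have hp : ∀ j, fderiv ℂ (fun x => contactForm x (S x)) m (ddp j) = -(S m).1 j := fun j => by
      rw [key (fun _ => ddp j) (differentiable_const _) fun x => by simp [contactDist, ddp],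
        symplecticForm_apply]
      simp [ddp, Pi.single_apply]
    have hx : ∀ j, fderiv ℂ (fun x => contactForm x (S x)) m (ddx j + m.2.2 j • ddu) =
        (S m).2.2 j := fun j => by
      rw [key (fun x => ddx j + x.2.2 j • ddu) (by fun_prop)
        fun x => by simp [contactDist, ddx, ddu, Pi.single_apply], symplecticForm_apply]
      simp [ddx, ddu, Pi.single_apply]
    rw [contactField_eq]
    refine Prod.ext (funext fun i => ?_) (Prod.ext ?_ (funext fun i => ?_))
    · simp [hp]
    · simp only [hp]
      simp [contactForm, momentumPairing_apply]
    · simpa using (hx i).symm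

/-- The symplectic product of the bracket with a contact vector field. -/
theorem symplecticForm_lieBracket {U : Set (J1 d)} (hU : IsOpen U) {f : J1 d → ℂ}
    (hf : DifferentiableOn ℂ f U) {m : J1 d} (hm : m ∈ U) {Y Y' : J1 d → J1 d}
    (hY' : DifferentiableAt ℂ Y' m) (h' : ∀ x, Y' x ∈ contactDist x) :
    symplecticForm d (VectorField.lieBracket ℂ (contactField f) Y m) (Y' m) =
      fderiv ℂ (fun x => fderiv ℂ f x (Y' x)) m (Y m)
        + symplecticForm d (fderiv ℂ Y m (contactField f m)) (Y' m)
        - symplecticForm d (fderiv ℂ Y' m (Y m)) (contactField f m) := by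
  have hS := (differentiableOn_contactField hU hf).differentiableAt (hU.mem_nhds hm)
  -- Along the section Y' one has df(Y') = ω(Y', S_f), and ω has constant coefficients, so the
  -- product rule applies.
  simp only [fderiv_eq_symplecticForm f (h' _)]
  rw [((symplecticForm d).hasFDerivAt_of_bilinear hY'.hasFDerivAt hS.hasFDerivAt).fderiv]
  simp only [VectorField.lieBracket, map_sub, sub_apply, _root_.add_apply,
    ContinuousLinearMap.precompR_apply, ContinuousLinearMap.precompL_apply,
    ContinuousLinearMap.compL_apply, ContinuousLinearMap.comp_apply]
  rw [symplecticForm_swap (Y' m)]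
  ring

end ContactGeometry

/-! ### Affine tangent spaces of cones. -/

section TangentSpace

variable {E : Type*} [NormedAddCommGroup E] [NormedSpace ℂ E]

/-- A quadratic equation of a cone, differentiated along the tangent space. -/
theorem bilinear_apply_of_mem_affineTangentSpace {s : Set E} {Q : E →L[ℂ] E →L[ℂ] ℂ}
    (hQ : ∀ v ∈ s, Q v v = 0) {v y : E} (hv : v ∈ closure s)
    (hy : y ∈ affineTangentSpace (closure s) v) : Q y v + Q v y = 0 := by
  have hcl : ∀ x ∈ closure s, Q x x = 0 := fun x hx =>
    closure_minimal (t := {x | Q x x = 0}) hQ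
      (isClosed_eq (by fun_prop) continuous_const) hx
  refine Submodule.span_induction (p := fun y _ => Q y v + Q v y = 0) ?_ (by simp)
    (fun x y _ _ hx hy => ?_) (fun a x _ hx => ?_) hy
  · rintro x (rfl | ⟨γ, hγ, rfl, hK, rfl⟩)
    · rw [hcl _ hv, add_zero]
    · have h1 := Q.hasFDerivAt_of_bilinear hγ.differentiableAt.hasFDerivAt
        hγ.differentiableAt.hasFDerivAt
      have h2 : (fun z => Q (γ z) (γ z)) =ᶠ[nhds 0] fun _ => 0 := by
        filter_upwards [hK] with z hz using hcl _ hz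
      have h3 := h1.fderiv
      rw [h2.fderiv_eq] at h3
      have h4 := congrArg (fun L : ℂ →L[ℂ] ℂ => L 1) h3
      simp only [fderiv_fun_const, Pi.zero_apply, zero_apply, _root_.add_apply,
        ContinuousLinearMap.precompR_apply, ContinuousLinearMap.precompL_apply,
        ContinuousLinearMap.compL_apply, ContinuousLinearMap.comp_apply,
        fderiv_apply_one_eq_deriv] at h4
      rw [add_comm]
      exact h4.symm
  · simp only [map_add, _root_.add_apply]
    linear_combination hx + hy
  · simp only [map_smul, _root_.smul_apply, smul_eq_mul]
    linear_combination a * hx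

/-- The velocity of a cubic curve in a cone. -/
theorem mem_affineTangentSpace_of_cubic [CompleteSpace E] {K : Set E} {v₀ v₁ v₂ v₃ : E}
    (h : ∀ z : ℂ, v₀ + z • v₁ + z ^ 2 • v₂ + z ^ 3 • v₃ ∈ K) : v₁ ∈ affineTangentSpace K v₀ := by
  refine Submodule.subset_span (Or.inr ⟨_, ?_, ?_, Filter.Eventually.of_forall h, ?_⟩)
  · exact Differentiable.analyticAt (by fun_prop) 0
  · simp
  · have h1 : HasDerivAt (fun z : ℂ => z) 1 0 := hasDerivAt_id 0
    have h2 := (((h1.smul_const v₁).const_add v₀).add ((h1.pow 2).smul_const v₂)).add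
      ((h1.pow 3).smul_const v₃)
    exact h2.deriv.trans (by simp)

theorem self_mem_affineTangentSpace (K : Set E) (v : E) : v ∈ affineTangentSpace K v :=
  Submodule.subset_span (Or.inl rfl)

end TangentSpace

/-! ### Brackets of a contact field with the frame. -/

section FrameFields

variable {d : ℕ} {W : Type*} [AddCommGroup W] [Module ℂ W] (w : Module.Basis (Fin d) ℂ W)
  (c : Fin d)

/-- The vector fields that are constant in the frame. -/
noncomputable def frameField : (ℂ × W × ℂ × (W →ₗ[ℂ] ℂ)) →ₗ[ℂ] (J1 d → J1 d) where
  toFun q m := q.1 • frameX0 c m + fieldX w q.2.1 m + q.2.2.1 • ddp 0 + fieldU w q.2.2.2 m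
  map_add' q q' := funext fun m => by
    simp only [Prod.fst_add, Prod.snd_add, fieldX_add, fieldU_add, Pi.add_apply]
    module
  map_smul' a q := funext fun m => by
    simp only [Prod.smul_fst, Prod.smul_snd, fieldX_smul, fieldU_smul, Pi.smul_apply,
      RingHom.id_apply, smul_eq_mul]
    module

variable {w c}

theorem frameField_apply (q : ℂ × W × ℂ × (W →ₗ[ℂ] ℂ)) (m : J1 d) : frameField w c q m =
    q.1 • frameX0 c m + fieldX w q.2.1 m + q.2.2.1 • ddp 0 + fieldU w q.2.2.2 m := rfl

theorem frameField_eq (q : ℂ × W × ℂ × (W →ₗ[ℂ] ℂ)) (m : J1 d) : frameField w c q m =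
    (Fin.cons q.1 (w.repr q.2.1), q.1 * m.2.2 0 + ∑ a, w.repr q.2.1 a * m.2.2 a.succ,
      Fin.cons (q.2.2.1 + q.1 * m.1 c.succ) fun a => q.2.2.2 (w a)) := by
  rw [frameField_apply, frameX0_eq, fieldX_eq, fieldU_eq]
  refine Prod.ext (funext fun i => ?_) (Prod.ext ?_ (funext fun i => ?_))
  · refine Fin.cases ?_ (fun a => ?_) i <;> simp [ddp]
  · simp [ddp]
  · refine Fin.cases ?_ (fun a => ?_) i <;> simp [ddp, add_comm]

theorem differentiable_frameField (q : ℂ × W × ℂ × (W →ₗ[ℂ] ℂ)) :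
    Differentiable ℂ (frameField w c q) :=
  ((((differentiable_frameX0 c).const_smul q.1).add (differentiable_fieldX w q.2.1)).add_const
    (q.2.2.1 • ddp 0)).add (differentiable_fieldU w q.2.2.2)

theorem fderiv_frameField (q : ℂ × W × ℂ × (W →ₗ[ℂ] ℂ)) (m v : J1 d) :
    fderiv ℂ (frameField w c q) m v =
      (0, q.1 * v.2.2 0 + ∑ a, w.repr q.2.1 a * v.2.2 a.succ,
        Pi.single 0 (q.1 * v.1 c.succ)) := by
  have h := (((((differentiable_frameX0 c) m).hasFDerivAt.const_smul q.1).add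
    ((differentiable_fieldX w q.2.1) m).hasFDerivAt).add_const (q.2.2.1 • ddp 0)).add
    ((differentiable_fieldU w q.2.2.2) m).hasFDerivAt
  have h' := congrArg (fun L : J1 d →L[ℂ] J1 d => L v) h.fderiv
  refine Eq.trans h' ?_
  simp only [_root_.add_apply, _root_.smul_apply, fderiv_frameX0, fderiv_fieldX, fderiv_fieldU]
  refine Prod.ext ?_ (Prod.ext ?_ ?_)
  · simp
  · simp
  · simp [← Pi.single_smul']

theorem frameField_mem_contactDist (q : ℂ × W × ℂ × (W →ₗ[ℂ] ℂ)) (m : J1 d) :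
    frameField w c q m ∈ contactDist m := by
  simp [contactDist, frameField_eq, Fin.sum_univ_succ, mul_comm]

theorem exists_frameField_eq {m v : J1 d} (hv : v ∈ contactDist m) :
    ∃ q, frameField w c q m = v := by
  refine ⟨(v.1 0, pointX w v, v.2.2 0 - v.1 0 * m.1 c.succ, ∑ a, v.2.2 a.succ • w.coord a), ?_⟩
  have hv' : v.2.1 = ∑ i, m.2.2 i * v.1 i := hv
  have hX : ∀ a, w.repr (pointX w v) a = v.1 a.succ := fun a => by
    simp [pointX, Finsupp.single_apply]
  rw [frameField_eq]
  refine Prod.ext (funext fun i => ?_) (Prod.ext ?_ (funext fun i => ?_))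
  · refine Fin.cases ?_ (fun a => ?_) i <;> simp [hX]
  · simp [hX, hv', Fin.sum_univ_succ, mul_comm]
  · refine Fin.cases ?_ (fun a => ?_) i
    · simp
    · simp [LinearMap.sum_apply, Finsupp.single_apply]

theorem symplecticForm_frameField (q q' : ℂ × W × ℂ × (W →ₗ[ℂ] ℂ)) (m : J1 d) :
    symplecticForm d (frameField w c q m) (frameField w c q' m) =
      q.1 * q'.2.2.1 + q'.2.2.2 q.2.1 - q'.1 * q.2.2.1 - q.2.2.2 q'.2.1 := by
  rw [symplecticForm_apply, frameField_eq, frameField_eq, ← sum_repr_mul w q'.2.2.2,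
    ← sum_repr_mul w q.2.2.2]
  simp only [Fin.sum_univ_succ, Fin.cons_zero, Fin.cons_succ, mul_comm (q.2.2.2 _),
    mul_comm (q'.2.2.2 _)]
  ring

variable (w c)

/-- The symplectic products of the brackets of `S` and the frame with the frame. -/
noncomputable def bracketForm (S : J1 d → J1 d) (m : J1 d) :
    (ℂ × W × ℂ × (W →ₗ[ℂ] ℂ)) →ₗ[ℂ] (ℂ × W × ℂ × (W →ₗ[ℂ] ℂ)) →ₗ[ℂ] ℂ :=
  LinearMap.mk₂ ℂ (fun q q' => symplecticForm d
      (VectorField.lieBracket ℂ S (frameField w c q) m) (frameField w c q' m))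
    (fun q q' r => by
      rw [map_add, VectorField.lieBracket_add_right (differentiable_frameField q m)
        (differentiable_frameField q' m), map_add, _root_.add_apply])
    (fun a q r => by
      rw [map_smul, VectorField.lieBracket_const_smul_right (differentiable_frameField q m),
        map_smul, _root_.smul_apply])
    (fun q r r' => by rw [map_add, Pi.add_apply, map_add])
    (fun a q r => by rw [map_smul, Pi.smul_apply, map_smul])

variable {w c}

theorem bracketForm_apply (S : J1 d → J1 d) (m : J1 d) (q q' : ℂ × W × ℂ × (W →ₗ[ℂ] ℂ)) :
    bracketForm w c S m q q' = symplecticForm d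
      (VectorField.lieBracket ℂ S (frameField w c q) m) (frameField w c q' m) := rfl

variable {U : Set (J1 d)} (hU : IsOpen U) {f : J1 d → ℂ} (hf : DifferentiableOn ℂ f U) {m : J1 d}
  (hm : m ∈ U)
include hU hf hm

/-- The two corrections come from x^c ∂_{u_0} in X_0, the only momentum component of the frame that
varies. They become the l^6 and l^5 terms of the equation. -/
theorem bracketForm_contactField (q q' : ℂ × W × ℂ × (W →ₗ[ℂ] ℂ)) :
    bracketForm w c (contactField f) m q q' =
      fderiv ℂ (fun x => fderiv ℂ f x (frameField w c q' x)) m (frameField w c q m)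
        + q.1 * q'.1 * fderiv ℂ f m (ddp c.succ)
        - q'.1 * w.coord c q.2.1 * fderiv ℂ f m (ddp 0) := by
  rw [bracketForm_apply, symplecticForm_lieBracket hU hf hm (differentiable_frameField q' m)
    (frameField_mem_contactDist q'), fderiv_frameField, fderiv_frameField, symplecticForm_apply,
    symplecticForm_apply]
  simp only [frameField_eq, contactField_eq]
  simp [Pi.single_apply]
  ring

/-- The flow of S_f rescales ω at the rate f_u, and the products of frame fields are constant. On an
isotropic pair the bracket form is therefore symmetric. -/
theorem bracketForm_swap (q q' : ℂ × W × ℂ × (W →ₗ[ℂ] ℂ)) :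
    bracketForm w c (contactField f) m q q' - bracketForm w c (contactField f) m q' q =
      -symplecticForm d (frameField w c q m) (frameField w c q' m) * fderiv ℂ f m ddu := by
  have hd := (differentiableOn_fderiv_of_holomorphic hU hf).differentiableAt (hU.mem_nhds hm)
  have hsymm := second_derivative_symmetric_of_eventually (𝕜 := ℂ) (f := f) (f' := fderiv ℂ f)
    (by filter_upwards [hU.mem_nhds hm] with y hy using
          (hf.differentiableAt (hU.mem_nhds hy)).hasFDerivAt) hd.hasFDerivAt
    (frameField w c q m) (frameField w c q' m)
  rw [bracketForm_contactField hU hf hm, bracketForm_contactField hU hf hm,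
    fderiv_clm_apply hd (differentiable_frameField q' m),
    fderiv_clm_apply hd (differentiable_frameField q m)]
  simp only [_root_.add_apply, ContinuousLinearMap.comp_apply, ContinuousLinearMap.flip_apply,
    hsymm, fderiv_frameField]
  have h : ∀ r r' : ℂ × W × ℂ × (W →ₗ[ℂ] ℂ), fderiv ℂ f m
      (0, r'.1 * (frameField w c r m).2.2 0 + ∑ a, w.repr r'.2.1 a * (frameField w c r m).2.2 a.succ,
        Pi.single 0 (r'.1 * (frameField w c r m).1 c.succ)) =
      (r'.1 * (r.2.2.1 + r.1 * m.1 c.succ) + r.2.2.2 r'.2.1) * fderiv ℂ f m ddu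
        + r'.1 * w.coord c r.2.1 * fderiv ℂ f m (ddp 0) := fun r r' => by
    rw [fderiv_apply_eq_sum, frameField_eq, ← sum_repr_mul w r.2.2.2]
    simp [Pi.single_apply]
  rw [h, h, symplecticForm_frameField]
  ring

end FrameFields

/-! ### The cone over the sub-adjoint variety has Lagrangian tangent spaces. -/

section Cone

variable {d : ℕ} {W : Type*} [AddCommGroup W] [Module ℂ W] (w : Module.Basis (Fin d) ℂ W)
  (c : Fin d) (C : W →ₗ[ℂ] W →ₗ[ℂ] W →ₗ[ℂ] ℂ)

/-- The components of `V(l, t)` in the frame. -/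
noncomputable def coneVector (l : ℂ) (t : W) : ℂ × W × ℂ × (W →ₗ[ℂ] ℂ) :=
  (l ^ 3, -(l ^ 2) • t, -(1 / 2 * C t t t), -(3 / 2 * l) • C t t)

/-- The derivative of `V(l, t)` with respect to `t`. -/
noncomputable def coneTangent (l : ℂ) (t s : W) : ℂ × W × ℂ × (W →ₗ[ℂ] ℂ) :=
  (0, -(l ^ 2) • s, -(3 / 2 * C t t s), -(3 * l) • C t s)

theorem pointX_add (v v' : J1 d) : pointX w (v + v') = pointX w v + pointX w v' := by
  simp [pointX, add_smul, Finset.sum_add_distrib]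

theorem pointX_smul (a : ℂ) (v : J1 d) : pointX w (a • v) = a • pointX w v := by
  simp [pointX, mul_smul, Finset.smul_sum]

/-- The bilinear form of the equation `x⁰ u_a + (3/2) C_a(X²) = 0` of the cone. -/
noncomputable def coneEquation (a : Fin d) : J1 d →L[ℂ] J1 d →L[ℂ] ℂ :=
  LinearMap.toContinuousBilinearMap (LinearMap.mk₂ ℂ
    (fun v v' => v.1 0 * v'.2.2 a.succ + 3 / 2 * C (w a) (pointX w v) (pointX w v'))
    (fun u v v' => by
      simp only [pointX_add, map_add, LinearMap.add_apply, Prod.fst_add, Pi.add_apply]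
      ring)
    (fun a v v' => by
      simp only [pointX_smul, map_smul, LinearMap.smul_apply, Prod.smul_fst, Pi.smul_apply,
        smul_eq_mul]
      ring)
    (fun u v v' => by
      simp only [pointX_add, map_add, Prod.snd_add, Pi.add_apply]
      ring)
    (fun a v v' => by
      simp only [pointX_smul, map_smul, Prod.smul_snd, Pi.smul_apply, smul_eq_mul]
      ring))

/-- The bilinear form of the equation `3 x⁰ (u_0 - x⁰ m^c) + x^a u_a = 0` of the cone at `m`. -/
noncomputable def coneEquationZero (m : J1 d) : J1 d →L[ℂ] J1 d →L[ℂ] ℂ :=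
  LinearMap.toContinuousBilinearMap (LinearMap.mk₂ ℂ
    (fun v v' => 3 * (v.1 0 * (v'.2.2 0 - v'.1 0 * m.1 c.succ))
      + ∑ a : Fin d, v.1 a.succ * v'.2.2 a.succ)
    (fun u v v' => by
      simp only [Prod.fst_add, Pi.add_apply, add_mul, Finset.sum_add_distrib]
      ring)
    (fun a v v' => by
      simp only [Prod.smul_fst, Pi.smul_apply, smul_eq_mul, mul_assoc, ← Finset.mul_sum]
      ring)
    (fun u v v' => by
      simp only [Prod.fst_add, Prod.snd_add, Pi.add_apply, mul_add, Finset.sum_add_distrib]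
      ring)
    (fun a v v' => by
      simp only [Prod.smul_fst, Prod.smul_snd, Pi.smul_apply, smul_eq_mul,
        mul_left_comm _ a, ← Finset.mul_sum]
      ring))

variable {w c C}

theorem coneEquation_apply (a : Fin d) (v v' : J1 d) : coneEquation w C a v v' =
    v.1 0 * v'.2.2 a.succ + 3 / 2 * C (w a) (pointX w v) (pointX w v') := rfl

theorem coneEquationZero_apply (m v v' : J1 d) : coneEquationZero c m v v' =
    3 * (v.1 0 * (v'.2.2 0 - v'.1 0 * m.1 c.succ))
      + ∑ a : Fin d, v.1 a.succ * v'.2.2 a.succ := rfl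

theorem pointX_frameField (q : ℂ × W × ℂ × (W →ₗ[ℂ] ℂ)) (m : J1 d) :
    pointX w (frameField w c q m) = q.2.1 := by
  simp [pointX, frameField_eq, w.sum_repr]

theorem sum_mul_apply_pointX (B : W →ₗ[ℂ] W →ₗ[ℂ] W →ₗ[ℂ] ℂ) (v : J1 d) (s t : W) :
    ∑ a : Fin d, v.1 a.succ * B (w a) s t = B (pointX w v) s t := by
  simp [pointX, LinearMap.sum_apply]

theorem fieldV_eq_frameField (hC : IsJordanCubicForm C) (l : ℂ) (t : W) :
    fieldV C w c l t = frameField w c (coneVector C l t) := by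
  funext m
  rw [fieldV_eq w c C hC, frameField_apply]
  simp only [coneVector, fieldX_smul, fieldU_smul]
  module

theorem fieldV_mem_subadjointCone (l : ℂ) (t : W) (m : J1 d) :
    fieldV C w c l t m ∈ subadjointCone C w c m := subset_closure ⟨l, t, rfl⟩

/-- The tangent spaces of the cone are isotropic. -/
theorem symplecticForm_eq_zero_of_mem_affineTangentSpace (hC : IsJordanCubicForm C) {l : ℂ}
    (hl : l ≠ 0) (t : W) {m y : J1 d}
    (hy : y ∈ affineTangentSpace (subadjointCone C w c m) (fieldV C w c l t m)) :
    symplecticForm d y (fieldV C w c l t m) = 0 := by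
  have hE : ∀ a, ∀ v ∈ {v | ∃ (l : ℂ) (t : W), fieldV C w c l t m = v},
      coneEquation w C a v v = 0 := by
    rintro a _ ⟨l, t, rfl⟩
    rw [fieldV_eq_frameField hC, coneEquation_apply, pointX_frameField, frameField_eq]
    simp only [coneVector, Fin.cons_zero, Fin.cons_succ, LinearMap.smul_apply, map_smul,
      smul_eq_mul, hC.swap_left (w a) t t, hC.swap_right t (w a) t]
    ring
  have hE0 : ∀ v ∈ {v | ∃ (l : ℂ) (t : W), fieldV C w c l t m = v},
      coneEquationZero c m v v = 0 := by
    rintro _ ⟨l, t, rfl⟩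
    rw [fieldV_eq_frameField hC, coneEquationZero_apply, frameField_eq]
    simp only [Fin.cons_zero, Fin.cons_succ, sum_repr_mul]
    simp only [coneVector, LinearMap.smul_apply, map_smul, smul_eq_mul]
    ring
  have hv := fieldV_mem_subadjointCone (C := C) (w := w) (c := c) l t m
  have h1 := bilinear_apply_of_mem_affineTangentSpace hE0 hv hy
  have h2 := fun a => bilinear_apply_of_mem_affineTangentSpace (hE a) hv hy
  have h3 := hE0 _ ⟨l, t, rfl⟩
  have h4 := fun a => hE a _ ⟨l, t, rfl⟩
  have hA : (fieldV C w c l t m).1 0 ≠ 0 := by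
    rw [fieldV_eq_frameField hC, frameField_eq]
    exact pow_ne_zero 3 hl
  generalize fieldV C w c l t m = v at h1 h2 h3 h4 hA ⊢
  simp only [coneEquation_apply, coneEquationZero_apply] at h1 h2 h3 h4
  -- Contracting the equations for the u_a with the positions of v and of y produces the pairings of
  -- positions and momenta. Eliminating the common term C(X_v, X_v, X_y) with the remaining quadric
  -- expresses x⁰ ω(y, v), and x⁰ = l³ ≠ 0.
  have h5 : ∑ a : Fin d, v.1 a.succ * (y.1 0 * v.2.2 a.succ
      + 3 / 2 * C (w a) (pointX w y) (pointX w v) + (v.1 0 * y.2.2 a.succ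
      + 3 / 2 * C (w a) (pointX w v) (pointX w y))) = 0 :=
    Finset.sum_eq_zero fun a _ => by rw [h2, mul_zero]
  have h6 : ∑ a : Fin d, y.1 a.succ * (v.1 0 * v.2.2 a.succ
      + 3 / 2 * C (w a) (pointX w v) (pointX w v)) = 0 :=
    Finset.sum_eq_zero fun a _ => by rw [h4, mul_zero]
  simp only [mul_add, Finset.sum_add_distrib, mul_left_comm _ (3 / 2 : ℂ),
    mul_left_comm _ (v.1 0), mul_left_comm _ (y.1 0), ← Finset.mul_sum,
    sum_mul_apply_pointX] at h5 h6
  rw [symplecticForm_apply, Fin.sum_univ_succ, Fin.sum_univ_succ]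
  refine (mul_eq_zero.1 ?_).resolve_left hA
  simp only [mul_comm (v.2.2 _), mul_comm (y.2.2 _)]
  linear_combination -(v.1 0 / 3) * h1 - 2 / 3 * h5 + 4 / 3 * h6 + 2 / 3 * y.1 0 * h3
    - hC.swap_right (pointX w v) (pointX w y) (pointX w v)
    + 2 * hC.swap_left (pointX w v) (pointX w y) (pointX w v)

/-- The expansion of `V(l, t + z s)`. -/
theorem coneVector_add (hC : IsJordanCubicForm C) (l z : ℂ) (t s : W) :
    coneVector C l (t + z • s) = coneVector C l t + z • coneTangent C l t s
      + z ^ 2 • ((0, 0, -(3 / 2 * C s s t), -(3 / 2 * l) • C s s) : ℂ × W × ℂ × (W →ₗ[ℂ] ℂ))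
      + z ^ 3 • ((0, 0, -(1 / 2 * C s s s), 0) : ℂ × W × ℂ × (W →ₗ[ℂ] ℂ)) := by
  refine Prod.ext ?_ (Prod.ext ?_ (Prod.ext ?_ ?_))
  · simp [coneVector, coneTangent]
  · simp only [coneVector, coneTangent, Prod.fst_add, Prod.snd_add, Prod.smul_fst, Prod.smul_snd]
    module
  · simp only [coneVector, coneTangent, Prod.fst_add, Prod.snd_add, Prod.smul_fst, Prod.smul_snd,
      map_add, map_smul, LinearMap.add_apply, LinearMap.smul_apply, smul_eq_mul,
      hC.comm s t, hC.swap_right t s t, hC.swap_right s s t]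
    ring
  · simp only [coneVector, coneTangent, Prod.snd_add, Prod.smul_snd,
      map_add, map_smul, LinearMap.add_apply, LinearMap.smul_apply, hC.comm s t]
    module

theorem frameField_coneTangent_mem (hC : IsJordanCubicForm C) (l : ℂ) (t s : W) (m : J1 d) :
    frameField w c (coneTangent C l t s) m ∈
      affineTangentSpace (subadjointCone C w c m) (fieldV C w c l t m) := by
  rw [fieldV_eq_frameField hC]
  refine mem_affineTangentSpace_of_cubic
    (v₂ := frameField w c (0, 0, -(3 / 2 * C s s t), -(3 / 2 * l) • C s s) m)
    (v₃ := frameField w c (0, 0, -(1 / 2 * C s s s), 0) m) fun z => ?_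
  have h := fieldV_mem_subadjointCone (C := C) (w := w) (c := c) l (t + z • s) m
  rw [fieldV_eq_frameField hC, coneVector_add hC] at h
  simpa only [map_add, map_smul, Pi.add_apply, Pi.smul_apply] using h

/-- The tangent spaces of the cone are Lagrangian. -/
theorem frameField_mem_affineTangentSpace (hC : IsJordanCubicForm C) {l : ℂ} (hl : l ≠ 0) (t : W)
    {m : J1 d} {q : ℂ × W × ℂ × (W →ₗ[ℂ] ℂ)}
    (h : symplecticForm d (frameField w c q m) (frameField w c (coneVector C l t) m) = 0)
    (h' : ∀ s, symplecticForm d (frameField w c q m) (frameField w c (coneTangent C l t s) m) = 0) :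
    frameField w c q m ∈ affineTangentSpace (subadjointCone C w c m) (fieldV C w c l t m) := by
  obtain ⟨a, b, z, φ⟩ := q
  simp only [symplecticForm_frameField, coneVector, coneTangent, LinearMap.smul_apply, map_smul,
    smul_eq_mul] at h h'
  -- The component a fixes the multiple of V and then b fixes the direction s of the t-derivative.
  -- Orthogonality forces z and φ.
  have key : ((a, b, z, φ) : ℂ × W × ℂ × (W →ₗ[ℂ] ℂ)) = (a / l ^ 3) • coneVector C l t
      + coneTangent C l t (-(1 / l ^ 2) • (b + (a / l) • t)) := by
    have hφ : φ = -(a / l ^ 3 * (3 / 2 * l)) • C t t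
        + (3 / l) • C t (b + (a / l) • t) := by
      ext s
      have h1 := h' s
      simp only [LinearMap.add_apply, LinearMap.smul_apply, map_add, map_smul, smul_eq_mul]
      rw [hC.swap_right t s b] at h1
      have h2 : φ s = (3 / 2 * a * C t t s + 3 * l * C t b s) / l ^ 2 := by
        rw [eq_div_iff (pow_ne_zero 2 hl)]
        linear_combination h1
      rw [h2]
      field_simp
      ring
    refine Prod.ext ?_ (Prod.ext ?_ (Prod.ext ?_ ?_))
    · simp only [coneVector, coneTangent, Prod.fst_add, Prod.smul_fst, smul_eq_mul]
      field_simp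
      ring
    · simp only [coneVector, coneTangent, Prod.fst_add, Prod.snd_add, Prod.smul_fst,
        Prod.smul_snd, smul_smul]
      match_scalars
      · field_simp
      · field_simp
        ring
    · simp only [coneVector, coneTangent, Prod.fst_add, Prod.snd_add, Prod.smul_fst,
        Prod.smul_snd, smul_eq_mul, map_smul, map_add]
      have h1 : z = (a * C t t t + 3 / 2 * l * C t t b) / l ^ 3 := by
        rw [eq_div_iff (pow_ne_zero 3 hl)]
        linear_combination h' t - h
      rw [h1]
      field_simp
      ring
    · simp only [coneVector, coneTangent, Prod.snd_add, Prod.smul_snd, map_smul, map_add]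
      rw [hφ]
      simp only [map_add, map_smul]
      match_scalars <;> field_simp
  rw [key, map_add, map_smul, Pi.add_apply, Pi.smul_apply]
  refine Submodule.add_mem _ (Submodule.smul_mem _ _ ?_) (frameField_coneTangent_mem hC l t _ m)
  rw [← fieldV_eq_frameField hC]
  exact self_mem_affineTangentSpace _ _

end Cone

/-! ### Symmetries correspond to solutions of the equation. -/

section Symmetries

variable {d : ℕ} {W : Type*} [AddCommGroup W] [Module ℂ W] {w : Module.Basis (Fin d) ℂ W}
  {c : Fin d} {C : W →ₗ[ℂ] W →ₗ[ℂ] W →ₗ[ℂ] ℂ}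

/-- The linear term of a bilinear form on a cubic curve. -/
theorem LinearMap.apply_add_apply_eq_zero_of_cubic {M : Type*} [AddCommGroup M] [Module ℂ M]
    (Φ : M →ₗ[ℂ] M →ₗ[ℂ] ℂ) {q₀ q₁ q₂ q₃ : M}
    (h : ∀ z : ℂ, Φ (q₀ + z • q₁ + z ^ 2 • q₂ + z ^ 3 • q₃)
      (q₀ + z • q₁ + z ^ 2 • q₂ + z ^ 3 • q₃) = 0) : Φ q₀ q₁ + Φ q₁ q₀ = 0 := by
  have key := eq_zero_of_forall_sum_pow_smul_eq_zero (H := ℂ) (n := 7)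
    (a := ![Φ q₀ q₀, Φ q₀ q₁ + Φ q₁ q₀, Φ q₀ q₂ + Φ q₁ q₁ + Φ q₂ q₀,
      Φ q₀ q₃ + Φ q₁ q₂ + Φ q₂ q₁ + Φ q₃ q₀, Φ q₁ q₃ + Φ q₂ q₂ + Φ q₃ q₁,
      Φ q₂ q₃ + Φ q₃ q₂, Φ q₃ q₃]) fun z => by
    rw [← h z]
    simp only [map_add, map_smul, LinearMap.add_apply, LinearMap.smul_apply, Fin.sum_univ_succ,
      Fin.sum_univ_zero, Matrix.cons_val_zero, Matrix.cons_val_succ, Fin.val_zero, Fin.val_succ,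
      smul_eq_mul]
    ring
  exact key 1

section
variable {U : Opens (J1 d)} {f : J1 d → ℂ} (hf : DifferentiableOn ℂ f U)

theorem jetFrame_mk (q : ℂ × W × ℂ × (W →ₗ[ℂ] ℂ)) :
    q.1 • (jetFrame w c U).X0 (HolFun.mk f hf) + (jetFrame w c U).X q.2.1 (HolFun.mk f hf)
      + q.2.2.1 • (jetFrame w c U).U0 (HolFun.mk f hf) + (jetFrame w c U).U q.2.2.2 (HolFun.mk f hf) =
    mk (fun x => fderiv ℂ f x (frameField w c q x))
      (differentiableOn_fderiv_field hf (differentiable_frameField q)) := by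
  refine ext_evalAt fun m => ?_
  rw [evalAt_mk, frameField_apply]
  simp only [jetFrame_X0, jetFrame_X, jetFrame_U0, jetFrame_U, derivX0, derivX, derivU0, derivU,
    along_mk, map_add, map_smul, evalAt_mk]

theorem jetFrame_V_mk (l : ℂ) (t : W) : (jetFrame w c U).V C l t (HolFun.mk f hf) =
    mk (fun x => fderiv ℂ f x (frameField w c (coneVector C l t) x))
      (differentiableOn_fderiv_field hf (differentiable_frameField _)) := by
  rw [← jetFrame_mk hf]
  simp only [ContactFrame.V, coneVector, LinearMap.sub_apply, LinearMap.smul_apply, map_smul]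
  module

theorem fieldU_coord (m : J1 d) : fieldU w (w.coord c) m = ddp c.succ := by
  simp [fieldU, Finsupp.single_apply]

/-- The equation of the generating functions in terms of brackets. -/
theorem evalAt_equation (l : ℂ) (t : W) (m : U) :
    evalAt m ((jetFrame w c U).V C l t ((jetFrame w c U).V C l t (HolFun.mk f hf))
      + (l ^ 5 * w.coord c t) • (jetFrame w c U).U0 (HolFun.mk f hf)
      + l ^ 6 • (jetFrame w c U).U (w.coord c) (HolFun.mk f hf)) =
    bracketForm w c (contactField f) m (coneVector C l t) (coneVector C l t) := by
  rw [bracketForm_contactField U.isOpen hf m.2, jetFrame_V_mk, jetFrame_V_mk, jetFrame_U0,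
    jetFrame_U, derivU0, derivU, along_mk, along_mk]
  simp only [map_add, map_smul, evalAt_mk, fieldU_coord, smul_eq_mul]
  simp only [coneVector, map_smul, smul_eq_mul]
  ring

theorem ContactFrame.IsSolution.bracketForm_eq_zero (h : (jetFrame w c U).IsSolution C (HolFun.mk f hf)) (l : ℂ)
    (t : W) {m : J1 d} (hm : m ∈ U) :
    bracketForm w c (contactField f) m (coneVector C l t) (coneVector C l t) = 0 := by
  rw [← evalAt_equation hf l t ⟨m, hm⟩, h l t, map_zero]

/-- The bracket with `V(l, t)` is tangent to the cone when `l ≠ 0`. -/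
theorem ContactFrame.IsSolution.lieBracket_mem_of_ne_zero (hC : IsJordanCubicForm C)
    (h : (jetFrame w c U).IsSolution C (HolFun.mk f hf)) {l : ℂ} (hl : l ≠ 0) (t : W) {m : J1 d}
    (hm : m ∈ U) : VectorField.lieBracket ℂ (contactField f) (fieldV C w c l t) m ∈
      affineTangentSpace (subadjointCone C w c m) (fieldV C w c l t m) := by
  have hb : VectorField.lieBracket ℂ (contactField f) (frameField w c (coneVector C l t)) m ∈
      contactDist m := isContactField_contactField U.isOpen hf _
    (differentiable_frameField _).differentiableOn (fun x _ => frameField_mem_contactDist _ x) m hm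
  obtain ⟨q, hq⟩ := exists_frameField_eq (w := w) (c := c) hb
  rw [fieldV_eq_frameField hC, ← hq, ← fieldV_eq_frameField hC]
  refine frameField_mem_affineTangentSpace hC hl t ?_ fun s => ?_
  · rw [hq]
    exact ContactFrame.IsSolution.bracketForm_eq_zero hf h l t hm
  · rw [hq]
    change bracketForm w c (contactField f) m (coneVector C l t) (coneTangent C l t s) = 0
    -- The term linear in z of the equation at t + z s gives the sum of the two orders of the
    -- bracket form on V and its derivative along s. Their difference vanishes by isotropy, so each
    -- is zero.
    have h1 := LinearMap.apply_add_apply_eq_zero_of_cubic (bracketForm w c (contactField f) m)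
      fun z => by
        rw [← coneVector_add hC l z t s]
        exact ContactFrame.IsSolution.bracketForm_eq_zero hf h l _ hm
    have h2 := bracketForm_swap (w := w) (c := c) U.isOpen hf hm (coneVector C l t)
      (coneTangent C l t s)
    have h3 : symplecticForm d (frameField w c (coneVector C l t) m)
        (frameField w c (coneTangent C l t s) m) = 0 := by
      rw [symplecticForm_frameField]
      simp only [coneVector, coneTangent, LinearMap.smul_apply, map_smul, smul_eq_mul,
        hC.swap_right t s t]
      ring
    rw [h3, neg_zero, zero_mul] at h2
    linear_combination h1 / 2 + h2 / 2

/-- The vertical vectors are tangent to the cone at the points with `l = 0`. -/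
theorem frameField_vertical_mem (hC : IsJordanCubicForm C) {t : W} (ht : C t t t ≠ 0) (z : ℂ)
    (φ : W →ₗ[ℂ] ℂ) (m : J1 d) : frameField w c (0, 0, z, φ) m ∈
      affineTangentSpace (subadjointCone C w c m) (fieldV C w c 0 t m) := by
  have : Module.Finite ℂ W := Module.Finite.of_basis w
  have : Nontrivial W := ⟨t, 0, fun h => ht (by simp [h])⟩
  set T := affineTangentSpace (subadjointCone C w c m) (fieldV C w c 0 t m) with hT
  have h0 : frameField w c (0, 0, z, 0) m ∈ T := by
    have h1 : ((0, 0, z, 0) : ℂ × W × ℂ × (W →ₗ[ℂ] ℂ)) =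
        (-(2 * z / C t t t)) • coneVector C 0 t := by
      refine Prod.ext ?_ (Prod.ext ?_ (Prod.ext ?_ ?_)) <;> simp [coneVector]
      field_simp
    rw [h1, map_smul, Pi.smul_apply, ← fieldV_eq_frameField hC]
    exact T.smul_mem _ (self_mem_affineTangentSpace _ _)
  -- V(0, t) depends only on N(t), so z ↦ V(z, t') is a curve in the cone through the same point,
  -- with velocity -(3/2) U_{C(t',t')}.
  have h1 : ∀ t' : W, C t' t' t' = C t t t → frameField w c (0, 0, 0, C t' t') m ∈ T := fun t' e => by
    have h2 : (-(3 / 2) : ℂ) • frameField w c (0, 0, 0, C t' t') m ∈ T := by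
      have h3 : fieldV C w c 0 t m = frameField w c (0, 0, -(1 / 2 * C t t t), 0) m := by
        rw [fieldV_eq_frameField hC]
        simp [coneVector]
      rw [hT, h3]
      refine mem_affineTangentSpace_of_cubic (v₂ := frameField w c (0, -t', 0, 0) m)
        (v₃ := frameField w c (1, 0, 0, 0) m) fun z => ?_
      have h4 := fieldV_mem_subadjointCone (C := C) (w := w) (c := c) z t' m
      have h5 : coneVector C z t' = (0, 0, -(1 / 2 * C t t t), 0)
          + z • ((-(3 / 2) : ℂ) • (0, 0, 0, C t' t')) + z ^ 2 • (0, -t', 0, 0)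
          + z ^ 3 • (1, 0, 0, 0) := by
        refine Prod.ext ?_ (Prod.ext ?_ (Prod.ext ?_ ?_))
        · simp [coneVector]
        · simp [coneVector]
        · simp [coneVector, e]
        · simp [coneVector, smul_smul, mul_comm]
      rw [fieldV_eq_frameField hC, h5] at h4
      simpa only [map_add, map_smul, Pi.add_apply, Pi.smul_apply] using h4
    exact (T.smul_mem_iff (by norm_num)).1 h2
  let J : (W →ₗ[ℂ] ℂ) →ₗ[ℂ] J1 d :=
    LinearMap.proj m ∘ₗ frameField w c ∘ₗ LinearMap.inr ℂ ℂ _ ∘ₗ LinearMap.inr ℂ W _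
      ∘ₗ LinearMap.inr ℂ ℂ _
  have hJ : ∀ ψ, J ψ = frameField w c (0, 0, 0, ψ) m := fun ψ => rfl
  have h2 : T.mkQ (J φ) = 0 := hC.linearMap_ext_of_smul (L := T.mkQ ∘ₗ J) (fun t' => by
    by_cases ht' : C t' t' t' = 0
    · rw [ht', zero_smul]
    · obtain ⟨μ, hμ⟩ := IsAlgClosed.exists_pow_nat_eq (C t t t / C t' t' t') (n := 3) (by norm_num)
      have hμ0 : μ ≠ 0 := by
        rintro rfl
        rw [zero_pow three_ne_zero] at hμ
        exact div_ne_zero ht ht' hμ.symm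
      have h3 := h1 (μ • t') (by
        simp only [map_smul, LinearMap.smul_apply, smul_eq_mul]
        rw [eq_div_iff ht'] at hμ
        rw [← hμ]
        ring)
      rw [← hJ] at h3
      simp only [map_smul, LinearMap.smul_apply, smul_smul] at h3
      have h4 : T.mkQ (J (C t' t')) = 0 := (Submodule.Quotient.mk_eq_zero T).2
        ((T.smul_mem_iff (mul_ne_zero hμ0 hμ0)).1 h3)
      rw [LinearMap.comp_apply, h4, smul_zero]) φ
  have h3 : J φ ∈ T := (Submodule.Quotient.mk_eq_zero T).1 h2
  have h4 : ((0, 0, z, φ) : ℂ × W × ℂ × (W →ₗ[ℂ] ℂ)) = (0, 0, z, 0) + (0, 0, 0, φ) := by simp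
  rw [h4, map_add, Pi.add_apply]
  exact T.add_mem h0 h3

/-- The bracket with `V(0, t)` is tangent to the cone. -/
theorem ContactFrame.IsSolution.lieBracket_mem_zero (hC : IsJordanCubicForm C)
    (h : (jetFrame w c U).IsSolution C (HolFun.mk f hf)) (t : W) {m : J1 d}
    (hm : m ∈ U) : VectorField.lieBracket ℂ (contactField f) (fieldV C w c 0 t) m ∈
      affineTangentSpace (subadjointCone C w c m) (fieldV C w c 0 t m) := by
  have : Module.Finite ℂ W := Module.Finite.of_basis w
  have hV : fieldV C w c 0 t = frameField w c (0, 0, -(1 / 2 * C t t t), 0) := by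
    rw [fieldV_eq_frameField hC]
    congr 1
    simp [coneVector]
  -- V(0, t) = -(1/2) N(t) ∂_{u_0} vanishes identically when N(t) = 0, and so does the bracket.
  by_cases ht : C t t t = 0
  · have h0 : fieldV C w c 0 t = 0 := by
      rw [hV, ht, mul_zero, neg_zero]
      exact map_zero _
    rw [h0, VectorField.lieBracket_zero_right]
    exact Submodule.zero_mem _
  have hb : VectorField.lieBracket ℂ (contactField f) (fieldV C w c 0 t) m ∈ contactDist m := by
    rw [hV]
    exact isContactField_contactField U.isOpen hf _
      (differentiable_frameField _).differentiableOn (fun x _ => frameField_mem_contactDist _ x) m hm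
  have hs : ∀ z ψ, symplecticForm d
      (VectorField.lieBracket ℂ (contactField f) (fieldV C w c 0 t) m)
      (frameField w c (0, 0, z, ψ) m) = 0 := fun z ψ => by
    rw [hV, ← bracketForm_apply, bracketForm_contactField U.isOpen hf hm]
    have he : w.coord c (w c) = 1 := by simp
    -- U_0 U_0 f = 0 and U_ψ U_0 f = 0 make the bracket orthogonal to all vertical vectors, hence
    -- vertical.
    have h1 : (jetFrame w c U).U0 (HolFun.mk _ (differentiableOn_fderiv_field hf
        (differentiable_frameField (w := w) (c := c) (0, 0, z, ψ)))) = 0 := by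
      rw [← jetFrame_mk hf]
      simp only [map_add, map_smul, map_zero, zero_smul, zero_add, LinearMap.zero_apply]
      rw [h.U0_U0 hC he, (jetFrame w c U).U0_U, h.U_U0 hC he, smul_zero, zero_add]
    rw [jetFrame_U0, derivU0, along_mk] at h1
    have h2 := congrArg (evalAt ⟨m, hm⟩) h1
    rw [evalAt_mk, map_zero] at h2
    have h3 : frameField w c (0, 0, -(1 / 2 * C t t t), 0) m = (-(1 / 2 * C t t t)) • ddp 0 := by
      simp [frameField_apply, fieldX, fieldU]
    rw [h3, map_smul, h2]
    simp
  obtain ⟨⟨a, b, z, φ⟩, hq⟩ := exists_frameField_eq (w := w) (c := c) hb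
  rw [← hq] at hs ⊢
  simp only [symplecticForm_frameField] at hs
  have ha : a = 0 := by simpa using hs 1 0
  have hb0 : b = 0 := (Module.forall_dual_apply_eq_zero_iff ℂ b).1 fun ψ => by simpa using hs 0 ψ
  rw [ha, hb0]
  exact frameField_vertical_mem hC ht z φ m

/-- The symmetries in terms of their generating functions. -/
theorem isSymmetry_contactField_iff (hC : IsJordanCubicForm C) :
    IsSymmetry C w c U (contactField f) ↔ (jetFrame w c U).IsSolution C (HolFun.mk f hf) := by
  refine ⟨fun h l t => ext_evalAt fun m => ?_, fun h => ⟨differentiableOn_contactField U.isOpen hf,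
    isContactField_contactField U.isOpen hf, fun l t m hm => ?_⟩⟩
  · rw [evalAt_equation, map_zero]
    -- Isotropy is available only for l ≠ 0; the value at l = 0 follows by continuity.
    have hcont : Continuous fun l => bracketForm w c (contactField f) m (coneVector C l t)
        (coneVector C l t) := by
      have h1 : ∀ l, coneVector C l t = l ^ 3 • (1, 0, 0, 0) + l ^ 2 • (0, -t, 0, 0)
          + (0, 0, -(1 / 2 * C t t t), 0) + l • (0, 0, 0, -(3 / 2 : ℂ) • C t t) := fun l => by
        refine Prod.ext ?_ (Prod.ext ?_ (Prod.ext ?_ ?_)) <;>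
          simp [coneVector, smul_smul, mul_comm]
      simp only [h1, map_add, map_smul, LinearMap.add_apply, LinearMap.smul_apply, smul_eq_mul]
      fun_prop
    refine congrFun (hcont.ext_on (dense_compl_singleton 0) continuous_const (g := fun _ => 0)
      fun l hl => ?_) l
    have h1 := symplecticForm_eq_zero_of_mem_affineTangentSpace hC hl t (h.preserves l t m m.2)
    rwa [fieldV_eq_frameField hC] at h1
  · by_cases hl : l = 0
    · rw [hl]
      exact ContactFrame.IsSolution.lieBracket_mem_zero hf hC h t hm
    · exact ContactFrame.IsSolution.lieBracket_mem_of_ne_zero hf hC h hl t hm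

end

theorem IsSymmetry.congr {U : Set (J1 d)} (hU : IsOpen U) {S S' : J1 d → J1 d}
    (h : IsSymmetry C w c U S) (hS : Set.EqOn S' S U) : IsSymmetry C w c U S' := by
  have hb : ∀ Y, ∀ m ∈ U, VectorField.lieBracket ℂ S' Y m = VectorField.lieBracket ℂ S Y m :=
    fun Y m hm => Filter.EventuallyEq.lieBracket_vectorField_eq
      (hS.eventuallyEq_of_mem (hU.mem_nhds hm)) Filter.EventuallyEq.rfl
  refine ⟨h.holomorphic.congr hS, fun Y hY hY' m hm => ?_, fun l t m hm => ?_⟩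
  · rw [hb Y m hm]
    exact h.contact Y hY hY' m hm
  · rw [hb _ m hm]
    exact h.preserves l t m hm

theorem Set.EqOn.contactField {U : Set (J1 d)} (hU : IsOpen U) {f g : J1 d → ℂ}
    (h : Set.EqOn f g U) : Set.EqOn (contactField f) (contactField g) U := fun m hm => by
  rw [contactField_eq, contactField_eq, (h.eventuallyEq_of_mem (hU.mem_nhds hm)).fderiv_eq, h hm]

theorem isSymmetry_contactField_iff_exists (hC : IsJordanCubicForm C) {U : Set (J1 d)}
    (hU : IsOpen U) (hU' : IsConnected U) {f : J1 d → ℂ} (hf : DifferentiableOn ℂ f U) :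
    IsSymmetry C w c U (contactField f) ↔
      ∃ g ∈ Submodule.span ℂ {g | ListedFunction C w c g}, Set.EqOn f g U := by
  refine (isSymmetry_contactField_iff (U := ⟨U, hU⟩) hf hC).trans ?_
  constructor
  · intro h
    obtain ⟨g, hg, hfg⟩ := ContactFrame.IsSolution.mem_listedRestrictions (U := ⟨U, hU⟩) hC hU' h
    exact ⟨g, hg, fun m hm => hfg ⟨m, hm⟩⟩
  · rintro ⟨g, hg, hfg⟩
    obtain ⟨F, hF, hFg⟩ := exists_solution_of_mem_span (U := ⟨U, hU⟩) hC hg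
    have : mk (U := ⟨U, hU⟩) f hf = F := ext_evalAt fun m => (hfg m.2).trans (hFg m).symm
    rw [this]
    exact hF

theorem differentiableOn_of_mem_span (hC : IsJordanCubicForm C) {U : Set (J1 d)}
    (hU : IsOpen U) {g : J1 d → ℂ} (hg : g ∈ Submodule.span ℂ {g | ListedFunction C w c g}) :
    DifferentiableOn ℂ g U := by
  obtain ⟨F, -, hFg⟩ := exists_solution_of_mem_span (U := ⟨U, hU⟩) hC hg
  exact (differentiableOn_extend F).congr fun m hm =>
    (hFg ⟨m, hm⟩).symm.trans (extend_apply F ⟨m, hm⟩).symm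

end Symmetries

theorem propositionP {W : Type*} [AddCommGroup W] [Module ℂ W]
    (C : W →ₗ[ℂ] W →ₗ[ℂ] W →ₗ[ℂ] ℂ) (hC : IsJordanCubicForm C)
    {d : ℕ} (w : Module.Basis (Fin d) ℂ W) (c : Fin d)
    (U : Set (J1 d)) (hU : IsOpen U) (hU' : IsConnected U) :
    (∀ S : J1 d → J1 d, IsSymmetry C w c U S ↔
      ∃ f ∈ Submodule.span ℂ {g | ListedFunction C w c g}, Set.EqOn S (contactField f) U) ∧
    (∀ f : J1 d → ℂ, DifferentiableOn ℂ f U →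
      (IsSymmetry C w c U (contactField f) ↔
        ∃ g ∈ Submodule.span ℂ {g | ListedFunction C w c g}, Set.EqOn f g U)) := by
  refine ⟨fun S => ⟨fun hS => ?_, ?_⟩,
    fun f hf => isSymmetry_contactField_iff_exists hC hU hU' hf⟩
  · obtain ⟨f, hf, hSf⟩ := hS.contact.exists_eqOn hU hS.holomorphic
    obtain ⟨g, hg, hfg⟩ := (isSymmetry_contactField_iff_exists hC hU hU' hf).1
      (hS.congr hU hSf.symm)
    exact ⟨g, hg, hSf.trans (hfg.contactField hU)⟩
  · rintro ⟨f, hf, hSf⟩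
    exact ((isSymmetry_contactField_iff_exists hC hU hU' (differentiableOn_of_mem_span hC hU hf)).2
      ⟨f, hf, fun _ _ => rfl⟩).congr hU hSf
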